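/- **Notation.** Let $\mathbb N_0=\{0,1,2,\dots\}$ and $s\ge 0$. For $r>0$ let $D_r=\{z\in\mathbb C:|z|<r\}$ and let $G_s(r)$ be the space of those $u=\sum_n u_nz^n\in\mathbb C[[z]]$ for which there are $A,C>0$ with $|u_n|\le AC^n\Gamma(1+sn)$ for all $n$, and for which $\sum_n \frac{u_n}{\Gamma(1+sn)}z^n$ is holomorphic on $D_r$. For positive radii $(r(n))_{n\in\mathbb N_0}$ let $(G_s(r(n)))_n[[t]]$ be the space of all $\sum_n u_n(z)t^n$ with $u_n\in G_s(r(n))$ for every $n$. Let $$P(\partial_t,\partial_z)=\sum_{(q,r)\in\Delta}a_{qr}(t,z)\,\partial_t^q\partial_z^r,$$ where $\Delta\subset\mathbb N_0\times\mathbb N_0$ is finite and, for some fixed $\rho>0$, all $a_{qr}\ne 0$ are formal power series in $t$ with coefficients in $G_s(\rho)$. Assume that $\Delta\neq\emptyset$ and that $m:=\max_{(q,r)\in\Delta}(q-\mathrm{ord}_t a_{qr})\ge 0$, and let $\partial_t^{-1}$ be the formal integration $t^n\mapsto t^{n+1}/(n+1)$. Put $\Delta_m=\{(q,r)\in\Delta: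 q-\mathrm{ord}_t a_{qr}=m\}$. For $(q,r)\in\Delta_m$ let $a_{q,r,q-m}(z)$ be the coefficient of $t^{q-m}$ in $a_{qr}$, and write $a_{q,r,q-m}(z)=z^{\alpha_{qr}}\tilde a_{q,r,q-m}(z)$ with $\tilde a_{q,r,q-m}(0)\ne0$. With $n^{\underline{d}}=n(n-1)\cdots(n-d+1)$, let $$\tilde P_m(n,\partial_z)=\sum_{(q,r)\in\Delta_m}a_{q,r,q-m}(z)\,n^{\underline{q-m}}\,\partial_z^r\qquad(n\in\mathbb N_0).$$ For an operator $L=\sum_r c_r(z)\partial_z^r$ (a finite sum) the Newton polygon $N(L)$ is the convex hull of the union of the sets $\{(x,y)\in\mathbb R^2: x\le r,\ y\ge \mathrm{ord}_z c_r-r\}$ over all $r$ with $c_r\neq0$. Its lower ordinate is the minimum of $y$ on $N(L)$. Its first positive slope is the slope of the edge which starts at the right end of the horizontal bottom edge; it is $\infty$ if that edge is vertical. For $j\in\mathbb N_0$ let $\Delta_{m,j}=\{(q,r)\in\Delta_m:\alpha_{qr}-r=j\}$ and $$W_{m,0}(n,k,0)=\sum_{(q,r)\in\Delta_{m,0}}\tilde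 a_{q,r,q-m}(0)\,n^{\underline{q-m}}\,k^{\underline{r}}.$$ Let $p=\max\{r:(q,r)\in\Delta_{m,0}\}$, let $\deg w_{ij}=\max\{q-m:(q,i)\in\Delta_{m,j}\}$ (and $\deg w_{ij}=0$ if there is no such $q$), and let $$\alpha=\max\Big(0,\max_{j\ge1,\ js\in\mathbb N_0}\frac{\deg w_{p+js,j}-\deg w_{p0}}{j}\Big).$$ **Theorem.** Assume that (a) for every $n\in\mathbb N_0$ the lower ordinate of the Newton polygon $N(\tilde P_m(n,\partial_z))$ is $0$; (b) for every $n\in\mathbb N_0$ the first positive slope of $N(\tilde P_m(n,\partial_z))$ is at least $1/s$ (where $1/0=\infty$); (c) there is $C_0>0$ with $|W_{m,0}(n,k,0)|\ge C_0$ for all $n,k\in\mathbb N_0$. Then $P(\partial_t,\partial_z)\partial_t^{-m}$ is a linear automorphism of $\mathbb C[[t,z]]$, and for some $a>0$ it induces a linear automorphism of $(G_s(a(n+1)^{-\alpha}))_{n\in\mathbb N_0}[[t]]$. Moreover, if $\alpha>0$, then for every real $\tilde\alpha<\alpha$ and every $a>0$ it does not induce a linear automorphism of $(G_s(a(n+1)^{-\tilde\alpha}))_{n\in\mathbb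 N_0}[[t]]$. -/

import Mathlib

open scoped NNReal ENNReal

noncomputable section

namespace GevreyDisc

/-! ### Formal power series of Gevrey order `s` -/

/-- `ℂ[[z]]`. -/
abbrev SeriesZ : Type := PowerSeries ℂ

/-- `ℂ[[t,z]] = ℂ[[z]][[t]]`: the outer variable is `t`, the inner variable is `z`. -/
abbrev SeriesTZ : Type := PowerSeries (PowerSeries ℂ)

/-- The coefficients satisfy `|u_n| ≤ A C^n Γ(1+sn)` for all `n`, for some `A, C > 0`. -/
def IsGevrey (s : ℝ≥0) (u : SeriesZ) : Prop :=
  ∃ A > (0 : ℝ), ∃ C > (0 : ℝ), ∀ n : ℕ,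
    ‖PowerSeries.coeff n u‖ ≤ A * C ^ n * Real.Gamma (1 + s * n)

/-- The series `∑ u_n / Γ(1+sn) z^n` is (the Taylor series of) a holomorphic function on the
open disc `D_r`. -/
def BorelHolomorphic (s : ℝ≥0) (r : ℝ) (u : SeriesZ) : Prop :=
  ∃ f : ℂ → ℂ, DifferentiableOn ℂ f (Metric.ball 0 r) ∧
    ∀ z ∈ Metric.ball (0 : ℂ) r,
      HasSum (fun n : ℕ => PowerSeries.coeff n u / (Real.Gamma (1 + s * n) : ℂ) * z ^ n) (f z)

theorem gamma_pos (s : ℝ≥0) (n : ℕ) : 0 < Real.Gamma (1 + s * n) :=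
  Real.Gamma_pos_of_pos (by positivity)

/-- The space `G_s(r)`. -/
def gevreyDisc (s : ℝ≥0) (r : ℝ) : Submodule ℂ SeriesZ where
  carrier := {u | IsGevrey s u ∧ BorelHolomorphic s r u}
  zero_mem' := by
    refine ⟨⟨1, one_pos, 1, one_pos, fun n => ?_⟩, fun _ => 0, differentiableOn_const 0,
      fun z _ => ?_⟩
    · simpa using (gamma_pos s n).le
    · simp only [map_zero, zero_div, zero_mul]
      exact hasSum_zero
  add_mem' := by
    rintro u v ⟨⟨A, hA, C, hC, hu⟩, f, hf, hfs⟩ ⟨⟨A', hA', C', hC', hv⟩, g, hg, hgs⟩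
    refine ⟨⟨A + A', by positivity, max C C', lt_max_of_lt_left hC, fun n => ?_⟩,
      fun z => f z + g z, hf.add hg, fun z hz => ?_⟩
    · have hG := (gamma_pos s n).le
      have h1 : C ^ n ≤ max C C' ^ n := pow_le_pow_left₀ hC.le (le_max_left _ _) n
      have h2 : C' ^ n ≤ max C C' ^ n := pow_le_pow_left₀ hC'.le (le_max_right _ _) n
      calc ‖PowerSeries.coeff n (u + v)‖
          ≤ ‖PowerSeries.coeff n u‖ + ‖PowerSeries.coeff n v‖ := by
            rw [map_add]; exact norm_add_le _ _
        _ ≤ A * C ^ n * Real.Gamma (1 + s * n) + A' * C' ^ n * Real.Gamma (1 + s * n) :=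
            add_le_add (hu n) (hv n)
        _ ≤ A * max C C' ^ n * Real.Gamma (1 + s * n)
              + A' * max C C' ^ n * Real.Gamma (1 + s * n) := by gcongr
        _ = (A + A') * max C C' ^ n * Real.Gamma (1 + s * n) := by ring
    · have h := (hfs z hz).add (hgs z hz)
      have he : (fun n : ℕ => PowerSeries.coeff n (u + v) /
          (Real.Gamma (1 + s * n) : ℂ) * z ^ n) = fun n : ℕ =>
          PowerSeries.coeff n u / (Real.Gamma (1 + s * n) : ℂ) * z ^ n
            + PowerSeries.coeff n v / (Real.Gamma (1 + s * n) : ℂ) * z ^ n := by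
        funext n
        rw [map_add]
        ring
      rw [he]
      exact h
  smul_mem' := by
    rintro c u ⟨⟨A, hA, C, hC, hu⟩, f, hf, hfs⟩
    refine ⟨⟨(‖c‖ + 1) * A, by positivity, C, hC, fun n => ?_⟩, fun z => c * f z,
      hf.const_mul c, fun z hz => ?_⟩
    · have hG := (gamma_pos s n).le
      calc ‖PowerSeries.coeff n (c • u)‖ = ‖c‖ * ‖PowerSeries.coeff n u‖ := by
            rw [PowerSeries.coeff_smul, norm_smul]
        _ ≤ (‖c‖ + 1) * (A * C ^ n * Real.Gamma (1 + s * n)) := by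
            gcongr
            · linarith
            · exact hu n
        _ = (‖c‖ + 1) * A * C ^ n * Real.Gamma (1 + s * n) := by ring
    · have h := (hfs z hz).mul_left c
      have he : (fun n : ℕ => PowerSeries.coeff n (c • u) /
          (Real.Gamma (1 + s * n) : ℂ) * z ^ n) = fun n : ℕ =>
          c * (PowerSeries.coeff n u / (Real.Gamma (1 + s * n) : ℂ) * z ^ n) := by
        funext n
        rw [PowerSeries.coeff_smul, smul_eq_mul]
        ring
      rw [he]
      exact h

/-- The space `(G_s(r(n)))_{n}[[t]]` of the series `∑ u_n(z) t^n` with `u_n ∈ G_s(r(n))` for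
every `n`. -/
def gevreyDiscSeries (s : ℝ≥0) (r : ℕ → ℝ) : Submodule ℂ SeriesTZ where
  carrier := {u | ∀ n : ℕ, PowerSeries.coeff n u ∈ gevreyDisc s (r n)}
  zero_mem' := fun n => by simp
  add_mem' := fun {u v} hu hv n => by
    rw [map_add]; exact (gevreyDisc s (r n)).add_mem (hu n) (hv n)
  smul_mem' := fun c u hu n => (gevreyDisc s (r n)).smul_mem c (hu n)

/-! ### The operators `P(∂_t,∂_z)` and `P(∂_t,∂_z) ∂_t^{-m}` -/

theorem coeff_smul_seriesTZ (c : ℂ) (u : SeriesTZ) (n : ℕ) :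
    PowerSeries.coeff n (c • u) = c • PowerSeries.coeff n u := rfl

/-- The derivation `∂_t`. -/
def dt : SeriesTZ →ₗ[ℂ] SeriesTZ where
  toFun u := PowerSeries.mk fun n => ((n : ℂ) + 1) • PowerSeries.coeff (n + 1) u
  map_add' u v := by ext n : 1; simp
  map_smul' c u := by
    ext n : 1
    simp only [PowerSeries.coeff_mk, RingHom.id_apply, coeff_smul_seriesTZ]
    exact smul_comm _ _ _

/-- The derivation `∂_z`. -/
def dz : SeriesTZ →ₗ[ℂ] SeriesTZ where
  toFun u := PowerSeries.mk fun n => PowerSeries.derivative ℂ (PowerSeries.coeff n u)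
  map_add' u v := by ext n : 1; simp
  map_smul' c u := by
    ext n : 1
    simp only [PowerSeries.coeff_mk, RingHom.id_apply, coeff_smul_seriesTZ]
    exact (PowerSeries.derivative ℂ).map_smul c (PowerSeries.coeff n u)

/-- The formal integration `∂_t^{-1}`, `t^n ↦ t^{n+1}/(n+1)`. -/
def dtInv : SeriesTZ →ₗ[ℂ] SeriesTZ where
  toFun u := PowerSeries.mk fun n =>
    if n = 0 then 0 else (n : ℂ)⁻¹ • PowerSeries.coeff (n - 1) u
  map_add' u v := by
    ext n : 1
    by_cases h : n = 0 <;> simp [h]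
  map_smul' c u := by
    ext n : 1
    by_cases h : n = 0
    · simp [h]
    · simp only [PowerSeries.coeff_mk, RingHom.id_apply, coeff_smul_seriesTZ, h, if_false]
      exact smul_comm _ _ _

/-- The data of an operator `P(∂_t,∂_z) = ∑_{(q,r) ∈ Δ} a_{qr}(t,z) ∂_t^q ∂_z^r`: the finite index
set `Δ` is the support, and `P (q, r) = a_{qr}`. -/
abbrev Operator : Type := (ℕ × ℕ) →₀ SeriesTZ

/-- The operator `P(∂_t,∂_z)` acting on `ℂ[[t,z]]`. -/
def Operator.act (P : Operator) : SeriesTZ →ₗ[ℂ] SeriesTZ :=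
  ∑ x ∈ P.support, LinearMap.mulLeft ℂ (P x) ∘ₗ (dt ^ x.1) ∘ₗ (dz ^ x.2)

/-- The operator `P(∂_t,∂_z) ∂_t^{-m}` acting on `ℂ[[t,z]]`. -/
def Operator.actInt (P : Operator) (m : ℕ) : SeriesTZ →ₗ[ℂ] SeriesTZ :=
  P.act ∘ₗ (dtInv ^ m)

/-- `q - ord_t(a_{qr})`, for `x = (q, r)` with `a_{qr} ≠ 0`. -/
def Operator.timeShift (P : Operator) (x : ℕ × ℕ) : ℤ := (x.1 : ℤ) - ((P x).order.toNat : ℤ)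

/-- `m = max_{(q,r) ∈ Δ} (q - ord_t(a_{qr}))`; as `m` is a natural number, this says as well that
`Δ` is nonempty and that the maximum is nonnegative. -/
def Operator.HasTimeOrder (P : Operator) (m : ℕ) : Prop :=
  IsGreatest {i : ℤ | ∃ x ∈ P.support, i = P.timeShift x} (m : ℤ)

/-- `Δ_m = {(q,r) ∈ Δ : q - ord_t(a_{qr}) = m}`. -/
def Operator.principal (P : Operator) (m : ℕ) : Finset (ℕ × ℕ) :=
  P.support.filter fun x => P.timeShift x = m

/-- `a_{q,r,q-m}(z)`, the coefficient of `t^{q-m}` in `a_{qr}(t,z)`. It is the lowest one of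
`a_{qr}`, and `m ≤ q`, if `(q,r) ∈ Δ_m`. -/
def Operator.leadCoeff (P : Operator) (m : ℕ) (x : ℕ × ℕ) : SeriesZ :=
  PowerSeries.coeff (x.1 - m) (P x)

/-- `α_{qr} = ord_z(a_{q,r,q-m})`, for `(q,r) ∈ Δ_m`. -/
def Operator.ordZ (P : Operator) (m : ℕ) (x : ℕ × ℕ) : ℕ := (P.leadCoeff m x).order.toNat

/-- `Δ_{m,j} = {(q,r) ∈ Δ_m : α_{qr} - r = j}`. -/
def Operator.principalAt (P : Operator) (m j : ℕ) : Finset (ℕ × ℕ) :=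
  (P.principal m).filter fun x => (P.ordZ m x : ℤ) - (x.2 : ℤ) = j

/-! ### Newton polygons of ordinary differential operators in `z` -/

/-- `{(x,y) : x ≤ a, y ≥ b}`. -/
def corner (a b : ℝ) : Set (ℝ × ℝ) := {z | z.1 ≤ a ∧ b ≤ z.2}

/-- The Newton polygon of the differential operator `∑_r c_r(z) ∂_z^r` (a finite sum): the convex
hull of the union of the corners at the points `(r, ord_z(c_r) - r)` with `c_r ≠ 0`. -/
def newtonPolygon (c : ℕ →₀ SeriesZ) : Set (ℝ × ℝ) :=
  convexHull ℝ (⋃ r ∈ c.support, corner (r : ℝ) (((c r).order.toNat : ℝ) - (r : ℝ)))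

/-- `l` is the lower ordinate of `N`. -/
def IsLowerOrdinate (N : Set (ℝ × ℝ)) (l : ℝ) : Prop := IsLeast (Prod.snd '' N) l

/-- `v` is the right end point of the horizontal bottom edge of `N`. -/
def IsBottomVertex (N : Set (ℝ × ℝ)) (v : ℝ × ℝ) : Prop :=
  v ∈ N ∧ (∀ w ∈ N, v.2 ≤ w.2) ∧ ∀ w ∈ N, w.2 = v.2 → w.1 ≤ v.1

/-- The first positive slope of the polygon `N`, i.e. the slope of the edge that starts at the right
end point of the bottom edge; it is `∞` if that edge is vertical. -/
def firstPositiveSlope (N : Set (ℝ × ℝ)) : ℝ≥0∞ :=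
  ⨅ (v : ℝ × ℝ) (_ : IsBottomVertex N v) (w : ℝ × ℝ) (_ : w ∈ N ∧ v.1 < w.1),
    ENNReal.ofReal ((w.2 - v.2) / (w.1 - v.1))

/-! ### The operators `P̃_m(n,∂_z)`, the numbers `W_{m,0}(n,k,0)` and the exponent `α` -/

/-- The operator
`P̃_m(n,∂_z) = ∑_{(q,r) ∈ Δ_m} a_{q,r,q-m}(z) n(n-1)⋯(n-(q-m)+1) ∂_z^r` as the family of its
coefficients at the powers `∂_z^r`. -/
def Operator.reduced (P : Operator) (m n : ℕ) : ℕ →₀ SeriesZ :=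
  ∑ x ∈ P.principal m,
    Finsupp.single x.2 ((n.descFactorial (x.1 - m) : ℂ) • P.leadCoeff m x)

/-- `W_{m,0}(n,k,0) = ∑_{(q,r) ∈ Δ_{m,0}} ã_{q,r,q-m}(0) n(n-1)⋯(n-(q-m)+1) k(k-1)⋯(k-r+1)`, where
`a_{q,r,q-m}(z) = z^{α_{qr}} ã_{q,r,q-m}(z)`. -/
def Operator.resonance (P : Operator) (m n k : ℕ) : ℂ :=
  ∑ x ∈ P.principalAt m 0,
    PowerSeries.coeff (P.ordZ m x) (P.leadCoeff m x)
      * (n.descFactorial (x.1 - m) : ℂ) * (k.descFactorial x.2 : ℂ)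

/-- `p = max {r : (q,r) ∈ Δ_{m,0}}`. -/
def Operator.topOrder (P : Operator) (m : ℕ) : ℕ := (P.principalAt m 0).sup Prod.snd

/-- `deg w_{ij} = max {q - m : (q,i) ∈ Δ_{m,j}}`, which is `0` if there is no such `q`. -/
def Operator.degW (P : Operator) (m i j : ℕ) : ℕ :=
  ((P.principalAt m j).filter fun x => x.2 = i).sup fun x => x.1 - m

/-- `α = max (0, max_{j ≥ 1, js ∈ ℕ₀} (deg w_{p+js,j} - deg w_{p0}) / j)`. Almost all of the numbers
`deg w_{p+js,j}` are zero, so the maximum exists. -/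
def Operator.exponent (P : Operator) (m : ℕ) (s : ℝ≥0) : ℝ :=
  sSup (insert 0 {x : ℝ | ∃ i j : ℕ, 1 ≤ j ∧ (i : ℝ) = j * s ∧
    x = ((P.degW m (P.topOrder m + i) j : ℝ) - (P.degW m (P.topOrder m) 0 : ℝ)) / j})

/-! ### Automorphisms -/

/-- The linear map `T` is an automorphism of `ℂ[[t,z]]`. -/
def IsAutomorphism (T : SeriesTZ →ₗ[ℂ] SeriesTZ) : Prop :=
  ∃ e : SeriesTZ ≃ₗ[ℂ] SeriesTZ, ∀ u, e u = T u

/-- The linear map `T` of `ℂ[[t,z]]` induces an automorphism of the subspace `V`. -/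
def IsAutomorphismOn (T : SeriesTZ →ₗ[ℂ] SeriesTZ) (V : Submodule ℂ SeriesTZ) : Prop :=
  ∃ e : V ≃ₗ[ℂ] V, ∀ u : V, (e u : SeriesTZ) = T u

end GevreyDisc

end

noncomputable section

namespace GevreyDisc

/-! ### Estimates for the Gamma function -/

/-! Write `u = ∑ u_n t^n`. By the definition of `m`, no term of `P ∂_t^{-m}` lowers the degree in
`t`, so the coefficient of `t^N` in the image is an expression in `u_0, …, u_{N-1}` plus `P̃_m(N,
∂_z) u_N` (`Operator.coeff_actInt`). Everything reduces to the ordinary differential operators on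
the diagonal. By (a) these do not lower the degree in `z` either: they send `z^i` to `∑_{j ≥ 0}
W_j(i) z^{i+j}`, where `W_0(k)` is the number `W_{m,0}(n,k,0)`, nonzero by (c). Two triangular
recursions give the automorphism of `ℂ[[t,z]]`.

For the Gevrey spaces, `G_s(r)` is described by boundedness of `|u_k| R^k / Γ(1+sk)` for all `R < r`
(`mem_gevreyDisc_iff`). By (b), a nonzero coefficient of `z^{j+r} ∂_z^r` satisfies `r ≤ p + js`.
Gamma estimates then bound `W_j(i)`, relative to `W_0(i+j)` in these weights, by the size of the
coefficient on the edge `r = p + js`, plus a term that tends to zero as `i + j` grows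
(`exists_symbol_le`). On the edge, the coefficients of `P̃_m(n, ∂_z)` divided by the one at the
vertex are `O((C n^α)^j Γ(1+sj))`, by the definition of `α` (`Operator.Admissible.degree_le`). So on
radii at most `ε n^{-α}` the diagonal dominates in high degrees, and solutions inherit the bounds
(`borelBounded_of_odeAct`, `exists_radius`). The finitely many small `n` only shrink `a`. As the
radii decrease in `n` and the spaces are closed under products and derivatives, the recursion in `t`
stays inside them.

For sharpness let `J` be the largest index at which `α` is attained. At radius `x n^{-α}` with `x`
and `n` large, the edge term with index `J` exceeds the sum of all others, the diagonal included:
those with `j < J` grow at most like `x^{J-1}`, those with `j > J` carry an extra power `n^{-ηj}`,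
and those off the edge decay. Summing the equations for the coefficients of a solution of `P̃_m(n,
∂_z) u = z^K` then shows that it cannot have a larger radius (`false_of_dominant`, `exists_scale`).
An automorphism for an exponent below `α` would provide such a solution, as the component at `t^n`
of the preimage of `z^K t^n`. -/

/-- Log-convexity: `1+a` and `1+b` are convex combinations of `1` and `1+a+b` with complementary
weights, and `log Γ(1) = 0`. -/
theorem Gamma_one_add_mul_le {a b : ℝ} (ha : 0 ≤ a) (hb : 0 ≤ b) :
    Real.Gamma (1 + a) * Real.Gamma (1 + b) ≤ Real.Gamma (1 + a + b) := by
  rcases ha.eq_or_lt with rfl | ha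
  · simp
  have hab : 0 < a + b := by positivity
  have h1 := Real.convexOn_log_Gamma.2 (show (1 : ℝ) ∈ Set.Ioi 0 by simp)
    (show 1 + a + b ∈ Set.Ioi 0 by simp only [Set.mem_Ioi]; positivity)
    (show 0 ≤ b / (a + b) by positivity) (show 0 ≤ a / (a + b) by positivity) (by field_simp; ring)
  have h2 := Real.convexOn_log_Gamma.2 (show (1 : ℝ) ∈ Set.Ioi 0 by simp)
    (show 1 + a + b ∈ Set.Ioi 0 by simp only [Set.mem_Ioi]; positivity)
    (show 0 ≤ a / (a + b) by positivity) (show 0 ≤ b / (a + b) by positivity) (by field_simp)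
  have e1 : (b / (a + b)) • (1 : ℝ) + (a / (a + b)) • (1 + a + b) = 1 + a := by
    simp only [smul_eq_mul]; field_simp; ring
  have e2 : (a / (a + b)) • (1 : ℝ) + (b / (a + b)) • (1 + a + b) = 1 + b := by
    simp only [smul_eq_mul]; field_simp; ring
  rw [e1] at h1
  rw [e2] at h2
  simp only [Function.comp_apply, smul_eq_mul, Real.Gamma_one, Real.log_one, mul_zero,
    zero_add] at h1 h2
  have g1 : 0 < Real.Gamma (1 + a) := Real.Gamma_pos_of_pos (by positivity)
  have g2 : 0 < Real.Gamma (1 + b) := Real.Gamma_pos_of_pos (by positivity)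
  have g3 : 0 < Real.Gamma (1 + a + b) := Real.Gamma_pos_of_pos (by positivity)
  rw [← Real.log_le_log_iff (by positivity) g3, Real.log_mul g1.ne' g2.ne']
  have e3 : a / (a + b) * Real.log (Real.Gamma (1 + a + b)) +
      b / (a + b) * Real.log (Real.Gamma (1 + a + b)) = Real.log (Real.Gamma (1 + a + b)) := by
    field_simp
  linarith

theorem log_Gamma_add_one {y : ℝ} (hy : 0 < y) :
    Real.log (Real.Gamma (y + 1)) = Real.log y + Real.log (Real.Gamma y) := by
  rw [Real.Gamma_add_one hy.ne', Real.log_mul hy.ne' (Real.Gamma_pos_of_pos hy).ne']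

/-- The slope of `log Γ` on `[y, y+δ]` is at most that on `[y+δ, y+δ+1]`, which is `log (y+δ)` by
the functional equation. -/
theorem Gamma_add_le {y δ : ℝ} (hy : 0 < y) (hδ : 0 ≤ δ) :
    Real.Gamma (y + δ) ≤ (y + δ) ^ δ * Real.Gamma y := by
  rcases hδ.eq_or_lt with rfl | hδ
  · simp
  have h := Real.convexOn_log_Gamma.slope_mono_adjacent (x := y) (y := y + δ) (z := y + δ + 1)
    hy (by simp only [Set.mem_Ioi]; positivity) (by linarith) (by linarith)
  simp only [Function.comp_apply, log_Gamma_add_one (by positivity : 0 < y + δ)] at h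
  have e1 : y + δ - y = δ := by ring
  have e2 : y + δ + 1 - (y + δ) = 1 := by ring
  rw [e1, e2, div_one, div_le_iff₀ hδ] at h
  have g1 : 0 < Real.Gamma y := Real.Gamma_pos_of_pos hy
  have g2 : 0 < Real.Gamma (y + δ) := Real.Gamma_pos_of_pos (by positivity)
  have g3 : 0 < (y + δ) ^ δ := by positivity
  rw [← Real.log_le_log_iff g2 (by positivity), Real.log_mul g3.ne' g1.ne',
    Real.log_rpow (by positivity)]
  linarith

/-- The slope of `log Γ` on `[y, y+1]` is `log y` and is at most that on `[y+1, y+1+δ]`. -/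
theorem le_Gamma_one_add_add {y δ : ℝ} (hy : 0 ≤ y) (hδ : 0 ≤ δ) :
    y ^ δ * Real.Gamma (1 + y) ≤ Real.Gamma (1 + y + δ) := by
  rcases hδ.eq_or_lt with rfl | hδ
  · simp
  rcases hy.eq_or_lt with rfl | hy
  · rw [Real.zero_rpow hδ.ne', zero_mul]
    exact (Real.Gamma_pos_of_pos (by positivity)).le
  have h := Real.convexOn_log_Gamma.slope_mono_adjacent (x := y) (y := y + 1) (z := y + 1 + δ)
    hy (by simp only [Set.mem_Ioi]; positivity) (by linarith) (by linarith)
  simp only [Function.comp_apply, log_Gamma_add_one hy] at h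
  have e1 : y + 1 - y = 1 := by ring
  have e2 : y + 1 + δ - (y + 1) = δ := by ring
  rw [e1, e2, div_one, le_div_iff₀ hδ, ← log_Gamma_add_one hy] at h
  rw [add_comm 1 y]
  have g1 : 0 < Real.Gamma (y + 1) := Real.Gamma_pos_of_pos (by positivity)
  have g2 : 0 < Real.Gamma (y + 1 + δ) := Real.Gamma_pos_of_pos (by positivity)
  have g3 : 0 < y ^ δ := by positivity
  rw [← Real.log_le_log_iff (by positivity) g2, Real.log_mul g3.ne' g1.ne', Real.log_rpow hy]
  rw [log_Gamma_add_one hy] at h ⊢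
  linarith

/-! ### Elementary estimates -/

theorem exists_one_add_pow_mul_pow_le (N : ℕ) {q : ℝ} (h0 : 0 < q) (h1 : q < 1) :
    ∃ C > (0 : ℝ), ∀ j : ℕ, (1 + (j : ℝ)) ^ N * q ^ j ≤ C := by
  have h := tendsto_pow_const_mul_const_pow_of_abs_lt_one N (r := q) (by rwa [abs_of_pos h0])
  obtain ⟨C, hC⟩ := h.bddAbove_range
  refine ⟨(max C 1) / q, by positivity, fun j => ?_⟩
  have := hC ⟨j + 1, rfl⟩
  simp only [Nat.cast_add, Nat.cast_one] at this
  rw [le_div_iff₀ h0]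
  calc (1 + (j : ℝ)) ^ N * q ^ j * q = ((j : ℝ) + 1) ^ N * q ^ (j + 1) := by ring
    _ ≤ _ := this.trans (le_max_left _ _)

theorem exists_one_add_pow_le (N : ℕ) :
    ∃ C > (0 : ℝ), ∀ j : ℕ, (1 + (j : ℝ)) ^ N ≤ C * 2 ^ j := by
  obtain ⟨C, hC, h⟩ := exists_one_add_pow_mul_pow_le N (q := 1 / 2) (by norm_num) (by norm_num)
  refine ⟨C, hC, fun j => ?_⟩
  have := h j
  rw [one_div, inv_pow, ← div_eq_mul_inv, div_le_iff₀ (by positivity)] at this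
  exact this

theorem exists_pos_le_of_finset {ι : Type*} (F : Finset ι) (f : ι → ℝ) (h : ∀ x ∈ F, 0 < f x) :
    ∃ δ > (0 : ℝ), ∀ x ∈ F, δ ≤ f x := by
  rcases F.eq_empty_or_nonempty with rfl | hF
  · exact ⟨1, one_pos, by simp⟩
  · obtain ⟨x, hx, hmin⟩ := F.exists_min_image f hF
    exact ⟨f x, h x hx, hmin⟩

theorem tendsto_descFactorial_div (e d : ℕ) (hed : e ≤ d) :
    Filter.Tendsto (fun n : ℕ => (n.descFactorial e : ℝ) / (1 + (n : ℝ)) ^ d) Filter.atTop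
      (nhds (if e = d then 1 else 0)) := by
  have h1 : Filter.Tendsto (fun n : ℕ => (n.descFactorial e : ℝ) / (n : ℝ) ^ e) Filter.atTop
      (nhds 1) := by
    refine (Asymptotics.isEquivalent_iff_tendsto_one ?_).1 (isEquivalent_descFactorial e)
    filter_upwards [Filter.eventually_gt_atTop 0] with n hn
    positivity
  have h2 : Filter.Tendsto (fun n : ℕ => (n : ℝ) / (1 + (n : ℝ))) Filter.atTop (nhds 1) := by
    have := tendsto_natCast_div_add_atTop (𝕜 := ℝ) 1
    simpa [add_comm] using this
  have h3 : Filter.Tendsto (fun n : ℕ => (1 + (n : ℝ))⁻¹) Filter.atTop (nhds 0) := by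
    have := tendsto_one_div_add_atTop_nhds_zero_nat (𝕜 := ℝ)
    simpa [add_comm] using this
  have h4 := (h1.mul (h2.pow e)).mul (h3.pow (d - e))
  have e1 : (1 * 1 ^ e * 0 ^ (d - e) : ℝ) = if e = d then 1 else 0 := by
    split_ifs with h
    · simp [h]
    · rw [zero_pow (by omega)]; simp
  rw [e1] at h4
  refine h4.congr' ?_
  filter_upwards [Filter.eventually_gt_atTop 0] with n hn
  have hn' : (0 : ℝ) < n := by exact_mod_cast hn
  have : (1 + (n : ℝ)) ^ d = (1 + (n : ℝ)) ^ e * (1 + (n : ℝ)) ^ (d - e) := by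
    rw [← pow_add]; congr 1; omega
  rw [this, div_pow, inv_pow]
  field_simp

/-- Terms with vanishing coefficient are exempt from the degree bound because the Newton polygon
only constrains nonzero coefficients. -/
theorem tendsto_sum_descFactorial_div {ι : Type*} (F : Finset ι) (a : ι → ℂ) (e : ι → ℕ) (d : ℕ)
    (h : ∀ x ∈ F, a x ≠ 0 → e x ≤ d) :
    Filter.Tendsto (fun n : ℕ => (∑ x ∈ F, a x * (n.descFactorial (e x) : ℂ)) /
      ((1 + (n : ℝ) : ℝ) : ℂ) ^ d) Filter.atTop (nhds (∑ x ∈ F with e x = d, a x)) := by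
  have key : ∀ x ∈ F, Filter.Tendsto (fun n : ℕ => a x * (n.descFactorial (e x) : ℂ) /
      ((1 + (n : ℝ) : ℝ) : ℂ) ^ d) Filter.atTop (nhds (if e x = d then a x else 0)) := by
    intro x hx
    by_cases hax : a x = 0
    · simp [hax]
    have h1 := ((Complex.continuous_ofReal.tendsto _).comp
      (tendsto_descFactorial_div (e x) d (h x hx hax))).const_mul (a x)
    have e1 : a x * ((if e x = d then 1 else 0 : ℝ) : ℂ) = if e x = d then a x else 0 := by
      split_ifs <;> simp
    rw [e1] at h1
    refine h1.congr fun n => ?_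
    simp only [Function.comp_apply]
    push_cast
    ring
  have h2 := tendsto_finsetSum F key
  rw [Finset.sum_filter]
  refine h2.congr fun n => ?_
  rw [Finset.sum_div]

theorem eventually_norm_bounds {f : ℕ → ℂ} {d : ℕ} {l : ℂ} (hl : l ≠ 0)
    (h : Filter.Tendsto (fun n : ℕ => f n / ((1 + (n : ℝ) : ℝ) : ℂ) ^ d) Filter.atTop (nhds l)) :
    ∀ᶠ n : ℕ in Filter.atTop, ‖l‖ * (1 + (n : ℝ)) ^ d ≤ 2 * ‖f n‖ ∧
      ‖f n‖ ≤ 2 * ‖l‖ * (1 + (n : ℝ)) ^ d := by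
  have hl' : 0 < ‖l‖ := norm_pos_iff.2 hl
  have h1 := h.norm
  filter_upwards [h1.eventually (lt_mem_nhds (show ‖l‖ / 2 < ‖l‖ by linarith)),
    h1.eventually (gt_mem_nhds (show ‖l‖ < 2 * ‖l‖ by linarith))] with n hn1 hn2
  have hp : (0 : ℝ) < (1 + (n : ℝ)) ^ d := by positivity
  have e1 : ‖f n / ((1 + (n : ℝ) : ℝ) : ℂ) ^ d‖ = ‖f n‖ / (1 + (n : ℝ)) ^ d := by
    rw [norm_div, norm_pow, Complex.norm_real, Real.norm_of_nonneg (by positivity)]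
  rw [e1] at hn1 hn2
  rw [lt_div_iff₀ hp] at hn1
  rw [div_lt_iff₀ hp] at hn2
  constructor <;> linarith

/-! ### Ratios of Gamma functions against powers -/

theorem gamma_mul_le (s : ℝ≥0) (i j : ℕ) :
    Real.Gamma (1 + s * i) * Real.Gamma (1 + s * j) ≤ Real.Gamma (1 + s * (i + j : ℕ)) := by
  have := Gamma_one_add_mul_le (a := s * i) (b := s * j) (by positivity) (by positivity)
  convert this using 2
  push_cast
  ring

/-- An amount `E ≤ js` of Gamma growth is moved from `j` to `i`: up to polynomial factors in `j`,
`Γ(1+sj)` is at most `Γ(1+sj-E)`, while `(si)^E Γ(1+si) ≤ Γ(1+si+E)`. Then `Gamma_one_add_mul_le`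
recombines the two. -/
theorem exists_rpow_mul_gamma_le (s : ℝ≥0) (N : ℕ) :
    ∃ c > (0 : ℝ), ∀ (i j : ℕ) (E : ℝ), 0 ≤ E → E ≤ N → E ≤ j * s →
      (1 + (i : ℝ)) ^ E * (Real.Gamma (1 + s * i) * Real.Gamma (1 + s * j)) ≤
        c * (1 + (j : ℝ)) ^ N * Real.Gamma (1 + s * (i + j : ℕ)) := by
  refine ⟨(1 + 2 / s) ^ N * (1 + s) ^ N, by positivity, fun i j E hE0 hEN hEj => ?_⟩
  have gi := gamma_pos s i
  have gj := gamma_pos s j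
  have gk := gamma_pos s (i + j)
  have hs0 : (0 : ℝ) ≤ s := s.2
  have h1 : (1 : ℝ) ≤ (1 + 2 / s) ^ N := one_le_pow₀ (by linarith [show (0 : ℝ) ≤ 2 / s by positivity])
  have h2 : (1 : ℝ) ≤ (1 + (s : ℝ)) ^ N := one_le_pow₀ (by linarith)
  have h3 : (1 : ℝ) ≤ (1 + (j : ℝ)) ^ N := one_le_pow₀ (by linarith [show (0 : ℝ) ≤ j by positivity])
  have hc : (1 : ℝ) ≤ (1 + 2 / (s : ℝ)) ^ N * (1 + (s : ℝ)) ^ N * (1 + (j : ℝ)) ^ N :=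
    one_le_mul_of_one_le_of_one_le (one_le_mul_of_one_le_of_one_le h1 h2) h3
  have hbase : Real.Gamma (1 + s * i) * Real.Gamma (1 + s * j) ≤
      (1 + 2 / (s : ℝ)) ^ N * (1 + (s : ℝ)) ^ N * (1 + (j : ℝ)) ^ N *
        Real.Gamma (1 + s * (i + j : ℕ)) :=
    (gamma_mul_le s i j).trans (le_mul_of_one_le_left gk.le hc)
  rcases hE0.eq_or_lt with rfl | hE
  · simpa using hbase
  rcases Nat.eq_zero_or_pos i with rfl | hi
  · simpa using hbase
  have hs : (0 : ℝ) < s := by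
    rcases hs0.eq_or_lt with h | h
    · rw [← h] at hEj; linarith
    · exact h
  have hi' : (1 : ℝ) ≤ i := by exact_mod_cast hi
  have hsE : 0 ≤ s * (j : ℝ) - E := by linarith
  have t1 := le_Gamma_one_add_add (y := s * i) (δ := E) (by positivity) hE0
  have t2 := Gamma_add_le (y := 1 + (s * j - E)) (δ := E) (by linarith) hE0
  have t3 := Gamma_one_add_mul_le (a := s * i + E) (b := s * j - E) (by positivity) hsE
  have e1 : 1 + (s * (j : ℝ) - E) + E = 1 + s * j := by ring
  have e2 : 1 + (s * (i : ℝ) + E) + (s * j - E) = 1 + s * (i + j : ℕ) := by push_cast; ring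
  have e3 : 1 + s * (i : ℝ) + E = 1 + (s * i + E) := by ring
  rw [e1] at t2
  rw [e2] at t3
  rw [e3] at t1
  have t4 : (1 + (i : ℝ)) ^ E ≤ (1 + 2 / (s : ℝ)) ^ N * (s * (i : ℝ)) ^ E := by
    calc (1 + (i : ℝ)) ^ E ≤ ((1 + 2 / (s : ℝ)) * (s * (i : ℝ))) ^ E := by
          apply Real.rpow_le_rpow (by positivity) _ hE0
          have : (1 + 2 / (s : ℝ)) * (s * (i : ℝ)) = s * i + 2 * i := by field_simp
          rw [this]
          nlinarith [mul_nonneg hs0 (show (0 : ℝ) ≤ i by positivity)]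
      _ = (1 + 2 / (s : ℝ)) ^ E * (s * (i : ℝ)) ^ E := Real.mul_rpow (by positivity) (by positivity)
      _ ≤ _ := by
          gcongr
          rw [← Real.rpow_natCast]
          exact Real.rpow_le_rpow_of_exponent_le (by linarith [show (0 : ℝ) ≤ 2 / s by positivity]) hEN
  have t5 : (1 + s * (j : ℝ)) ^ E ≤ (1 + (s : ℝ)) ^ N * (1 + (j : ℝ)) ^ N := by
    have h5 : (1 : ℝ) ≤ 1 + s * j := by linarith [show (0 : ℝ) ≤ s * j by positivity]
    calc (1 + s * (j : ℝ)) ^ E ≤ (1 + s * (j : ℝ)) ^ (N : ℝ) :=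
          Real.rpow_le_rpow_of_exponent_le h5 hEN
      _ = (1 + s * (j : ℝ)) ^ N := Real.rpow_natCast _ _
      _ ≤ ((1 + (s : ℝ)) * (1 + (j : ℝ))) ^ N := by
          apply pow_le_pow_left₀ (by positivity)
          nlinarith [show (0 : ℝ) ≤ j by positivity]
      _ = _ := mul_pow _ _ _
  have gE : 0 < Real.Gamma (1 + (s * j - E)) := Real.Gamma_pos_of_pos (by linarith)
  have gE' : 0 < Real.Gamma (1 + (s * i + E)) := Real.Gamma_pos_of_pos (by positivity)
  calc (1 + (i : ℝ)) ^ E * (Real.Gamma (1 + s * i) * Real.Gamma (1 + s * j))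
      ≤ ((1 + 2 / (s : ℝ)) ^ N * (s * (i : ℝ)) ^ E) * (Real.Gamma (1 + s * i) *
          (((1 + (s : ℝ)) ^ N * (1 + (j : ℝ)) ^ N) * Real.Gamma (1 + (s * j - E)))) := by
        gcongr
        exact t2.trans (by gcongr)
    _ = (1 + 2 / (s : ℝ)) ^ N * (1 + (s : ℝ)) ^ N * (1 + (j : ℝ)) ^ N *
          (((s * (i : ℝ)) ^ E * Real.Gamma (1 + s * i)) * Real.Gamma (1 + (s * j - E))) := by ring
    _ ≤ (1 + 2 / (s : ℝ)) ^ N * (1 + (s : ℝ)) ^ N * (1 + (j : ℝ)) ^ N *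
          (Real.Gamma (1 + (s * i + E)) * Real.Gamma (1 + (s * j - E))) := by gcongr
    _ ≤ _ := by gcongr

/-- The slack `δ` below the edge `r = p + js` becomes the decaying factor `(1+i+j)^{-δ}`; on the
edge itself `δ = 0` is used. -/
theorem exists_pow_mul_gamma_le (s : ℝ≥0) (N : ℕ) :
    ∃ c > (0 : ℝ), ∀ (i j r p : ℕ) (δ : ℝ), r ≤ N → 0 ≤ δ → δ ≤ 1 → (r : ℝ) + δ ≤ p + j * s →
      (1 + (i : ℝ)) ^ r * (Real.Gamma (1 + s * i) * Real.Gamma (1 + s * j)) ≤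
        c * 2 ^ j * ((1 + (i + j : ℕ) : ℝ) ^ p * (1 + (i + j : ℕ) : ℝ) ^ (-δ)) *
          Real.Gamma (1 + s * (i + j : ℕ)) := by
  obtain ⟨c, hc, h⟩ := exists_rpow_mul_gamma_le s (N + 1)
  obtain ⟨c', hc', h'⟩ := exists_one_add_pow_le (N + 2)
  refine ⟨c * c', by positivity, fun i j r p δ hr hδ hδ1 hrp => ?_⟩
  have gi := gamma_pos s i
  have gj := gamma_pos s j
  have gk := gamma_pos s (i + j)
  have hr' : (r : ℝ) ≤ N := by exact_mod_cast hr
  have hp0 : (0 : ℝ) ≤ p := by positivity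
  have hi1 : (1 : ℝ) ≤ 1 + i := by linarith [show (0 : ℝ) ≤ i by positivity]
  have hj1 : (1 : ℝ) ≤ 1 + j := by linarith [show (0 : ℝ) ≤ j by positivity]
  -- The excess of `r` over `p - δ` is at most `js`, so it can be paid for by the Gamma factors.
  -- Moving the exponents `p` and `-δ` from `1+i` to `1+i+j` costs one factor `1+j`, and all powers
  -- of `1+j` go into `2^j`.
  set E : ℝ := max 0 (r - p + δ) with hE
  have k1 := h i j E (le_max_left _ _) (max_le (by positivity) (by push_cast; linarith))
    (max_le (by positivity) (by linarith))
  have k2 : (1 + (i : ℝ)) ^ r ≤ (1 + (i : ℝ)) ^ p * (1 + (i : ℝ)) ^ (-δ) * (1 + (i : ℝ)) ^ E := by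
    rw [← Real.rpow_natCast, ← Real.rpow_natCast, ← Real.rpow_add (by positivity),
      ← Real.rpow_add (by positivity)]
    apply Real.rpow_le_rpow_of_exponent_le hi1
    linarith [le_max_right 0 (r - p + δ)]
  have k3 : (1 + (i : ℝ)) ^ p ≤ (1 + (i + j : ℕ) : ℝ) ^ p := by
    apply pow_le_pow_left₀ (by positivity)
    push_cast; linarith
  have k4 : (1 + (i : ℝ)) ^ (-δ) ≤ (1 + (i + j : ℕ) : ℝ) ^ (-δ) * (1 + (j : ℝ)) := by
    have : (1 + (i + j : ℕ) : ℝ) ^ δ ≤ (1 + (i : ℝ)) ^ δ * (1 + (j : ℝ)) := by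
      calc (1 + (i + j : ℕ) : ℝ) ^ δ ≤ ((1 + (i : ℝ)) * (1 + (j : ℝ))) ^ δ := by
            apply Real.rpow_le_rpow (by positivity) _ hδ
            push_cast
            nlinarith [show (0 : ℝ) ≤ (i : ℝ) * j by positivity]
        _ = (1 + (i : ℝ)) ^ δ * (1 + (j : ℝ)) ^ δ := Real.mul_rpow (by positivity) (by positivity)
        _ ≤ (1 + (i : ℝ)) ^ δ * (1 + (j : ℝ)) ^ (1 : ℝ) := by gcongr
        _ = _ := by rw [Real.rpow_one]
    rw [Real.rpow_neg (by positivity), Real.rpow_neg (by positivity), inv_mul_eq_div,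
      le_div_iff₀ (by positivity), inv_mul_le_iff₀ (by positivity)]
    exact this
  calc (1 + (i : ℝ)) ^ r * (Real.Gamma (1 + s * i) * Real.Gamma (1 + s * j))
      ≤ ((1 + (i : ℝ)) ^ p * (1 + (i : ℝ)) ^ (-δ) * (1 + (i : ℝ)) ^ E) *
          (Real.Gamma (1 + s * i) * Real.Gamma (1 + s * j)) := by gcongr
    _ = ((1 + (i : ℝ)) ^ p * (1 + (i : ℝ)) ^ (-δ)) * ((1 + (i : ℝ)) ^ E *
          (Real.Gamma (1 + s * i) * Real.Gamma (1 + s * j))) := by ring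
    _ ≤ ((1 + (i + j : ℕ) : ℝ) ^ p * ((1 + (i + j : ℕ) : ℝ) ^ (-δ) * (1 + (j : ℝ)))) *
          (c * (1 + (j : ℝ)) ^ (N + 1) * Real.Gamma (1 + s * (i + j : ℕ))) := by gcongr
    _ = c * (1 + (j : ℝ)) ^ (N + 2) * ((1 + (i + j : ℕ) : ℝ) ^ p * (1 + (i + j : ℕ) : ℝ) ^ (-δ)) *
          Real.Gamma (1 + s * (i + j : ℕ)) := by ring
    _ ≤ c * (c' * 2 ^ j) * ((1 + (i + j : ℕ) : ℝ) ^ p * (1 + (i + j : ℕ) : ℝ) ^ (-δ)) *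
          Real.Gamma (1 + s * (i + j : ℕ)) := by gcongr; exact h' j
    _ = _ := by ring

/-- For `s > 0` only finitely many pairs matter, because `js ≥ N + 1` for large `j`; for `s = 0` the
inequality is between integers. -/
theorem exists_slope_gap (s : ℝ≥0) (N p : ℕ) :
    ∃ δ > (0 : ℝ), δ ≤ 1 ∧ ∀ r j : ℕ, r ≤ N → (r : ℝ) < p + j * s → (r : ℝ) + δ ≤ p + j * s := by
  rcases eq_or_ne s 0 with rfl | hs
  · refine ⟨1, one_pos, le_rfl, fun r j _ h => ?_⟩
    simp only [NNReal.coe_zero, mul_zero, add_zero] at h ⊢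
    exact_mod_cast h
  have hs' : (0 : ℝ) < s := by positivity
  obtain ⟨L, hL⟩ := exists_nat_ge ((N + 1) / (s : ℝ))
  obtain ⟨δ, hδ, h⟩ := exists_pos_le_of_finset
    ((Finset.range (N + 1) ×ˢ Finset.range L).filter fun x => (x.1 : ℝ) < p + x.2 * s)
    (fun x => p + x.2 * s - x.1) (fun x hx => by
      have := (Finset.mem_filter.1 hx).2
      linarith)
  refine ⟨min δ 1, by positivity, min_le_right _ _, fun r j hr hrj => ?_⟩
  by_cases hj : j < L
  · have := h (r, j) (by simp [hrj, hj]; omega)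
    simp only at this
    linarith [min_le_left δ 1]
  · have h1 : (L : ℝ) ≤ j := by exact_mod_cast not_lt.1 hj
    have h2 : (N + 1 : ℝ) ≤ j * s := by
      rw [div_le_iff₀ hs'] at hL
      nlinarith
    have h3 : (r : ℝ) ≤ N := by exact_mod_cast hr
    have h4 : (0 : ℝ) ≤ p := by positivity
    linarith [min_le_right δ 1]

/-- A lower bound matching `exists_pow_mul_gamma_le` on the edge `r = p + js`. -/
theorem exists_le_pow_mul_gamma (s : ℝ≥0) (p J l : ℕ) (hl : (l : ℝ) = J * s) :
    ∃ c > (0 : ℝ), ∀ i : ℕ, c * (1 + (i + J : ℕ) : ℝ) ^ p * Real.Gamma (1 + s * (i + J : ℕ)) ≤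
      (1 + (i : ℝ)) ^ (p + l) * Real.Gamma (1 + s * i) := by
  refine ⟨((1 + J : ℝ) ^ p * ((1 + s) * (1 + J)) ^ l)⁻¹, by positivity, fun i => ?_⟩
  have gi := gamma_pos s i
  have hi : (0 : ℝ) ≤ i := by positivity
  have hJ : (0 : ℝ) ≤ J := by positivity
  have hs : (0 : ℝ) ≤ s := s.2
  have h1 := Gamma_add_le (y := 1 + s * i) (δ := l) (by positivity) (by positivity)
  have e1 : 1 + s * (i : ℝ) + l = 1 + s * (i + J : ℕ) := by rw [hl]; push_cast; ring
  rw [e1, Real.rpow_natCast] at h1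
  have h2 : (1 + (i + J : ℕ) : ℝ) ≤ (1 + J) * (1 + i) := by
    push_cast; nlinarith [mul_nonneg hi hJ]
  have h3 : 1 + s * (i + J : ℕ) ≤ (1 + s) * (1 + J) * (1 + (i : ℝ)) := by
    calc (1 + s * (i + J : ℕ) : ℝ) ≤ (1 + s) * (1 + (i + J : ℕ) : ℝ) := by
          have : (0 : ℝ) ≤ (i + J : ℕ) := by positivity
          nlinarith
      _ ≤ (1 + s) * ((1 + J) * (1 + i)) := by gcongr
      _ = _ := by ring
  rw [mul_assoc, inv_mul_le_iff₀ (by positivity)]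
  calc (1 + (i + J : ℕ) : ℝ) ^ p * Real.Gamma (1 + s * (i + J : ℕ))
      ≤ ((1 + J) * (1 + i) : ℝ) ^ p * (((1 + s) * (1 + J) * (1 + (i : ℝ))) ^ l *
          Real.Gamma (1 + s * i)) := by
        have gk := gamma_pos s (i + J)
        have : Real.Gamma (1 + s * (i + J : ℕ)) ≤ ((1 + s) * (1 + J) * (1 + (i : ℝ))) ^ l *
          Real.Gamma (1 + s * i) := h1.trans (by gcongr)
        gcongr
    _ = _ := by rw [mul_pow, mul_pow _ _ l, pow_add]; ring

/-! ### Symbols of ordinary differential operators in `z` -/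

/-- `z^i ↦ ∑_j W_j(i) z^{i+j}` is the action of `∑_r c_r(z) ∂_z^r`; here is `W_j(i)`. -/
def odeSymbol (c : ℕ →₀ SeriesZ) (j i : ℕ) : ℂ :=
  ∑ r ∈ c.support, PowerSeries.coeff (j + r) (c r) * (i.descFactorial r : ℂ)

/-- The Newton polygon of `∑_r c_r(z) ∂_z^r` lies above the line of slope `1/s` through its
vertex `(p, 0)`, the order is at most `N`, and the coefficients are of Gevrey order `s`. -/
structure OdeBounds (s : ℝ≥0) (c : ℕ →₀ SeriesZ) (p N : ℕ) (A C : ℝ) : Prop where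
  slope : ∀ r j, PowerSeries.coeff (j + r) (c r) ≠ 0 → (r : ℝ) ≤ p + j * s
  bound : ∀ r j, ‖PowerSeries.coeff (j + r) (c r)‖ ≤ A * C ^ j * Real.Gamma (1 + s * j)
  top : PowerSeries.coeff p (c p) ≠ 0
  order_le : ∀ r ∈ c.support, r ≤ N

section OdeBounds

variable {s : ℝ≥0} {c : ℕ →₀ SeriesZ} {p N : ℕ} {A C : ℝ}

theorem OdeBounds.top_mem (h : OdeBounds s c p N A C) : p ∈ c.support := by
  rw [Finsupp.mem_support_iff]
  intro h0
  exact h.top (by simp [h0])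

/-- At `j = 0` the slope condition reads `r ≤ p`, so the diagonal symbol is a polynomial in `k` of
exact degree `p`. -/
theorem OdeBounds.tendsto_zero_symbol (h : OdeBounds s c p N A C) :
    Filter.Tendsto (fun k : ℕ => odeSymbol c 0 k / ((1 + (k : ℝ) : ℝ) : ℂ) ^ p) Filter.atTop
      (nhds (PowerSeries.coeff p (c p))) := by
  have h1 := tendsto_sum_descFactorial_div c.support
    (fun r => PowerSeries.coeff (0 + r) (c r)) (fun r => r) p (fun r _ hr => by
      have := h.slope r 0 hr
      simp only [Nat.cast_zero, zero_mul, add_zero] at this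
      exact_mod_cast this)
  rw [Finset.filter_eq', if_pos h.top_mem, Finset.sum_singleton, zero_add] at h1
  exact h1

theorem OdeBounds.tendsto_symbol (h : OdeBounds s c p N A C) {J l : ℕ} (hl : (l : ℝ) = J * s)
    (hne : PowerSeries.coeff (J + (p + l)) (c (p + l)) ≠ 0) :
    Filter.Tendsto (fun k : ℕ => odeSymbol c J k / ((1 + (k : ℝ) : ℝ) : ℂ) ^ (p + l)) Filter.atTop
      (nhds (PowerSeries.coeff (J + (p + l)) (c (p + l)))) := by
  have h1 := tendsto_sum_descFactorial_div c.support
    (fun r => PowerSeries.coeff (J + r) (c r)) (fun r => r) (p + l) (fun r _ hr => by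
      have := h.slope r J hr
      rw [← hl] at this
      exact_mod_cast this)
  have hmem : p + l ∈ c.support := by
    rw [Finsupp.mem_support_iff]
    intro h0
    exact hne (by simp [h0])
  rw [Finset.filter_eq', if_pos hmem, Finset.sum_singleton] at h1
  exact h1

end OdeBounds

theorem norm_coeff_mul_descFactorial_le (a : ℂ) (i r : ℕ) :
    ‖a * (i.descFactorial r : ℂ)‖ ≤ ‖a‖ * (1 + (i : ℝ)) ^ r := by
  rw [norm_mul, Complex.norm_natCast]
  gcongr
  calc (i.descFactorial r : ℝ) ≤ ((i ^ r : ℕ) : ℝ) := by exact_mod_cast Nat.descFactorial_le_pow _ _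
    _ ≤ (1 + (i : ℝ)) ^ r := by
      push_cast
      exact pow_le_pow_left₀ (by positivity) (by linarith) _

/-- Upper bounds for the symbol relative to its value on the diagonal. The terms off the edge
`r = p + js` decay; the others are controlled by `φ j`. -/
theorem exists_symbol_le (s : ℝ≥0) (N : ℕ) :
    ∃ κ > (0 : ℝ), ∀ (c : ℕ →₀ SeriesZ) (p : ℕ) (A C : ℝ) (φ : ℕ → ℝ), 0 ≤ A → 0 ≤ C →
      OdeBounds s c p N A C → (∀ j, 0 ≤ φ j) →
      (∀ r j : ℕ, 1 ≤ j → (r : ℝ) = p + j * s → ‖PowerSeries.coeff (j + r) (c r)‖ ≤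
        φ j * Real.Gamma (1 + s * j) * ‖PowerSeries.coeff p (c p)‖) →
      ∃ δ > (0 : ℝ), ∃ B ≥ (0 : ℝ), ∃ K : ℕ, ∀ i j : ℕ, 1 ≤ j → K ≤ i + j →
        ‖odeSymbol c j i‖ * Real.Gamma (1 + s * i) ≤
          κ * 2 ^ j * (φ j + B * (1 + (i + j : ℕ) : ℝ) ^ (-δ) * C ^ j) *
            (‖odeSymbol c 0 (i + j)‖ * Real.Gamma (1 + s * (i + j : ℕ))) := by
  -- The constant is fixed before the operator, hence later uniform in `n`; only `δ`, `B` and `K`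
  -- may depend on the operator. In `(N+1) κ 2`, `N+1` counts the orders and `2` comes from
  -- `T(1+k)^p ≤ 2|W_0(k)|`.
  obtain ⟨κ, hκ, hpow⟩ := exists_pow_mul_gamma_le s N
  refine ⟨(N + 1) * κ * 2, by positivity, fun c p A C φ hA hC h hφ hedge => ?_⟩
  obtain ⟨δ, hδ, hδ1, hgap⟩ := exists_slope_gap s N p
  have ht : 0 < ‖PowerSeries.coeff p (c p)‖ := norm_pos_iff.2 h.top
  obtain ⟨K, hK⟩ := Filter.eventually_atTop.1 (eventually_norm_bounds h.top h.tendsto_zero_symbol)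
  refine ⟨δ, hδ, A / ‖PowerSeries.coeff p (c p)‖, by positivity, K, fun i j hj hij => ?_⟩
  have gi := gamma_pos s i
  have gj := gamma_pos s j
  have gk := gamma_pos s (i + j)
  set T := ‖PowerSeries.coeff p (c p)‖ with hT
  set k := i + j with hk
  set D := (1 + (k : ℝ)) ^ (-δ) with hD
  have hD0 : 0 ≤ D := by positivity
  have hterm : ∀ r ∈ c.support,
      ‖PowerSeries.coeff (j + r) (c r) * (i.descFactorial r : ℂ)‖ * Real.Gamma (1 + s * i) ≤
        κ * 2 ^ j * (φ j + A / T * D * C ^ j) * (T * (1 + (k : ℝ)) ^ p) *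
          Real.Gamma (1 + s * k) := by
    intro r hr
    have hrN := h.order_le r hr
    have hnn : 0 ≤ κ * 2 ^ j * (φ j + A / T * D * C ^ j) * (T * (1 + (k : ℝ)) ^ p) *
          Real.Gamma (1 + s * k) := by
      have := hφ j
      positivity
    by_cases h0 : PowerSeries.coeff (j + r) (c r) = 0
    · simpa [h0] using hnn
    refine (mul_le_mul_of_nonneg_right (norm_coeff_mul_descFactorial_le _ _ _) gi.le).trans ?_
    rcases (h.slope r j h0).eq_or_lt with heq | hlt
    · have k1 := hpow i j r p 0 hrN le_rfl zero_le_one (by linarith)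
      simp only [neg_zero, Real.rpow_zero, mul_one] at k1
      calc ‖PowerSeries.coeff (j + r) (c r)‖ * (1 + (i : ℝ)) ^ r * Real.Gamma (1 + s * i)
          ≤ (φ j * Real.Gamma (1 + s * j) * T) * (1 + (i : ℝ)) ^ r * Real.Gamma (1 + s * i) := by
            gcongr; exact hedge r j hj heq
        _ = φ j * T * ((1 + (i : ℝ)) ^ r * (Real.Gamma (1 + s * i) * Real.Gamma (1 + s * j))) := by
            ring
        _ ≤ φ j * T * (κ * 2 ^ j * (1 + (k : ℝ)) ^ p * Real.Gamma (1 + s * k)) := by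
            have := hφ j
            gcongr
        _ = κ * 2 ^ j * (φ j + 0) * (T * (1 + (k : ℝ)) ^ p) * Real.Gamma (1 + s * k) := by ring
        _ ≤ _ := by gcongr; positivity
    · have k1 := hpow i j r p δ hrN hδ.le hδ1 (hgap r j hrN hlt)
      calc ‖PowerSeries.coeff (j + r) (c r)‖ * (1 + (i : ℝ)) ^ r * Real.Gamma (1 + s * i)
          ≤ (A * C ^ j * Real.Gamma (1 + s * j)) * (1 + (i : ℝ)) ^ r * Real.Gamma (1 + s * i) := by
            gcongr; exact h.bound r j
        _ = A * C ^ j * ((1 + (i : ℝ)) ^ r * (Real.Gamma (1 + s * i) * Real.Gamma (1 + s * j))) := by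
            ring
        _ ≤ A * C ^ j * (κ * 2 ^ j * ((1 + (k : ℝ)) ^ p * D) * Real.Gamma (1 + s * k)) := by
            gcongr
        _ = κ * 2 ^ j * (0 + A / T * D * C ^ j) * (T * (1 + (k : ℝ)) ^ p) *
              Real.Gamma (1 + s * k) := by field_simp; ring
        _ ≤ _ := by gcongr; exact hφ j
  have hcard : (c.support.card : ℝ) ≤ N + 1 := by
    have : c.support ⊆ Finset.range (N + 1) := fun r hr => by
      have := h.order_le r hr
      simp; omega
    have := Finset.card_le_card this
    rw [Finset.card_range] at this
    exact_mod_cast this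
  have hnn : 0 ≤ κ * 2 ^ j * (φ j + A / T * D * C ^ j) := by
    have := hφ j
    positivity
  calc ‖odeSymbol c j i‖ * Real.Gamma (1 + s * i)
      ≤ ∑ r ∈ c.support,
          ‖PowerSeries.coeff (j + r) (c r) * (i.descFactorial r : ℂ)‖ * Real.Gamma (1 + s * i) := by
        rw [← Finset.sum_mul]
        gcongr
        exact norm_sum_le _ _
    _ ≤ c.support.card • (κ * 2 ^ j * (φ j + A / T * D * C ^ j) * (T * (1 + (k : ℝ)) ^ p) *
          Real.Gamma (1 + s * k)) := Finset.sum_le_card_nsmul _ _ _ hterm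
    _ ≤ (N + 1) * (κ * 2 ^ j * (φ j + A / T * D * C ^ j) * (T * (1 + (k : ℝ)) ^ p) *
          Real.Gamma (1 + s * k)) := by
        rw [nsmul_eq_mul]
        gcongr
    _ = (N + 1) * (κ * 2 ^ j * (φ j + A / T * D * C ^ j)) * Real.Gamma (1 + s * k) *
          (T * (1 + (k : ℝ)) ^ p) := by ring
    _ ≤ (N + 1) * (κ * 2 ^ j * (φ j + A / T * D * C ^ j)) * Real.Gamma (1 + s * k) *
          (2 * ‖odeSymbol c 0 k‖) := mul_le_mul_of_nonneg_left (hK k hij).1 (by positivity)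
    _ = _ := by ring

/-- A lower bound for the symbol on the edge. -/
theorem exists_le_symbol (s : ℝ≥0) (p J l : ℕ) (hl : (l : ℝ) = J * s) :
    ∃ κ > (0 : ℝ), ∀ (c : ℕ →₀ SeriesZ) (N : ℕ) (A C : ℝ), OdeBounds s c p N A C →
      PowerSeries.coeff (J + (p + l)) (c (p + l)) ≠ 0 →
      ∃ K : ℕ, ∀ i : ℕ, K ≤ i →
        κ * ‖PowerSeries.coeff (J + (p + l)) (c (p + l))‖ / ‖PowerSeries.coeff p (c p)‖ *
            (‖odeSymbol c 0 (i + J)‖ * Real.Gamma (1 + s * (i + J : ℕ))) ≤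
          ‖odeSymbol c J i‖ * Real.Gamma (1 + s * i) := by
  obtain ⟨κ, hκ, hpow⟩ := exists_le_pow_mul_gamma s p J l hl
  -- One factor `1/2` comes from the upper bound for `W_0`, the other from the lower bound for
  -- `W_J`.
  refine ⟨κ / 4, by positivity, fun c N A C h hne => ?_⟩
  have ht : 0 < ‖PowerSeries.coeff p (c p)‖ := norm_pos_iff.2 h.top
  obtain ⟨K, hK⟩ := Filter.eventually_atTop.1 (eventually_norm_bounds h.top h.tendsto_zero_symbol)
  obtain ⟨K', hK'⟩ := Filter.eventually_atTop.1
    (eventually_norm_bounds hne (h.tendsto_symbol hl hne))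
  refine ⟨max K K', fun i hi => ?_⟩
  have h1 := (hK (i + J) (by omega)).2
  have h2 := (hK' i (by omega)).1
  have gi := gamma_pos s i
  have gk := gamma_pos s (i + J)
  set T := ‖PowerSeries.coeff p (c p)‖ with hT
  set V := ‖PowerSeries.coeff (J + (p + l)) (c (p + l))‖ with hV
  have hV0 : 0 ≤ V := norm_nonneg _
  calc κ / 4 * V / T * (‖odeSymbol c 0 (i + J)‖ * Real.Gamma (1 + s * (i + J : ℕ)))
      ≤ κ / 4 * V / T * ((2 * T * (1 + (i + J : ℕ) : ℝ) ^ p) *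
          Real.Gamma (1 + s * (i + J : ℕ))) := by gcongr
    _ = V / 2 * (κ * (1 + (i + J : ℕ) : ℝ) ^ p * Real.Gamma (1 + s * (i + J : ℕ))) := by
        field_simp; ring
    _ ≤ V / 2 * ((1 + (i : ℝ)) ^ (p + l) * Real.Gamma (1 + s * i)) := by
        exact mul_le_mul_of_nonneg_left (hpow i) (by positivity)
    _ = V * (1 + (i : ℝ)) ^ (p + l) * (Real.Gamma (1 + s * i) / 2) := by ring
    _ ≤ 2 * ‖odeSymbol c J i‖ * (Real.Gamma (1 + s * i) / 2) := by gcongr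
    _ = _ := by ring

/-! ### The spaces `G_s(r)` in terms of coefficient bounds -/

/-- The terms `u_k R^k / Γ(1+sk)` are bounded. -/
def BorelBounded (s : ℝ≥0) (R : ℝ) (u : SeriesZ) : Prop :=
  ∃ M : ℝ, ∀ k : ℕ, ‖PowerSeries.coeff k u‖ * R ^ k ≤ M * Real.Gamma (1 + s * k)

/-- Terms of a convergent series are bounded; conversely, bounds at every smaller radius give
locally uniform convergence by comparison with geometric series. The Gevrey estimate is automatic:
the bound at `R = r/2` is one. -/
theorem mem_gevreyDisc_iff {s : ℝ≥0} {r : ℝ} (hr : 0 < r) {u : SeriesZ} :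
    u ∈ gevreyDisc s r ↔ ∀ R : ℝ, 0 < R → R < r → BorelBounded s R u := by
  have hnorm : ∀ (k : ℕ) (z : ℂ), ‖PowerSeries.coeff k u / (Real.Gamma (1 + s * k) : ℂ) * z ^ k‖ =
      ‖PowerSeries.coeff k u‖ * ‖z‖ ^ k / Real.Gamma (1 + s * k) := by
    intro k z
    rw [norm_mul, norm_div, norm_pow, Complex.norm_real,
      Real.norm_of_nonneg (gamma_pos s k).le]
    ring
  constructor
  · rintro ⟨-, f, -, hsum⟩ R hR hRr
    have hz : (R : ℂ) ∈ Metric.ball (0 : ℂ) r := by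
      simpa [abs_of_pos hR] using hRr
    obtain ⟨M, hM⟩ := (hsum _ hz).summable.tendsto_atTop_zero.norm.bddAbove_range
    refine ⟨M, fun k => ?_⟩
    have := hM ⟨k, rfl⟩
    simp only [hnorm] at this
    rwa [Complex.norm_real, Real.norm_of_nonneg hR.le, div_le_iff₀ (gamma_pos s k)] at this
  · intro h
    have hterm : ∀ R₁ R : ℝ, 0 < R₁ → R₁ < R → R < r → ∃ v : ℕ → ℝ, Summable v ∧
        ∀ (k : ℕ), ∀ z ∈ Metric.ball (0 : ℂ) R₁,
          ‖PowerSeries.coeff k u / (Real.Gamma (1 + s * k) : ℂ) * z ^ k‖ ≤ v k := by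
      intro R₁ R h1 h2 h3
      have hR : 0 < R := h1.trans h2
      obtain ⟨M, hM⟩ := h R hR h3
      refine ⟨fun k => M * (R₁ / R) ^ k, (summable_geometric_of_lt_one (by positivity)
        ((div_lt_one hR).2 h2)).mul_left M, fun k z hz => ?_⟩
      have hz' : ‖z‖ ≤ R₁ := by simpa using (Metric.mem_ball.1 hz).le
      simp only
      rw [hnorm, div_le_iff₀ (gamma_pos s k), div_pow]
      calc ‖PowerSeries.coeff k u‖ * ‖z‖ ^ k ≤ ‖PowerSeries.coeff k u‖ * R₁ ^ k := by gcongr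
        _ = (‖PowerSeries.coeff k u‖ * R ^ k) * (R₁ ^ k / R ^ k) := by field_simp
        _ ≤ (M * Real.Gamma (1 + s * k)) * (R₁ ^ k / R ^ k) :=
          mul_le_mul_of_nonneg_right (hM k) (by positivity)
        _ = _ := by ring
    have hrad : ∀ z ∈ Metric.ball (0 : ℂ) r, ∃ R₁ R : ℝ, z ∈ Metric.ball (0 : ℂ) R₁ ∧ 0 < R₁ ∧
        R₁ < R ∧ R < r := by
      intro z hz
      have hz' : ‖z‖ < r := by simpa using hz
      obtain ⟨R₁, h1, h2⟩ := exists_between hz'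
      obtain ⟨R, h3, h4⟩ := exists_between h2
      exact ⟨R₁, R, by simpa using h1, (norm_nonneg z).trans_lt h1, h3, h4⟩
    refine ⟨?_, fun z => ∑' k : ℕ, PowerSeries.coeff k u / (Real.Gamma (1 + s * k) : ℂ) * z ^ k,
      ?_, ?_⟩
    · obtain ⟨M, hM⟩ := h (r / 2) (by positivity) (by linarith)
      refine ⟨max M 1, by positivity, (r / 2)⁻¹, by positivity, fun k => ?_⟩
      have hk := (hM k).trans
        (mul_le_mul_of_nonneg_right (le_max_left M 1) (gamma_pos s k).le)
      rw [inv_pow, mul_assoc, mul_left_comm, ← div_eq_inv_mul, le_div_iff₀ (by positivity)]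
      exact hk
    · intro z hz
      obtain ⟨R₁, R, hzR, h1, h2, h3⟩ := hrad z hz
      obtain ⟨v, hv, hb⟩ := hterm R₁ R h1 h2 h3
      have := Complex.differentiableOn_tsum_of_summable_norm hv (fun k => by fun_prop)
        Metric.isOpen_ball hb
      exact (this.differentiableAt (Metric.isOpen_ball.mem_nhds hzR)).differentiableWithinAt
    · intro z hz
      obtain ⟨R₁, R, hzR, h1, h2, h3⟩ := hrad z hz
      obtain ⟨v, hv, hb⟩ := hterm R₁ R h1 h2 h3
      exact (Summable.of_norm_bounded hv (fun k => hb k z hzR)).hasSum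

theorem gevreyDisc_anti {s : ℝ≥0} {r r' : ℝ} (hr' : 0 < r') (h : r' ≤ r) :
    gevreyDisc s r ≤ gevreyDisc s r' := by
  intro u hu
  rw [mem_gevreyDisc_iff (hr'.trans_le h)] at hu
  rw [mem_gevreyDisc_iff hr']
  exact fun R hR hRr => hu R hR (hRr.trans_le h)

/-- `gamma_mul_le` bounds each term of the Cauchy product, and their number `k+1` is absorbed by
passing from `R` to a smaller `R₁`. -/
theorem mul_mem_gevreyDisc {s : ℝ≥0} {r : ℝ} (hr : 0 < r) {u v : SeriesZ}
    (hu : u ∈ gevreyDisc s r) (hv : v ∈ gevreyDisc s r) : u * v ∈ gevreyDisc s r := by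
  rw [mem_gevreyDisc_iff hr] at *
  intro R₁ h1 h2
  obtain ⟨R, h3, h4⟩ := exists_between h2
  have hR : 0 < R := h1.trans h3
  obtain ⟨M, hM⟩ := hu R hR h4
  obtain ⟨M', hM'⟩ := hv R hR h4
  obtain ⟨C, hC, hCb⟩ := exists_one_add_pow_mul_pow_le 1 (q := R₁ / R) (by positivity)
    ((div_lt_one hR).2 h3)
  have hM0 : 0 ≤ M := by simpa using (norm_nonneg _).trans (by simpa using hM 0)
  have hM'0 : 0 ≤ M' := by simpa using (norm_nonneg _).trans (by simpa using hM' 0)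
  refine ⟨M * M' * C, fun k => ?_⟩
  have gk := gamma_pos s k
  have hsum : ‖PowerSeries.coeff k (u * v)‖ * R ^ k ≤
      (k + 1) * (M * M' * Real.Gamma (1 + s * k)) := by
    rw [PowerSeries.coeff_mul]
    calc ‖∑ x ∈ Finset.HasAntidiagonal.antidiagonal k, PowerSeries.coeff x.1 u * PowerSeries.coeff x.2 v‖ * R ^ k
        ≤ ∑ x ∈ Finset.HasAntidiagonal.antidiagonal k,
            ‖PowerSeries.coeff x.1 u * PowerSeries.coeff x.2 v‖ * R ^ k := by
          rw [← Finset.sum_mul]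
          gcongr
          exact norm_sum_le _ _
      _ ≤ (Finset.HasAntidiagonal.antidiagonal k).card • (M * M' * Real.Gamma (1 + s * k)) := by
          refine Finset.sum_le_card_nsmul _ _ _ fun x hx => ?_
          have hx' := Finset.HasAntidiagonal.mem_antidiagonal.1 hx
          have g1 := gamma_pos s x.1
          have g2 := gamma_pos s x.2
          have hg := gamma_mul_le s x.1 x.2
          rw [hx'] at hg
          rw [norm_mul, ← hx', pow_add]
          calc ‖PowerSeries.coeff x.1 u‖ * ‖PowerSeries.coeff x.2 v‖ * (R ^ x.1 * R ^ x.2)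
              = (‖PowerSeries.coeff x.1 u‖ * R ^ x.1) * (‖PowerSeries.coeff x.2 v‖ * R ^ x.2) := by
                ring
            _ ≤ (M * Real.Gamma (1 + s * x.1)) * (M' * Real.Gamma (1 + s * x.2)) := by
                have a1 := hM x.1
                have a2 := hM' x.2
                gcongr
            _ = M * M' * (Real.Gamma (1 + s * x.1) * Real.Gamma (1 + s * x.2)) := by ring
            _ ≤ _ := by rw [hx']; gcongr
      _ = _ := by simp
  calc ‖PowerSeries.coeff k (u * v)‖ * R₁ ^ k
      = (‖PowerSeries.coeff k (u * v)‖ * R ^ k) * (R₁ / R) ^ k := by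
        rw [div_pow]; field_simp
    _ ≤ ((k + 1) * (M * M' * Real.Gamma (1 + s * k))) * (R₁ / R) ^ k := by gcongr
    _ = M * M' * Real.Gamma (1 + s * k) * ((1 + (k : ℝ)) ^ 1 * (R₁ / R) ^ k) := by ring
    _ ≤ M * M' * Real.Gamma (1 + s * k) * C := by gcongr; exact hCb k
    _ = _ := by ring

/-- `Γ(1+s(k+1)) / Γ(1+sk)` grows only polynomially in `k`, which a smaller radius absorbs. -/
theorem derivative_mem_gevreyDisc {s : ℝ≥0} {r : ℝ} (hr : 0 < r) {u : SeriesZ}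
    (hu : u ∈ gevreyDisc s r) : PowerSeries.derivative ℂ u ∈ gevreyDisc s r := by
  rw [mem_gevreyDisc_iff hr] at *
  intro R₁ h1 h2
  obtain ⟨R, h3, h4⟩ := exists_between h2
  have hR : 0 < R := h1.trans h3
  obtain ⟨M, hM⟩ := hu R hR h4
  have hM0 : 0 ≤ M := by simpa using (norm_nonneg _).trans (by simpa using hM 0)
  obtain ⟨L, hL⟩ := exists_nat_ge (s : ℝ)
  obtain ⟨C, hC, hCb⟩ := exists_one_add_pow_mul_pow_le (1 + L) (q := R₁ / R) (by positivity)
    ((div_lt_one hR).2 h3)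
  refine ⟨M / R * (1 + 2 * s) ^ L * C, fun k => ?_⟩
  have gk := gamma_pos s k
  have hk : (0 : ℝ) ≤ k := by positivity
  have hs0 : (0 : ℝ) ≤ s := s.2
  have h5 : Real.Gamma (1 + s * (k + 1 : ℕ)) ≤
      (1 + 2 * s) ^ L * (1 + (k : ℝ)) ^ L * Real.Gamma (1 + s * k) := by
    have := Gamma_add_le (y := 1 + s * k) (δ := s) (by positivity) hs0
    have e1 : 1 + s * (k : ℝ) + s = 1 + s * (k + 1 : ℕ) := by push_cast; ring
    rw [e1] at this
    refine this.trans ?_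
    gcongr
    calc (1 + s * (k + 1 : ℕ) : ℝ) ^ (s : ℝ) ≤ (1 + s * (k + 1 : ℕ) : ℝ) ^ (L : ℝ) :=
          Real.rpow_le_rpow_of_exponent_le (by
            linarith [show (0 : ℝ) ≤ s * (k + 1 : ℕ) by positivity]) hL
      _ = (1 + s * (k + 1 : ℕ) : ℝ) ^ L := Real.rpow_natCast _ _
      _ ≤ ((1 + 2 * s) * (1 + (k : ℝ))) ^ L := by
          apply pow_le_pow_left₀ (by positivity)
          push_cast
          nlinarith [mul_nonneg hs0 hk]
      _ = _ := mul_pow _ _ _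
  have hn : ‖((k : ℂ) + 1)‖ = 1 + k := by
    rw [add_comm]
    exact_mod_cast Complex.norm_natCast (1 + k)
  rw [PowerSeries.coeff_derivative, norm_mul, hn]
  calc ‖PowerSeries.coeff (k + 1) u‖ * (1 + (k : ℝ)) * R₁ ^ k
      = (‖PowerSeries.coeff (k + 1) u‖ * R ^ (k + 1)) * ((1 + (k : ℝ)) / R * (R₁ / R) ^ k) := by
        rw [div_pow, pow_succ]; field_simp
    _ ≤ (M * ((1 + 2 * s) ^ L * (1 + (k : ℝ)) ^ L * Real.Gamma (1 + s * k))) *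
          ((1 + (k : ℝ)) / R * (R₁ / R) ^ k) := by
        have := (hM (k + 1)).trans (mul_le_mul_of_nonneg_left h5 hM0)
        gcongr
    _ = M / R * (1 + 2 * s) ^ L * Real.Gamma (1 + s * k) *
          ((1 + (k : ℝ)) ^ (1 + L) * (R₁ / R) ^ k) := by ring
    _ ≤ M / R * (1 + 2 * s) ^ L * Real.Gamma (1 + s * k) * C := by gcongr; exact hCb k
    _ = _ := by ring

theorem iterate_derivative_mem_gevreyDisc {s : ℝ≥0} {r : ℝ} (hr : 0 < r) {u : SeriesZ}
    (hu : u ∈ gevreyDisc s r) (n : ℕ) :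
    (PowerSeries.derivative ℂ)^[n] u ∈ gevreyDisc s r := by
  induction n with
  | zero => exact hu
  | succ n ih =>
    rw [Function.iterate_succ_apply']
    exact derivative_mem_gevreyDisc hr ih

theorem X_pow_mem_gevreyDisc (s : ℝ≥0) {r : ℝ} (hr : 0 < r) (n : ℕ) :
    (PowerSeries.X ^ n : SeriesZ) ∈ gevreyDisc s r := by
  rw [mem_gevreyDisc_iff hr]
  intro R hR _
  refine ⟨R ^ n / Real.Gamma (1 + s * n), fun k => ?_⟩
  have gk := gamma_pos s k
  have gn := gamma_pos s n
  rw [PowerSeries.coeff_X_pow]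
  split_ifs with h
  · subst h
    simp [gk.ne']
  · simp only [norm_zero, zero_mul]
    positivity

/-! ### Triangular systems -/

/-- Recursion in which the step sees only earlier values, the others being replaced by `0`. It
solves the triangular systems both in `z` and in `t`. -/
theorem exists_seq_of_step {A : Type*} [Zero A] (step : ℕ → (ℕ → A) → A) :
    ∃ u : ℕ → A, ∀ N, u N = step N fun n => if n < N then u n else 0 := by
  let F : (N : ℕ) → (∀ n, n < N → A) → A := fun N ih =>
    step N fun n => if h : n < N then ih n h else 0
  refine ⟨fun N => Nat.strongRec F N, fun N => ?_⟩
  simp only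
  rw [Nat.strongRec_eq]
  simp only [F, dite_eq_ite]

/-! ### The action of an ordinary differential operator in `z` -/

/-- The operator `∑_r c_r(z) ∂_z^r`. -/
def odeAct (c : ℕ →₀ SeriesZ) (u : SeriesZ) : SeriesZ :=
  ∑ r ∈ c.support, c r * (PowerSeries.derivative ℂ)^[r] u

theorem coeff_mul_iterate_derivative {a : SeriesZ} {r : ℕ}
    (ha : ∀ l < r, PowerSeries.coeff l a = 0) (u : SeriesZ) (k : ℕ) :
    PowerSeries.coeff k (a * (PowerSeries.derivative ℂ)^[r] u) =
      ∑ i ∈ Finset.range (k + 1), PowerSeries.coeff (k - i + r) a * (i.descFactorial r : ℂ) *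
        PowerSeries.coeff i u := by
  rw [PowerSeries.coeff_mul]
  have h1 : ∀ x ∈ Finset.HasAntidiagonal.antidiagonal k, PowerSeries.coeff x.1 a *
      PowerSeries.coeff x.2 ((PowerSeries.derivative ℂ)^[r] u) =
      (fun y : ℕ × ℕ => PowerSeries.coeff y.1 a * (((y.2 + r).descFactorial r : ℕ) : ℂ) *
        PowerSeries.coeff (y.2 + r) u) x := by
    intro x _
    rw [PowerSeries.coeff_iterate_derivative, ← Nat.add_descFactorial_eq_ascFactorial, ← mul_assoc]
  rw [Finset.sum_congr rfl h1]
  -- The new index is the degree before differentiation. Terms with `x.1 < r` vanish by the order of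
  -- `a`, those with `i < r` by the falling factorial; what remains matches exactly.
  refine Finset.sum_bij_ne_zero (fun x _ _ => x.2 + r) ?_ ?_ ?_ ?_
  · intro x hx h0
    have hx' := Finset.HasAntidiagonal.mem_antidiagonal.1 hx
    have : r ≤ x.1 := by
      by_contra hlt
      exact h0 (by rw [ha _ (not_le.1 hlt)]; simp)
    simp only [Finset.mem_range]
    omega
  · intro x hx _ y hy _ hxy
    have hx' := Finset.HasAntidiagonal.mem_antidiagonal.1 hx
    have hy' := Finset.HasAntidiagonal.mem_antidiagonal.1 hy
    ext <;> omega
  · intro i hi h0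
    have hi' : i ≤ k := by simpa [Nat.lt_succ_iff] using hi
    have hri : r ≤ i := by
      by_contra hlt
      exact h0 (by rw [Nat.descFactorial_eq_zero_iff_lt.2 (not_le.1 hlt)]; simp)
    refine ⟨(k - i + r, i - r), by simp; omega, ?_, by simp; omega⟩
    simpa [Nat.sub_add_cancel hri] using h0
  · intro x hx h0
    have hx' := Finset.HasAntidiagonal.mem_antidiagonal.1 hx
    have : r ≤ x.1 := by
      by_contra hlt
      exact h0 (by rw [ha _ (not_le.1 hlt)]; simp)
    have e : k - (x.2 + r) + r = x.1 := by omega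
    rw [e]

theorem coeff_odeAct {c : ℕ →₀ SeriesZ} (hc : ∀ r, ∀ l < r, PowerSeries.coeff l (c r) = 0)
    (u : SeriesZ) (k : ℕ) :
    PowerSeries.coeff k (odeAct c u) =
      ∑ i ∈ Finset.range (k + 1), odeSymbol c (k - i) i * PowerSeries.coeff i u := by
  simp only [odeAct, map_sum, odeSymbol, Finset.sum_mul,
    coeff_mul_iterate_derivative (hc _)]
  rw [Finset.sum_comm]

theorem coeff_odeAct_eq_add {c : ℕ →₀ SeriesZ}
    (hc : ∀ r, ∀ l < r, PowerSeries.coeff l (c r) = 0) (u : SeriesZ) (k : ℕ) :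
    PowerSeries.coeff k (odeAct c u) =
      (∑ i ∈ Finset.range k, odeSymbol c (k - i) i * PowerSeries.coeff i u) +
        odeSymbol c 0 k * PowerSeries.coeff k u := by
  rw [coeff_odeAct hc, Finset.sum_range_succ, Nat.sub_self]

/-- The truncation at `K` serves right-hand sides `z^K`: a solution then has no coefficients below
degree `K`. -/
theorem odeAct_injective {c : ℕ →₀ SeriesZ}
    (hc : ∀ r, ∀ l < r, PowerSeries.coeff l (c r) = 0) (h0 : ∀ k, odeSymbol c 0 k ≠ 0)
    {u : SeriesZ} {K : ℕ} (hu : ∀ k < K, PowerSeries.coeff k (odeAct c u) = 0) :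
    ∀ k < K, PowerSeries.coeff k u = 0 := by
  intro k
  induction k using Nat.strong_induction_on with
  | _ k ih =>
    intro hk
    have := hu k hk
    rw [coeff_odeAct_eq_add hc, Finset.sum_eq_zero, zero_add] at this
    · exact (mul_eq_zero.1 this).resolve_left (h0 k)
    · intro i hi
      have hi' := Finset.mem_range.1 hi
      rw [ih i hi' (hi'.trans hk), mul_zero]

theorem odeAct_surjective {c : ℕ →₀ SeriesZ}
    (hc : ∀ r, ∀ l < r, PowerSeries.coeff l (c r) = 0) (h0 : ∀ k, odeSymbol c 0 k ≠ 0)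
    (f : SeriesZ) : ∃ u, odeAct c u = f := by
  obtain ⟨u, hu⟩ := exists_seq_of_step (A := ℂ) fun N v =>
    (PowerSeries.coeff N f - ∑ i ∈ Finset.range N, odeSymbol c (N - i) i * v i) /
      odeSymbol c 0 N
  refine ⟨PowerSeries.mk u, ?_⟩
  ext k
  have hk : (odeSymbol c 0 k) * u k =
      PowerSeries.coeff k f - ∑ i ∈ Finset.range k, odeSymbol c (k - i) i * u i := by
    rw [hu k, mul_div_cancel₀ _ (h0 k)]
    congr 1
    refine Finset.sum_congr rfl fun i hi => ?_
    simp only [if_pos (Finset.mem_range.1 hi)]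
  rw [coeff_odeAct_eq_add hc]
  simp only [PowerSeries.coeff_mk, hk]
  ring

theorem odeAct_mem {s : ℝ≥0} {r : ℝ} (hr : 0 < r) {c : ℕ →₀ SeriesZ}
    (hc : ∀ i, c i ∈ gevreyDisc s r) {u : SeriesZ} (hu : u ∈ gevreyDisc s r) :
    odeAct c u ∈ gevreyDisc s r :=
  Submodule.sum_mem _ fun i _ =>
    mul_mem_gevreyDisc hr (hc i) (iterate_derivative_mem_gevreyDisc hr hu i)

/-! ### Inverting an ordinary differential operator on `G_s(r)` -/

theorem sum_range_half_pow_le (k : ℕ) :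
    ∑ i ∈ Finset.range k, (1 / 2 : ℝ) ^ (k - i) ≤ 1 := by
  have : ∑ i ∈ Finset.range k, (1 / 2 : ℝ) ^ (k - i) = 1 - (1 / 2) ^ k := by
    induction k with
    | zero => simp
    | succ k ih =>
      rw [Finset.sum_range_succ]
      have : ∀ i ∈ Finset.range k, (1 / 2 : ℝ) ^ (k + 1 - i) = (1 / 2) ^ (k - i) * (1 / 2) := by
        intro i hi
        have hi' := Finset.mem_range.1 hi
        rw [← pow_succ]; congr 1; omega
      rw [Finset.sum_congr rfl this, ← Finset.sum_mul, ih]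
      simp only [Nat.add_sub_cancel_left, pow_succ]
      ring
  rw [this]
  linarith [show (0 : ℝ) ≤ (1 / 2) ^ k by positivity]

theorem tendsto_one_add_rpow_neg {δ : ℝ} (hδ : 0 < δ) :
    Filter.Tendsto (fun k : ℕ => (1 + (k : ℝ)) ^ (-δ)) Filter.atTop (nhds 0) :=
  (tendsto_rpow_neg_atTop hδ).comp
    (Filter.tendsto_atTop_add_const_left _ _ tendsto_natCast_atTop_atTop)

/-- Keeps one factor `q` for smallness while retaining a summable geometric decay in `j`. -/
theorem pow_le_two_mul_half_pow {q : ℝ} (h0 : 0 ≤ q) (h1 : q ≤ 1 / 2) {j : ℕ} (hj : 1 ≤ j) :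
    q ^ j ≤ 2 * q * (1 / 2) ^ j := by
  obtain ⟨i, rfl⟩ := Nat.exists_eq_add_of_le' hj
  rw [pow_succ, pow_succ]
  have := pow_le_pow_left₀ h0 h1 i
  nlinarith

/-- If the subdiagonal terms are dominated by the diagonal, solutions inherit Borel bounds. -/
theorem borelBounded_of_odeAct {s : ℝ≥0} {c : ℕ →₀ SeriesZ}
    (hc : ∀ r, ∀ l < r, PowerSeries.coeff l (c r) = 0) {C₀ : ℝ} (hC₀ : 0 < C₀)
    (hW : ∀ k, C₀ ≤ ‖odeSymbol c 0 k‖) {R : ℝ} (hR : 0 < R) {K : ℕ}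
    (hdom : ∀ i j : ℕ, 1 ≤ j → K ≤ i + j → ‖odeSymbol c j i‖ * Real.Gamma (1 + s * i) * R ^ j ≤
      1 / 2 * (1 / 2) ^ j * (‖odeSymbol c 0 (i + j)‖ * Real.Gamma (1 + s * (i + j : ℕ))))
    {u : SeriesZ} (hu : BorelBounded s R (odeAct c u)) : BorelBounded s R u := by
  obtain ⟨F, hF⟩ := hu
  have hF0 : 0 ≤ F := by simpa using (norm_nonneg _).trans (by simpa using hF 0)
  set a : ℕ → ℝ := fun i => ‖PowerSeries.coeff i u‖ * R ^ i / Real.Gamma (1 + s * i) with ha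
  have ha0 : ∀ i, 0 ≤ a i := fun i => by
    have := gamma_pos s i
    positivity
  have hau : ∀ i, ‖PowerSeries.coeff i u‖ * R ^ i = a i * Real.Gamma (1 + s * i) := fun i => by
    have := gamma_pos s i
    simp only [ha]
    field_simp
  -- The sum covers the degrees below `K`. The summand `2F/C₀` makes the right-hand side use at most
  -- half of `D M`; the subdiagonal terms use the other half.
  set M := ∑ i ∈ Finset.range K, a i + 2 * F / C₀ with hM
  have hM0 : 0 ≤ M := add_nonneg (Finset.sum_nonneg fun i _ => ha0 i) (by positivity)
  suffices h : ∀ k, a k ≤ M from ⟨M, fun k => by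
    rw [hau]
    exact mul_le_mul_of_nonneg_right (h k) (gamma_pos s k).le⟩
  intro k
  induction k using Nat.strong_induction_on with
  | _ k ih =>
    by_cases hk : k < K
    · have := Finset.single_le_sum (fun i _ => ha0 i) (Finset.mem_range.2 hk)
      linarith [show 0 ≤ 2 * F / C₀ by positivity]
    have gk := gamma_pos s k
    set D := ‖odeSymbol c 0 k‖ * Real.Gamma (1 + s * k) with hD
    have hW0 := hC₀.trans_le (hW k)
    have hD0 : 0 < D := by positivity
    have hterm : ∀ i ∈ Finset.range k,
        ‖odeSymbol c (k - i) i * PowerSeries.coeff i u‖ * R ^ k ≤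
          (1 / 2) ^ (k - i) * (1 / 2 * D * M) := by
      intro i hi
      have hi' := Finset.mem_range.1 hi
      have hik : i + (k - i) = k := by omega
      have h1 := hdom i (k - i) (by omega) (by omega)
      rw [hik] at h1
      have hRk : R ^ k = R ^ i * R ^ (k - i) := by rw [← pow_add, hik]
      rw [norm_mul, hRk]
      have hai := ih i hi'
      calc ‖odeSymbol c (k - i) i‖ * ‖PowerSeries.coeff i u‖ * (R ^ i * R ^ (k - i))
          = ‖odeSymbol c (k - i) i‖ * R ^ (k - i) * (‖PowerSeries.coeff i u‖ * R ^ i) := by ring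
        _ = (‖odeSymbol c (k - i) i‖ * Real.Gamma (1 + s * i) * R ^ (k - i)) * a i := by
            rw [hau]; ring
        _ ≤ (1 / 2 * (1 / 2) ^ (k - i) * D) * M := mul_le_mul h1 hai (ha0 i) (by positivity)
        _ = _ := by ring
    have heq := coeff_odeAct_eq_add hc u k
    have h2 : odeSymbol c 0 k * PowerSeries.coeff k u = PowerSeries.coeff k (odeAct c u) -
        ∑ i ∈ Finset.range k, odeSymbol c (k - i) i * PowerSeries.coeff i u := by
      rw [heq]; ring
    have h3 : ‖odeSymbol c 0 k‖ * ‖PowerSeries.coeff k u‖ ≤ ‖PowerSeries.coeff k (odeAct c u)‖ +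
        ∑ i ∈ Finset.range k, ‖odeSymbol c (k - i) i * PowerSeries.coeff i u‖ := by
      rw [← norm_mul, h2]
      exact (norm_sub_le _ _).trans (add_le_add_right (norm_sum_le _ _) _)
    have h4 : D * a k ≤ F * Real.Gamma (1 + s * k) + 1 / 2 * D * M := by
      calc D * a k = ‖odeSymbol c 0 k‖ * ‖PowerSeries.coeff k u‖ * R ^ k := by
            rw [hD, mul_assoc ‖odeSymbol c 0 k‖ ‖PowerSeries.coeff k u‖, hau]; ring
        _ ≤ (‖PowerSeries.coeff k (odeAct c u)‖ +
              ∑ i ∈ Finset.range k, ‖odeSymbol c (k - i) i * PowerSeries.coeff i u‖) * R ^ k := by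
            gcongr
        _ = ‖PowerSeries.coeff k (odeAct c u)‖ * R ^ k +
              ∑ i ∈ Finset.range k, ‖odeSymbol c (k - i) i * PowerSeries.coeff i u‖ * R ^ k := by
            rw [add_mul, Finset.sum_mul]
        _ ≤ F * Real.Gamma (1 + s * k) +
              ∑ i ∈ Finset.range k, (1 / 2) ^ (k - i) * (1 / 2 * D * M) :=
            add_le_add (hF k) (Finset.sum_le_sum hterm)
        _ ≤ F * Real.Gamma (1 + s * k) + 1 * (1 / 2 * D * M) := by
            rw [← Finset.sum_mul]
            gcongr
            exact sum_range_half_pow_le k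
        _ = _ := by ring
    have h5 : F * Real.Gamma (1 + s * k) ≤ 1 / 2 * D * M := by
      have h6 : 2 * F / C₀ ≤ M := by
        have := Finset.sum_nonneg (s := Finset.range K) fun i _ => ha0 i
        linarith
      rw [div_le_iff₀ hC₀] at h6
      have h7 : M * C₀ ≤ M * ‖odeSymbol c 0 k‖ := by gcongr; exact hW k
      calc F * Real.Gamma (1 + s * k) ≤ (1 / 2 * (M * ‖odeSymbol c 0 k‖)) *
            Real.Gamma (1 + s * k) := by gcongr; linarith
        _ = _ := by rw [hD]; ring
    have h8 : D * a k ≤ D * M := by linarith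
    exact le_of_mul_le_mul_left h8 hD0

/-- Uniform lower bounds for the radii `r` on which an ordinary differential operator is
surjective on `G_s(r)`. -/
theorem exists_radius (s : ℝ≥0) (N : ℕ) {Q C : ℝ} (hQ : 0 ≤ Q) (hC : 0 ≤ C) :
    ∃ ε > (0 : ℝ), ∀ (c : ℕ →₀ SeriesZ) (p : ℕ) (A X : ℝ), 0 ≤ A → 1 ≤ X →
      OdeBounds s c p N A C → (∀ r, ∀ l < r, PowerSeries.coeff l (c r) = 0) →
      (∃ C₀ > (0 : ℝ), ∀ k, C₀ ≤ ‖odeSymbol c 0 k‖) →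
      (∀ r j : ℕ, 1 ≤ j → (r : ℝ) = p + j * s → ‖PowerSeries.coeff (j + r) (c r)‖ ≤
        Q * (C * X) ^ j * Real.Gamma (1 + s * j) * ‖PowerSeries.coeff p (c p)‖) →
      ∀ r : ℝ, 0 < r → r ≤ ε / X → ∀ u, odeAct c u ∈ gevreyDisc s r → u ∈ gevreyDisc s r := by
  obtain ⟨κ, hκ, hsym⟩ := exists_symbol_le s N
  -- With this radius, `q = 2CXR` satisfies `q ≤ 1/2` and `2κQq ≤ 1/4`; writing `C + 1` avoids
  -- division by zero when `C = 0`.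
  refine ⟨1 / (4 * (C + 1) * (1 + 8 * κ * Q)), by positivity,
    fun c p A X hA hX h hc ⟨C₀, hC₀, hW⟩ hedge r hr hrε u hu => ?_⟩
  set ε := 1 / (4 * (C + 1) * (1 + 8 * κ * Q)) with hε
  have hX0 : 0 < X := by linarith
  obtain ⟨δ, hδ, B, hB, K₁, hK₁⟩ := hsym c p A C (fun j => Q * (C * X) ^ j) hA hC h
    (fun j => by positivity) hedge
  -- Off the edge smallness comes from large `i + j` and not from the radius, so the
  -- operator-dependent constants `δ` and `B` influence only the threshold degree.
  have hlim := ((tendsto_one_add_rpow_neg hδ).const_mul (κ * B)).eventually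
    (gt_mem_nhds (show κ * B * 0 < 1 / 4 by norm_num))
  obtain ⟨K₂, hK₂⟩ := Filter.eventually_atTop.1 hlim
  rw [mem_gevreyDisc_iff hr] at hu ⊢
  intro R hR hRr
  refine borelBounded_of_odeAct hc hC₀ hW hR (K := max K₁ K₂) ?_ (hu R hR hRr)
  intro i j hj hij
  have h1 := hK₁ i j hj (by omega)
  have h2 := (hK₂ (i + j) (by omega)).le
  set k := i + j with hk
  have gk := gamma_pos s k
  set D := ‖odeSymbol c 0 k‖ * Real.Gamma (1 + s * k) with hD
  have hRX : R * X ≤ ε := by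
    have := (hRr.le.trans hrε)
    rwa [le_div_iff₀ hX0] at this
  have hε0 : 0 < ε := by positivity
  set q := 2 * (C * X) * R with hq
  have hq0 : 0 ≤ q := by positivity
  have hqε : q ≤ 2 * C * ε := by
    calc q = 2 * C * (R * X) := by rw [hq]; ring
      _ ≤ _ := by gcongr
  have hCε : 2 * C * ε ≤ 1 / 2 * (1 / (1 + 8 * κ * Q)) := by
    rw [hε]
    have : 2 * C * (1 / (4 * (C + 1) * (1 + 8 * κ * Q))) =
        (C / (C + 1)) * (1 / 2 * (1 / (1 + 8 * κ * Q))) := by field_simp; ring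
    rw [this]
    apply mul_le_of_le_one_left (by positivity)
    rw [div_le_one (by positivity)]
    linarith
  have hone : 1 / (1 + 8 * κ * Q) ≤ 1 := by
    rw [div_le_one (by positivity)]
    linarith [show 0 ≤ 8 * κ * Q by positivity]
  have hq1 : q ≤ 1 / 2 := by linarith
  have hq2 : κ * Q * (2 * q) ≤ 1 / 4 := by
    have : κ * Q * (2 * q) ≤ κ * Q * (1 / (1 + 8 * κ * Q)) := by gcongr; linarith
    refine this.trans ?_
    rw [mul_one_div, div_le_iff₀ (by positivity)]
    nlinarith [mul_nonneg hκ.le hQ]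
  have hqj := pow_le_two_mul_half_pow hq0 hq1 hj
  have hCR : (2 * C * R) ^ j ≤ (1 / 2) ^ j := by
    apply pow_le_pow_left₀ (by positivity)
    refine le_trans ?_ hq1
    rw [hq]
    have : C * 1 ≤ C * X := by gcongr
    nlinarith
  calc ‖odeSymbol c j i‖ * Real.Gamma (1 + s * i) * R ^ j
      ≤ (κ * 2 ^ j * (Q * (C * X) ^ j + B * (1 + (k : ℝ)) ^ (-δ) * C ^ j) * D) * R ^ j := by
        gcongr
    _ = (κ * Q * q ^ j + κ * B * (1 + (k : ℝ)) ^ (-δ) * (2 * C * R) ^ j) * D := by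
        rw [hq, mul_pow, mul_pow, mul_pow, mul_pow]; ring
    _ ≤ (κ * Q * (2 * q * (1 / 2) ^ j) + 1 / 4 * (1 / 2) ^ j) * D := by gcongr
    _ = (κ * Q * (2 * q) + 1 / 4) * (1 / 2) ^ j * D := by ring
    _ ≤ (1 / 4 + 1 / 4) * (1 / 2) ^ j * D := by gcongr
    _ = _ := by ring

/-! ### Solutions with small radius -/

theorem tsum_sum_antidiagonal (F : ℕ → ℕ → ℝ≥0∞) :
    ∑' k : ℕ, ∑ x ∈ Finset.HasAntidiagonal.antidiagonal k, F x.1 x.2 = ∑' i, ∑' j, F i j := by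
  rw [← ENNReal.tsum_prod, ← Finset.HasAntidiagonal.sigmaAntidiagonalEquivProd.tsum_eq
    (fun x : ℕ × ℕ => F x.1 x.2), ENNReal.tsum_sigma']
  refine tsum_congr fun k => ?_
  rw [tsum_fintype, ← Finset.sum_coe_sort]
  rfl

/-- The size of the symbol relative to its value on the diagonal, in the weights
`r^k / Γ(1+sk)`. -/
def relSymbol (s : ℝ≥0) (c : ℕ →₀ SeriesZ) (r : ℝ) (j i : ℕ) : ℝ :=
  ‖odeSymbol c j i‖ * Real.Gamma (1 + s * i) * r ^ j /
    (‖odeSymbol c 0 (i + j)‖ * Real.Gamma (1 + s * (i + j : ℕ)))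

theorem relSymbol_nonneg (s : ℝ≥0) (c : ℕ →₀ SeriesZ) {r : ℝ} (hr : 0 ≤ r) (j i : ℕ) :
    0 ≤ relSymbol s c r j i := by
  have g1 := gamma_pos s i
  have g2 := gamma_pos s (i + j)
  unfold relSymbol
  positivity

/-- Let `a_i` be the weighted coefficients of `u` and `ρ_j(i)` the relative symbols. The equation in
degree `i + J` bounds `a_i ρ_J(i)` by the other terms of that degree. Summed over `i`, this gives `∑
a_i ρ_J(i) ≤ ∑_i ∑_{j ≠ J} a_i ρ_j(i)`, whereas `hdom` makes the left side at least `∑ a_i` plus the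
right side. Cancelling leaves `∑ a_i = 0`, but `a_K > 0`. Sums in `ℝ≥0∞` can be rearranged freely.
-/
theorem false_of_dominant {s : ℝ≥0} {c : ℕ →₀ SeriesZ}
    (hc : ∀ r, ∀ l < r, PowerSeries.coeff l (c r) = 0) (hW : ∀ k, odeSymbol c 0 k ≠ 0)
    {r : ℝ} (hr : 0 < r) {J K : ℕ} (hJ : 1 ≤ J) {u : SeriesZ}
    (hu : odeAct c u = PowerSeries.X ^ K)
    (hsum : Summable fun i : ℕ => ‖PowerSeries.coeff i u‖ * r ^ i / Real.Gamma (1 + s * i))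
    (hdom : ∀ i ≥ K, 1 + ∑' j, (if j = J then 0 else ENNReal.ofReal (relSymbol s c r j i)) ≤
      ENNReal.ofReal (relSymbol s c r J i))
    (hbdd : ∃ G : ℝ, ∀ i ≥ K, relSymbol s c r J i ≤ G) : False := by
  obtain ⟨G, hG⟩ := hbdd
  set a : ℕ → ℝ := fun i => ‖PowerSeries.coeff i u‖ * r ^ i / Real.Gamma (1 + s * i) with ha
  have ha0 : ∀ i, 0 ≤ a i := fun i => by
    have := gamma_pos s i
    positivity
  have hlow : ∀ i < K, PowerSeries.coeff i u = 0 :=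
    odeAct_injective hc hW fun k hk => by
      rw [hu, PowerSeries.coeff_X_pow, if_neg hk.ne]
  have haK : 0 < a K := by
    have h1 := coeff_odeAct_eq_add hc u K
    rw [Finset.sum_eq_zero, zero_add, hu, PowerSeries.coeff_X_pow, if_pos rfl] at h1
    · have : PowerSeries.coeff K u ≠ 0 := by
        rintro h0
        rw [h0, mul_zero] at h1
        exact one_ne_zero h1
      have h2 := norm_pos_iff.2 this
      have h3 := gamma_pos s K
      simp only [ha]
      positivity
    · intro i hi
      rw [hlow i (Finset.mem_range.1 hi), mul_zero]
  let b : ℕ → ℝ≥0∞ := fun i => ENNReal.ofReal (a i)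
  have hb0 : ∀ i < K, b i = 0 := fun i hi => by simp [b, ha, hlow i hi]
  let F : ℕ → ℕ → ℝ≥0∞ := fun i j =>
    if j = J then 0 else b i * ENNReal.ofReal (relSymbol s c r j i)
  have key : ∀ i, b i * ENNReal.ofReal (relSymbol s c r J i) ≤
      ∑ x ∈ Finset.HasAntidiagonal.antidiagonal (i + J), F x.1 x.2 := by
    intro i
    by_cases hi : i < K
    · simp [hb0 i hi]
    have h1 := coeff_odeAct hc u (i + J)
    -- Since `i ≥ K` and `J ≥ 1`, the degree `i + J` exceeds `K` and the right-hand side contributes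
    -- nothing.
    rw [hu, PowerSeries.coeff_X_pow, if_neg (by omega)] at h1
    have h2 := Finset.Nat.sum_antidiagonal_eq_sum_range_succ
      (fun i j => odeSymbol c j i * PowerSeries.coeff i u) (i + J)
    rw [Nat.succ_eq_add_one, ← h1] at h2
    have hmem : (i, J) ∈ Finset.HasAntidiagonal.antidiagonal (i + J) := by simp
    rw [← Finset.add_sum_erase _ _ hmem] at h2
    have h3 : ‖odeSymbol c J i‖ * ‖PowerSeries.coeff i u‖ ≤
        ∑ x ∈ (Finset.HasAntidiagonal.antidiagonal (i + J)).erase (i, J),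
          ‖odeSymbol c x.2 x.1‖ * ‖PowerSeries.coeff x.1 u‖ := by
      rw [← norm_mul, eq_neg_of_add_eq_zero_left h2, norm_neg]
      refine (norm_sum_le _ _).trans (le_of_eq (Finset.sum_congr rfl fun x _ => norm_mul _ _))
    have hrel : ∀ x ∈ Finset.HasAntidiagonal.antidiagonal (i + J),
        a x.1 * relSymbol s c r x.2 x.1 = ‖odeSymbol c x.2 x.1‖ * ‖PowerSeries.coeff x.1 u‖ *
          (r ^ (i + J) / (‖odeSymbol c 0 (i + J)‖ * Real.Gamma (1 + s * (i + J : ℕ)))) := by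
      intro x hx
      have hx' := Finset.HasAntidiagonal.mem_antidiagonal.1 hx
      have g1 := gamma_pos s x.1
      have hp : r ^ (i + J) = r ^ x.1 * r ^ x.2 := by rw [← hx', pow_add]
      simp only [ha, relSymbol, hx', hp]
      field_simp
    have hpos : 0 ≤ r ^ (i + J) / (‖odeSymbol c 0 (i + J)‖ * Real.Gamma (1 + s * (i + J : ℕ))) := by
      have := gamma_pos s (i + J)
      positivity
    have h4 : a i * relSymbol s c r J i ≤
        ∑ x ∈ (Finset.HasAntidiagonal.antidiagonal (i + J)).erase (i, J),
          a x.1 * relSymbol s c r x.2 x.1 := by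
      have h5 := mul_le_mul_of_nonneg_right h3 hpos
      rw [Finset.sum_mul, ← hrel (i, J) hmem] at h5
      refine h5.trans (le_of_eq (Finset.sum_congr rfl fun x hx => ?_))
      rw [hrel x (Finset.mem_of_mem_erase hx)]
    calc b i * ENNReal.ofReal (relSymbol s c r J i)
        = ENNReal.ofReal (a i * relSymbol s c r J i) := (ENNReal.ofReal_mul (ha0 i)).symm
      _ ≤ ENNReal.ofReal (∑ x ∈ (Finset.HasAntidiagonal.antidiagonal (i + J)).erase (i, J),
          a x.1 * relSymbol s c r x.2 x.1) := ENNReal.ofReal_le_ofReal h4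
      _ = ∑ x ∈ (Finset.HasAntidiagonal.antidiagonal (i + J)).erase (i, J), F x.1 x.2 := by
          rw [ENNReal.ofReal_sum_of_nonneg fun x _ =>
            mul_nonneg (ha0 _) (relSymbol_nonneg s c hr.le _ _)]
          refine Finset.sum_congr rfl fun x hx => ?_
          have hx1 := Finset.HasAntidiagonal.mem_antidiagonal.1 (Finset.mem_of_mem_erase hx)
          have hx2 : x.2 ≠ J := fun h => Finset.ne_of_mem_erase hx (Prod.ext (by simp; omega) h)
          simp only [F, if_neg hx2, b]
          rw [ENNReal.ofReal_mul (ha0 _)]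
      _ ≤ _ := Finset.sum_le_sum_of_subset (Finset.erase_subset _ _)
  have h1 : ∑' i, b i * ENNReal.ofReal (relSymbol s c r J i) ≤ ∑' i, ∑' j, F i j := by
    rw [← tsum_sum_antidiagonal]
    refine (ENNReal.tsum_le_tsum key).trans ?_
    exact ENNReal.tsum_comp_le_tsum_of_injective (add_left_injective J) _
  have h2 : ∑' i, b i + ∑' i, ∑' j, F i j ≤ ∑' i, b i * ENNReal.ofReal (relSymbol s c r J i) := by
    rw [← ENNReal.tsum_add]
    refine ENNReal.tsum_le_tsum fun i => ?_
    by_cases hi : i < K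
    · simp [F, hb0 i hi]
    refine le_trans (le_of_eq ?_) (mul_le_mul_right (hdom i (not_lt.1 hi)) (b i))
    rw [mul_add, mul_one, ← ENNReal.tsum_mul_left]
    congr 1
    refine tsum_congr fun j => ?_
    simp only [F]
    split_ifs <;> simp
  have hfin : ∑' i, b i ≠ ⊤ := hsum.tsum_ofReal_ne_top
  -- Finiteness, needed for the cancellation, comes from `hsum` and the bound `G`.
  have h3 : ∑' i, b i * ENNReal.ofReal (relSymbol s c r J i) ≠ ⊤ := by
    refine ne_top_of_le_ne_top (ENNReal.mul_ne_top hfin (ENNReal.ofReal_ne_top (r := G))) ?_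
    rw [← ENNReal.tsum_mul_right]
    refine ENNReal.tsum_le_tsum fun i => ?_
    by_cases hi : i < K
    · simp [hb0 i hi]
    · exact mul_le_mul_right (ENNReal.ofReal_le_ofReal (hG i (not_lt.1 hi))) _
  have h4 : ∑' i, b i + ∑' i, ∑' j, F i j ≤ 0 + ∑' i, ∑' j, F i j := by
    rw [zero_add]
    exact h2.trans h1
  have h5 : ∑' i, ∑' j, F i j ≠ ⊤ :=
    ne_top_of_le_ne_top h3 (le_trans le_add_self h2)
  have h6 := (ENNReal.add_le_add_iff_right h5).1 h4
  have h7 : b K ≤ 0 := (ENNReal.le_tsum K).trans h6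
  exact absurd (ENNReal.ofReal_pos.2 haK) (not_lt.2 h7)

/-- The `4` leaves room for the required surplus `1`, the diagonal term `1`, and a geometric series
of sum `2`. -/
theorem exists_large_scale {J : ℕ} (hJ : 1 ≤ J) {M q L : ℝ} (hM : 0 ≤ M) (hq : 0 < q)
    (hL : 0 ≤ L) : ∃ x ≥ (1 : ℝ), 4 + M * (1 + L * x) ^ (J - 1) ≤ q * x ^ J := by
  set x := max 1 ((4 + M * (1 + L) ^ (J - 1)) / q) with hx
  have h1 : 1 ≤ x := le_max_left _ _
  have h2 : 4 + M * (1 + L) ^ (J - 1) ≤ x * q := by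
    rw [← div_le_iff₀ hq]
    exact le_max_right _ _
  have h3 : 1 ≤ x ^ (J - 1) := one_le_pow₀ h1
  refine ⟨x, h1, ?_⟩
  have hpow : x ^ J = x * x ^ (J - 1) := by rw [← pow_succ', Nat.sub_add_cancel hJ]
  calc 4 + M * (1 + L * x) ^ (J - 1) ≤ 4 * x ^ (J - 1) + M * ((1 + L) * x) ^ (J - 1) := by
        gcongr
        · linarith
        · nlinarith
    _ = (4 + M * (1 + L) ^ (J - 1)) * x ^ (J - 1) := by rw [mul_pow]; ring
    _ ≤ (x * q) * x ^ (J - 1) := by gcongr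
    _ = q * x ^ J := by rw [hpow]; ring

/-- If the edge coefficient with index `J` dominates the others, some solution of
`∑_r c_r ∂_z^r u = z^K` has radius at most `x/X`. -/
theorem exists_scale (s : ℝ≥0) (N p J l : ℕ) (hJ : 1 ≤ J) (hl : (l : ℝ) = J * s) {Q C q : ℝ}
    (hQ : 0 ≤ Q) (hC : 0 ≤ C) (hq : 0 < q) :
    ∃ x > (0 : ℝ), ∃ y₀ > (0 : ℝ), ∀ (c : ℕ →₀ SeriesZ) (A X Y : ℝ), 0 ≤ A → 0 < X → 0 ≤ Y →
      Y ≤ y₀ → X⁻¹ ≤ y₀ → OdeBounds s c p N A C →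
      (∀ r, ∀ l < r, PowerSeries.coeff l (c r) = 0) → (∀ k, odeSymbol c 0 k ≠ 0) →
      (∀ r j : ℕ, 1 ≤ j → j ≤ J → (r : ℝ) = p + j * s → ‖PowerSeries.coeff (j + r) (c r)‖ ≤
        Q * (C * X) ^ j * Real.Gamma (1 + s * j) * ‖PowerSeries.coeff p (c p)‖) →
      (∀ r j : ℕ, J < j → (r : ℝ) = p + j * s → ‖PowerSeries.coeff (j + r) (c r)‖ ≤
        Q * (C * X * Y) ^ j * Real.Gamma (1 + s * j) * ‖PowerSeries.coeff p (c p)‖) →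
      q * X ^ J * ‖PowerSeries.coeff p (c p)‖ ≤ ‖PowerSeries.coeff (J + (p + l)) (c (p + l))‖ →
      ∃ K : ℕ, ∀ u, odeAct c u = PowerSeries.X ^ K → ∀ R : ℝ, x / X < R → u ∉ gevreyDisc s R := by
  obtain ⟨κ, hκ, hsym⟩ := exists_symbol_le s N
  obtain ⟨κ', hκ', hlow⟩ := exists_le_symbol s p J l hl
  obtain ⟨x, hx1, hx⟩ := exists_large_scale hJ (M := J * (κ * Q)) (q := κ' * q) (L := 2 * C)
    (by positivity) (by positivity) (by positivity)
  have hx0 : 0 < x := by linarith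
  -- For `Y` and `X⁻¹` below this bound, `2CxY` and `2Cx/X` are at most `1/2`, and `4κQCxY ≤ 1/2`.
  refine ⟨x, hx0, 1 / (2 * (1 + 2 * C * x) * (1 + 4 * κ * Q)), by positivity,
    fun c A X Y hA hX hY hYy hXy h hc hW hedge hedge' htop => ?_⟩
  set y₀ := 1 / (2 * (1 + 2 * C * x) * (1 + 4 * κ * Q)) with hy₀
  have ht : 0 < ‖PowerSeries.coeff p (c p)‖ := norm_pos_iff.2 h.top
  set T := ‖PowerSeries.coeff p (c p)‖ with hT
  let φ : ℕ → ℝ := fun j => if j ≤ J then Q * (C * X) ^ j else Q * (C * X * Y) ^ j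
  have hφ0 : ∀ j, 0 ≤ φ j := fun j => by
    simp only [φ]
    split_ifs <;> positivity
  obtain ⟨δ, hδ, B, hB, K₁, hK₁⟩ := hsym c p A C φ hA hC h hφ0 (fun r j hj hr => by
    simp only [φ]
    split_ifs with hjJ
    · exact hedge r j hj hjJ hr
    · exact hedge' r j (not_le.1 hjJ) hr)
  have htop0 : PowerSeries.coeff (J + (p + l)) (c (p + l)) ≠ 0 :=
    norm_pos_iff.1 (lt_of_lt_of_le (by positivity) htop)
  obtain ⟨K₂, hK₂⟩ := hlow c N A C h htop0
  have hlim := ((tendsto_one_add_rpow_neg hδ).const_mul (κ * B)).eventually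
    (gt_mem_nhds (show κ * B * 0 < 1 / 2 by norm_num))
  obtain ⟨K₃, hK₃⟩ := Filter.eventually_atTop.1 hlim
  set K := max K₁ (max K₂ K₃) with hK
  refine ⟨K, fun u hu R hR hmem => ?_⟩
  -- At this radius `(CX)^j r^j = (Cx)^j`, so the edge terms no longer depend on `X`.
  set r := x / X with hr
  have hr0 : 0 < r := by positivity
  have hXr : X * r = x := by rw [hr]; field_simp
  have hden : ∀ k, 0 < ‖odeSymbol c 0 k‖ * Real.Gamma (1 + s * k) := fun k => by
    have h1 := norm_pos_iff.2 (hW k)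
    have h2 := gamma_pos s k
    positivity
  have hy1 : 2 * C * x * y₀ ≤ 1 / 2 * (1 / (1 + 4 * κ * Q)) := by
    have : 2 * C * x * y₀ = (2 * C * x / (1 + 2 * C * x)) * (1 / 2 * (1 / (1 + 4 * κ * Q))) := by
      rw [hy₀]; field_simp
    rw [this]
    apply mul_le_of_le_one_left (by positivity)
    rw [div_le_one (by positivity)]
    linarith
  have hone : 1 / (1 + 4 * κ * Q) ≤ 1 := by
    rw [div_le_one (by positivity)]
    linarith [show 0 ≤ 4 * κ * Q by positivity]
  have hz : 2 * C * x * Y ≤ 1 / 2 * (1 / (1 + 4 * κ * Q)) :=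
    (mul_le_mul_of_nonneg_left hYy (by positivity)).trans hy1
  have hz1 : 2 * C * x * Y ≤ 1 / 2 := by linarith
  have hz2 : κ * Q * (2 * (2 * C * x * Y)) ≤ 1 / 2 := by
    have : κ * Q * (2 * (2 * C * x * Y)) ≤ κ * Q * (1 / (1 + 4 * κ * Q)) := by gcongr; linarith
    refine this.trans ?_
    rw [mul_one_div, div_le_iff₀ (by positivity)]
    nlinarith [mul_nonneg hκ.le hQ]
  have hCr : 2 * C * r ≤ 1 / 2 := by
    have : 2 * C * r = 2 * C * x * X⁻¹ := by rw [hr]; ring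
    rw [this]
    have := mul_le_mul_of_nonneg_left hXy (show 0 ≤ 2 * C * x by positivity)
    linarith
  have hupper : ∀ i j, 1 ≤ j → K ≤ i → relSymbol s c r j i ≤
      κ * φ j * (2 * r) ^ j + 1 / 2 * (1 / 2) ^ j := by
    intro i j hj hi
    have h1 := hK₁ i j hj (by omega)
    have h2 := (hK₃ (i + j) (by omega)).le
    unfold relSymbol
    rw [div_le_iff₀ (hden _)]
    calc ‖odeSymbol c j i‖ * Real.Gamma (1 + s * i) * r ^ j
        ≤ (κ * 2 ^ j * (φ j + B * (1 + (i + j : ℕ) : ℝ) ^ (-δ) * C ^ j) *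
            (‖odeSymbol c 0 (i + j)‖ * Real.Gamma (1 + s * (i + j : ℕ)))) * r ^ j := by gcongr
      _ = (κ * φ j * (2 * r) ^ j + κ * B * (1 + (i + j : ℕ) : ℝ) ^ (-δ) * (2 * C * r) ^ j) *
            (‖odeSymbol c 0 (i + j)‖ * Real.Gamma (1 + s * (i + j : ℕ))) := by
          rw [mul_pow, mul_pow, mul_pow]; ring
      _ ≤ _ := by
          have h3 : (2 * C * r) ^ j ≤ (1 / 2) ^ j := pow_le_pow_left₀ (by positivity) hCr j
          have h4 : κ * B * (1 + (i + j : ℕ) : ℝ) ^ (-δ) * (2 * C * r) ^ j ≤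
              1 / 2 * (1 / 2) ^ j := by gcongr
          exact mul_le_mul_of_nonneg_right (by linarith) (hden _).le
  set H := κ * Q * (1 + 2 * C * x) ^ (J - 1) with hH
  have hH0 : 0 ≤ H := by positivity
  -- Majorant for the terms with `j ≠ J`: `1` for the diagonal, `H` for the edge below `J`, and
  -- `(1/2)^j` shared between the edge beyond `J` and everything off the edge.
  let m : ℕ → ℝ := fun j => (if j = 0 then 1 else 0) + (if j < J then H else 0) + (1 / 2) ^ j
  have hm0 : ∀ j, 0 ≤ m j := fun j => by
    simp only [m]
    have : (0 : ℝ) ≤ if j = 0 then 1 else 0 := by split_ifs <;> norm_num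
    have : (0 : ℝ) ≤ if j < J then H else 0 := by split_ifs <;> simp [hH0]
    positivity
  have hmsum : HasSum m (1 + J * H + 2) := by
    refine ((hasSum_ite_eq 0 1).add ?_).add hasSum_geometric_two
    have : HasSum (fun j : ℕ => if j < J then H else 0)
        (∑ j ∈ Finset.range J, if j < J then H else 0) :=
      hasSum_sum_of_ne_finset_zero fun j hj => if_neg (by simpa using hj)
    rw [Finset.sum_congr rfl fun j hj => if_pos (Finset.mem_range.1 hj)] at this
    simpa using this
  have hmrel : ∀ i j, K ≤ i → j ≠ J → relSymbol s c r j i ≤ m j := by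
    intro i j hi hjJ
    have hpow0 : (0 : ℝ) ≤ (1 / 2) ^ j := by positivity
    rcases Nat.eq_zero_or_pos j with rfl | hj
    · have : relSymbol s c r 0 i = 1 := by
        simp only [relSymbol, pow_zero, mul_one, add_zero]
        exact div_self (hden i).ne'
      rw [this]
      simp only [m, if_true]
      have : (0 : ℝ) ≤ if 0 < J then H else 0 := by split_ifs <;> simp [hH0]
      linarith
    refine (hupper i j hj hi).trans ?_
    simp only [m, φ, if_neg (Nat.pos_iff_ne_zero.1 hj), zero_add]
    rcases lt_or_gt_of_ne hjJ with hlt | hgt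
    · rw [if_pos hlt.le, if_pos hlt]
      have : κ * (Q * (C * X) ^ j) * (2 * r) ^ j ≤ H := by
        calc κ * (Q * (C * X) ^ j) * (2 * r) ^ j = κ * Q * (2 * C * (X * r)) ^ j := by
              rw [mul_pow, mul_pow, mul_pow, mul_pow, mul_pow]; ring
          _ ≤ κ * Q * (1 + 2 * C * x) ^ j := by rw [hXr]; gcongr; linarith
          _ ≤ H := by
              rw [hH]
              gcongr
              · linarith [show 0 ≤ 2 * C * x by positivity]
              · omega
      linarith
    · rw [if_neg (not_le.2 hgt), if_neg (by omega), zero_add]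
      have h1 : κ * (Q * (C * X * Y) ^ j) * (2 * r) ^ j = κ * Q * (2 * C * (X * r) * Y) ^ j := by
        simp only [mul_pow]; ring
      have h2 := pow_le_two_mul_half_pow (q := 2 * C * x * Y) (by positivity) hz1 hj
      rw [h1, hXr]
      have h3 : κ * Q * (2 * C * x * Y) ^ j ≤ 1 / 2 * (1 / 2) ^ j := by
        calc κ * Q * (2 * C * x * Y) ^ j ≤ κ * Q * (2 * (2 * C * x * Y) * (1 / 2) ^ j) := by gcongr
          _ = (κ * Q * (2 * (2 * C * x * Y))) * (1 / 2) ^ j := by ring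
          _ ≤ _ := by gcongr
      linarith
  refine false_of_dominant (s := s) hc hW hr0 hJ hu ?_ ?_ ?_
  -- Boundedness at a radius strictly between `r` and `R` gives summability at `r`.
  · obtain ⟨R', h1, h2⟩ := exists_between hR
    have hR' : 0 < R' := hr0.trans h1
    obtain ⟨M, hM⟩ := (mem_gevreyDisc_iff (hr0.trans hR)).1 hmem R' hR' h2
    refine Summable.of_nonneg_of_le (fun i => ?_) (fun i => ?_)
      ((summable_geometric_of_lt_one (by positivity) ((div_lt_one hR').2 h1)).mul_left M)
    · have := gamma_pos s i
      positivity
    · have gi := gamma_pos s i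
      rw [div_le_iff₀ gi, div_pow r R']
      calc ‖PowerSeries.coeff i u‖ * r ^ i
          = (‖PowerSeries.coeff i u‖ * R' ^ i) * (r ^ i / R' ^ i) := by field_simp
        _ ≤ (M * Real.Gamma (1 + s * i)) * (r ^ i / R' ^ i) :=
            mul_le_mul_of_nonneg_right (hM i) (by positivity)
        _ = _ := by ring
  · intro i hi
    have h1 : κ' * q * x ^ J ≤ relSymbol s c r J i := by
      unfold relSymbol
      rw [le_div_iff₀ (hden _)]
      have h2 := hK₂ i (by omega)
      have h3 : κ' * q * x ^ J ≤
          κ' * ‖PowerSeries.coeff (J + (p + l)) (c (p + l))‖ / T * r ^ J := by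
        calc κ' * q * x ^ J = κ' * (q * X ^ J * T) / T * r ^ J := by
              rw [← hXr, mul_pow]; field_simp
          _ ≤ _ := by gcongr
      calc κ' * q * x ^ J * (‖odeSymbol c 0 (i + J)‖ * Real.Gamma (1 + s * (i + J : ℕ)))
          ≤ (κ' * ‖PowerSeries.coeff (J + (p + l)) (c (p + l))‖ / T * r ^ J) *
            (‖odeSymbol c 0 (i + J)‖ * Real.Gamma (1 + s * (i + J : ℕ))) :=
            mul_le_mul_of_nonneg_right h3 (hden _).le
        _ = (κ' * ‖PowerSeries.coeff (J + (p + l)) (c (p + l))‖ / T *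
            (‖odeSymbol c 0 (i + J)‖ * Real.Gamma (1 + s * (i + J : ℕ)))) * r ^ J := by ring
        _ ≤ _ := by gcongr
    have h2 : ∑' j, (if j = J then 0 else ENNReal.ofReal (relSymbol s c r j i)) ≤
        ENNReal.ofReal (1 + J * H + 2) := by
      rw [← hmsum.tsum_eq, ENNReal.ofReal_tsum_of_nonneg hm0 hmsum.summable]
      refine ENNReal.tsum_le_tsum fun j => ?_
      split_ifs with hj
      · exact zero_le
      · exact ENNReal.ofReal_le_ofReal (hmrel i j hi hj)
    calc 1 + ∑' j, (if j = J then 0 else ENNReal.ofReal (relSymbol s c r j i))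
        ≤ ENNReal.ofReal 1 + ENNReal.ofReal (1 + J * H + 2) := by
          rw [ENNReal.ofReal_one]
          exact add_le_add_right h2 1
      _ = ENNReal.ofReal (1 + (1 + J * H + 2)) :=
          (ENNReal.ofReal_add zero_le_one (by positivity)).symm
      _ ≤ _ := by
          apply ENNReal.ofReal_le_ofReal
          refine le_trans ?_ h1
          refine le_trans (le_of_eq ?_) hx
          rw [hH]
          ring
  · exact ⟨_, fun i hi => hupper i J hJ hi⟩

/-! ### Newton polygons -/

theorem point_mem_newtonPolygon {c : ℕ →₀ SeriesZ} {r : ℕ} (hr : r ∈ c.support) :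
    ((r : ℝ), ((c r).order.toNat : ℝ) - (r : ℝ)) ∈ newtonPolygon c := by
  refine subset_convexHull ℝ _ ?_
  simp only [Set.mem_iUnion]
  exact ⟨r, hr, le_rfl, le_rfl⟩

theorem toNat_order_le {a : SeriesZ} {l : ℕ} (h : PowerSeries.coeff l a ≠ 0) :
    a.order.toNat ≤ l := by
  by_contra hlt
  exact h (PowerSeries.coeff_of_lt_order_toNat _ (not_le.1 hlt))

theorem le_order_of_isLowerOrdinate {c : ℕ →₀ SeriesZ}
    (ha : IsLowerOrdinate (newtonPolygon c) 0) {r : ℕ} (hr : r ∈ c.support) :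
    r ≤ (c r).order.toNat := by
  have h := ha.2 ⟨_, point_mem_newtonPolygon hr, rfl⟩
  simp only [sub_nonneg] at h
  exact_mod_cast h

theorem coeff_eq_zero_of_isLowerOrdinate {c : ℕ →₀ SeriesZ}
    (ha : IsLowerOrdinate (newtonPolygon c) 0) (r l : ℕ) (hl : l < r) :
    PowerSeries.coeff l (c r) = 0 := by
  by_cases hr : r ∈ c.support
  · exact PowerSeries.coeff_of_lt_order_toNat _ (hl.trans_le (le_order_of_isLowerOrdinate ha hr))
  · simp [Finsupp.notMem_support_iff.1 hr]

/-- Maximality of `p` on the bottom edge: the half-plane `x ≤ p + My`, with `M` bounding the orders,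
contains every corner, because a corner with `r > p` has ordinate at least `1`. Hence it contains
the hull, and `y = 0` forces `x ≤ p`. -/
theorem isBottomVertex {c : ℕ →₀ SeriesZ} (ha : IsLowerOrdinate (newtonPolygon c) 0) {p : ℕ}
    (hp : PowerSeries.coeff p (c p) ≠ 0)
    (hmax : ∀ r, PowerSeries.coeff r (c r) ≠ 0 → r ≤ p) :
    IsBottomVertex (newtonPolygon c) ((p : ℝ), 0) := by
  have hps : p ∈ c.support := by
    rw [Finsupp.mem_support_iff]
    rintro h0
    exact hp (by simp [h0])
  have hord : (c p).order.toNat = p :=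
    le_antisymm (toNat_order_le hp) (le_order_of_isLowerOrdinate ha hps)
  refine ⟨?_, fun w hw => ha.2 ⟨w, hw, rfl⟩, ?_⟩
  · have := point_mem_newtonPolygon hps
    rwa [hord, sub_self] at this
  · obtain ⟨M, hM⟩ := c.support.exists_le
    have hconv : Convex ℝ {w : ℝ × ℝ | w.1 ≤ p + M * w.2} := by
      intro v hv w hw a b ha hb hab
      simp only [Set.mem_ofPred_eq, Prod.fst_add, Prod.smul_fst, Prod.snd_add, Prod.smul_snd,
        smul_eq_mul] at *
      have : (p : ℝ) = a * p + b * p := by rw [← add_mul, hab, one_mul]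
      nlinarith [mul_le_mul_of_nonneg_left hv ha, mul_le_mul_of_nonneg_left hw hb]
    have hsub : newtonPolygon c ⊆ {w : ℝ × ℝ | w.1 ≤ p + M * w.2} := by
      refine convexHull_min ?_ hconv
      simp only [Set.iUnion_subset_iff]
      rintro r hr w ⟨h1, h2⟩
      have hM0 : (0 : ℝ) ≤ M := by positivity
      have hle := le_order_of_isLowerOrdinate ha hr
      simp only [Set.mem_ofPred_eq]
      by_cases hrp : r ≤ p
      · have h3 : (r : ℝ) ≤ p := by exact_mod_cast hrp
        have h4 : (r : ℝ) ≤ (c r).order.toNat := by exact_mod_cast hle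
        nlinarith [mul_nonneg hM0 (show 0 ≤ w.2 by linarith)]
      · have h3 : r < (c r).order.toNat := by
          refine lt_of_le_of_ne hle fun heq => hrp (hmax r ?_)
          have hne : c r ≠ 0 := Finsupp.mem_support_iff.1 hr
          have := PowerSeries.coeff_order hne
          rwa [← heq] at this
        have h4 : (r : ℝ) + 1 ≤ (c r).order.toNat := by exact_mod_cast h3
        have h5 : (r : ℝ) ≤ M := by exact_mod_cast hM r hr
        have hp0 : (0 : ℝ) ≤ p := by positivity
        nlinarith [mul_le_mul_of_nonneg_left (show 1 ≤ w.2 by linarith) hM0]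
    intro w hw h0
    have := hsub hw
    simp only [Set.mem_ofPred_eq] at this h0 ⊢
    rw [h0] at this
    simpa using this

/-- For `r > p` the segment from the vertex `(p,0)` to the point of `c r` has slope at least `1/s`.
-/
theorem le_add_of_firstPositiveSlope {s : ℝ≥0} {c : ℕ →₀ SeriesZ}
    (ha : IsLowerOrdinate (newtonPolygon c) 0)
    (hb : (s : ℝ≥0∞)⁻¹ ≤ firstPositiveSlope (newtonPolygon c)) {p : ℕ}
    (hp : PowerSeries.coeff p (c p) ≠ 0)
    (hmax : ∀ r, PowerSeries.coeff r (c r) ≠ 0 → r ≤ p) (r j : ℕ)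
    (hne : PowerSeries.coeff (j + r) (c r) ≠ 0) : (r : ℝ) ≤ p + j * s := by
  have hs0 : (0 : ℝ) ≤ s := s.2
  rcases le_or_gt r p with hrp | hrp
  · have h1 : (r : ℝ) ≤ p := by exact_mod_cast hrp
    have h2 : (0 : ℝ) ≤ j * s := by positivity
    linarith
  have hrp' : (p : ℝ) < r := by exact_mod_cast hrp
  have hr : r ∈ c.support := by
    rw [Finsupp.mem_support_iff]
    rintro h0
    exact hne (by simp [h0])
  have h1 : firstPositiveSlope (newtonPolygon c) ≤
      ENNReal.ofReal ((((c r).order.toNat : ℝ) - r - 0) / ((r : ℝ) - p)) := by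
    unfold firstPositiveSlope
    refine iInf₂_le_of_le ((p : ℝ), 0) (isBottomVertex ha hp hmax) ?_
    exact iInf₂_le_of_le _ ⟨point_mem_newtonPolygon hr, hrp'⟩ le_rfl
  have h2 := hb.trans h1
  -- For `s = 0` the slope would have to be infinite, which a point to the right of the vertex
  -- excludes.
  have hs : s ≠ 0 := by
    rintro rfl
    simp at h2
  have hs' : (0 : ℝ) < s := by positivity
  rw [← ENNReal.coe_inv hs, ← ENNReal.ofReal_coe_nnreal, ENNReal.ofReal_le_ofReal_iff'] at h2
  have h3 : (s : ℝ)⁻¹ ≤ (((c r).order.toNat : ℝ) - r - 0) / ((r : ℝ) - p) := by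
    rcases h2 with h | h
    · simpa using h
    · rw [NNReal.coe_inv] at h
      exact absurd (inv_pos.2 hs') (not_lt.2 h)
  rw [le_div_iff₀ (by linarith), inv_mul_le_iff₀ hs'] at h3
  have h4 : ((c r).order.toNat : ℝ) ≤ j + r := by exact_mod_cast toNat_order_le hne
  nlinarith

/-- Needed for small `n`: falling factorials may vanish there, so the vertex of `P̃_m(n, ∂_z)` need
not be at `topOrder`. A nonzero diagonal symbol guarantees some vertex. -/
theorem exists_top_coeff {c : ℕ →₀ SeriesZ} {k : ℕ} (h : odeSymbol c 0 k ≠ 0) :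
    ∃ p, PowerSeries.coeff p (c p) ≠ 0 ∧ ∀ r, PowerSeries.coeff r (c r) ≠ 0 → r ≤ p := by
  obtain ⟨r, hr, hne⟩ := Finset.exists_ne_zero_of_sum_ne_zero h
  have hr0 := left_ne_zero_of_mul hne
  rw [zero_add] at hr0
  have hmem : ∀ r, PowerSeries.coeff r (c r) ≠ 0 →
      r ∈ c.support.filter fun r => PowerSeries.coeff r (c r) ≠ 0 := fun r hr => by
    rw [Finset.mem_filter, Finsupp.mem_support_iff]
    exact ⟨fun h0 => hr (by simp [h0]), hr⟩
  obtain ⟨p, hp, hmax⟩ := Finset.exists_max_image _ (fun r : ℕ => r) ⟨r, hmem r hr0⟩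
  exact ⟨p, (Finset.mem_filter.1 hp).2, fun r hr => hmax r (hmem r hr)⟩

/-! ### The triangular structure of `P(∂_t,∂_z) ∂_t^{-m}` -/

theorem coeff_dz_pow (r : ℕ) (u : SeriesTZ) (n : ℕ) :
    PowerSeries.coeff n ((dz ^ r) u) = (PowerSeries.derivative ℂ)^[r] (PowerSeries.coeff n u) := by
  induction r generalizing u with
  | zero => rfl
  | succ r ih =>
    rw [pow_succ, Module.End.mul_apply, ih, Function.iterate_succ_apply]
    simp [dz]

theorem coeff_dt_pow (q : ℕ) (u : SeriesTZ) (l : ℕ) :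
    PowerSeries.coeff l ((dt ^ q) u) =
      (((l + q).factorial : ℂ) / (l.factorial : ℂ)) • PowerSeries.coeff (l + q) u := by
  induction q generalizing u with
  | zero => simp [Nat.factorial_ne_zero]
  | succ q ih =>
    rw [pow_succ, Module.End.mul_apply, ih]
    simp only [dt, LinearMap.coe_mk, AddHom.coe_mk, PowerSeries.coeff_mk, smul_smul]
    congr 1
    rw [← add_assoc, Nat.factorial_succ]
    push_cast
    ring

theorem coeff_dtInv_pow (m : ℕ) (u : SeriesTZ) (n : ℕ) :
    PowerSeries.coeff (n + m) ((dtInv ^ m) u) =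
      ((n.factorial : ℂ) / ((n + m).factorial : ℂ)) • PowerSeries.coeff n u := by
  induction m generalizing u n with
  | zero => simp [Nat.factorial_ne_zero]
  | succ m ih =>
    rw [pow_succ, Module.End.mul_apply, add_comm m 1, ← add_assoc, ih]
    simp only [dtInv, LinearMap.coe_mk, AddHom.coe_mk, PowerSeries.coeff_mk, smul_smul,
      Nat.succ_ne_zero, if_false, Nat.add_sub_cancel]
    congr 1
    have h1 : ((n : ℂ) + 1) ≠ 0 := by exact_mod_cast Nat.succ_ne_zero n
    rw [Nat.factorial_succ]
    push_cast
    field_simp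

theorem coeff_dtInv_pow_of_lt {m n : ℕ} (h : n < m) (u : SeriesTZ) :
    PowerSeries.coeff n ((dtInv ^ m) u) = 0 := by
  induction m generalizing u n with
  | zero => omega
  | succ m ih =>
    rw [pow_succ', Module.End.mul_apply]
    simp only [dtInv, LinearMap.coe_mk, AddHom.coe_mk, PowerSeries.coeff_mk]
    split_ifs with h0
    · rfl
    · have := ih (n := n - 1) (by omega) u
      simp only [dtInv] at this
      rw [this, smul_zero]

theorem iterate_derivative_smul (r : ℕ) (a : ℂ) (u : SeriesZ) :
    (PowerSeries.derivative ℂ)^[r] (a • u) = a • (PowerSeries.derivative ℂ)^[r] u := by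
  induction r generalizing u with
  | zero => rfl
  | succ r ih => rw [Function.iterate_succ_apply, Function.iterate_succ_apply, Derivation.map_smul, ih]

theorem iterate_derivative_zero (r : ℕ) : (PowerSeries.derivative ℂ)^[r] (0 : SeriesZ) = 0 := by
  simp

/-- The coefficient at `∂_z^r u_n` in the coefficient of `t^N` in
`a_{qr} ∂_t^q ∂_z^r ∂_t^{-m} ∑_n u_n t^n`, where `x = (q,r)`. -/
def Operator.kernel (P : Operator) (m : ℕ) (x : ℕ × ℕ) (N n : ℕ) : SeriesZ :=
  if x.1 ≤ n + m ∧ n + m ≤ N + x.1 then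
    ((n.factorial : ℂ) / ((n + m - x.1).factorial : ℂ)) •
      PowerSeries.coeff (N + x.1 - (n + m)) (P x)
  else 0

/-- The hypothesis `ord_t a ≥ q - m` compensates the net loss of `q - m` in the degree, so only `n ≤
N` contribute. -/
theorem coeff_mul_dt_pow {a : SeriesTZ} {q m : ℕ} (ha : ∀ i, i + m < q → PowerSeries.coeff i a = 0)
    (r : ℕ) (u : SeriesTZ) (N : ℕ) :
    PowerSeries.coeff N (a * (dt ^ q) ((dz ^ r) ((dtInv ^ m) u))) =
      ∑ n ∈ Finset.range (N + 1), (if q ≤ n + m ∧ n + m ≤ N + q then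
        ((n.factorial : ℂ) / ((n + m - q).factorial : ℂ)) •
          PowerSeries.coeff (N + q - (n + m)) a else 0) *
        (PowerSeries.derivative ℂ)^[r] (PowerSeries.coeff n u) := by
  have hcoeff : ∀ l, PowerSeries.coeff l ((dt ^ q) ((dz ^ r) ((dtInv ^ m) u))) =
      if m ≤ l + q then (((l + q - m).factorial : ℂ) / (l.factorial : ℂ)) •
        (PowerSeries.derivative ℂ)^[r] (PowerSeries.coeff (l + q - m) u) else 0 := by
    intro l
    rw [coeff_dt_pow, coeff_dz_pow]
    split_ifs with h
    · obtain ⟨n, hn⟩ := Nat.exists_eq_add_of_le' h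
      rw [hn, coeff_dtInv_pow, iterate_derivative_smul, smul_smul, Nat.add_sub_cancel]
      congr 1
      have := Nat.cast_ne_zero (R := ℂ).2 (Nat.factorial_ne_zero (n + m))
      field_simp
    · rw [coeff_dtInv_pow_of_lt (not_le.1 h), iterate_derivative_zero, smul_zero]
  rw [PowerSeries.coeff_mul]
  refine Finset.sum_bij_ne_zero (fun x _ _ => x.2 + q - m) ?_ ?_ ?_ ?_
  -- A nonzero term satisfies the inequalities under which the natural subtractions in the
  -- reindexing `n = x.2 + q - m` are exact.
  all_goals
    have hcond : ∀ x ∈ Finset.HasAntidiagonal.antidiagonal N, PowerSeries.coeff x.1 a *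
        PowerSeries.coeff x.2 ((dt ^ q) ((dz ^ r) ((dtInv ^ m) u))) ≠ 0 →
        x.1 + x.2 = N ∧ m ≤ x.2 + q ∧ q ≤ x.1 + m := by
      intro x hx h0
      refine ⟨Finset.HasAntidiagonal.mem_antidiagonal.1 hx, ?_, ?_⟩
      · by_contra hlt
        exact h0 (by rw [hcoeff, if_neg hlt, mul_zero])
      · by_contra hlt
        exact h0 (by rw [ha _ (not_le.1 hlt), zero_mul])
  · intro x hx h0
    obtain ⟨h1, h2, h3⟩ := hcond x hx h0
    simp only [Finset.mem_range]
    omega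
  · intro x hx hx0 y hy hy0 hxy
    obtain ⟨h1, h2, h3⟩ := hcond x hx hx0
    obtain ⟨h4, h5, h6⟩ := hcond y hy hy0
    ext <;> omega
  · intro n hn h0
    have hn' : n ≤ N := by simpa [Nat.lt_succ_iff] using hn
    have hc : q ≤ n + m ∧ n + m ≤ N + q := by
      by_contra hc
      exact h0 (by rw [if_neg hc, zero_mul])
    refine ⟨(N + q - (n + m), n + m - q), by simp; omega, ?_, by simp; omega⟩
    rw [if_pos hc] at h0
    simp only
    rw [hcoeff, if_pos (by omega), show n + m - q + q - m = n by omega]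
    rwa [smul_mul_assoc, ← mul_smul_comm] at h0
  · intro x hx h0
    obtain ⟨h1, h2, h3⟩ := hcond x hx h0
    rw [hcoeff, if_pos h2, if_pos (by omega), show x.2 + q - m + m - q = x.2 by omega,
      show N + q - (x.2 + q - m + m) = x.1 by omega, smul_mul_assoc, mul_smul_comm]

theorem odeAct_sum_single {ι : Type*} (F : Finset ι) (r : ι → ℕ) (a : ι → SeriesZ) (u : SeriesZ) :
    odeAct (∑ x ∈ F, Finsupp.single (r x) (a x)) u =
      ∑ x ∈ F, a x * (PowerSeries.derivative ℂ)^[r x] u := by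
  have h := Finsupp.sum_finsetSum_index (s := F) (g := fun x => Finsupp.single (r x) (a x))
    (h := fun r a => a * (PowerSeries.derivative ℂ)^[r] u) (by simp) (by simp [add_mul])
  rw [odeAct]
  refine Eq.trans ?_ h.symm |>.trans ?_
  · rfl
  · refine Finset.sum_congr rfl fun x _ => ?_
    rw [Finsupp.sum_single_index (by simp)]

variable {P : Operator} {m : ℕ}

theorem Operator.coeff_eq_zero_of_hasTimeOrder (hm : P.HasTimeOrder m) {x : ℕ × ℕ}
    (hx : x ∈ P.support) {i : ℕ} (hi : i + m < x.1) : PowerSeries.coeff i (P x) = 0 := by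
  have h := hm.2 ⟨x, hx, rfl⟩
  simp only [Operator.timeShift] at h
  exact PowerSeries.coeff_of_lt_order_toNat i (by omega)

theorem Operator.mem_principal {x : ℕ × ℕ} :
    x ∈ P.principal m ↔ x ∈ P.support ∧ x.1 = m + (P x).order.toNat := by
  rw [Operator.principal, Finset.mem_filter, Operator.timeShift]
  refine and_congr_right fun _ => ?_
  omega

theorem Operator.leadCoeff_ne_zero {x : ℕ × ℕ} (hx : x ∈ P.principal m) :
    P.leadCoeff m x ≠ 0 := by
  obtain ⟨h1, h2⟩ := Operator.mem_principal.1 hx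
  have := PowerSeries.coeff_order (Finsupp.mem_support_iff.1 h1)
  rwa [Operator.leadCoeff, show x.1 - m = (P x).order.toNat by omega]

/-- For `n = N` only the coefficient of `t^{q-m}` enters, which vanishes off `Δ_m`. The quotient of
factorials is a falling factorial; both sides are zero when `q - m > N`. -/
theorem Operator.kernel_self (hm : P.HasTimeOrder m) {x : ℕ × ℕ} (hx : x ∈ P.support) (N : ℕ) :
    P.kernel m x N N = if x ∈ P.principal m then
      (N.descFactorial (x.1 - m) : ℂ) • P.leadCoeff m x else 0 := by
  rw [Operator.kernel]
  have hmax := hm.2 ⟨x, hx, rfl⟩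
  simp only [Operator.timeShift] at hmax
  by_cases hp : x.1 = m + (P x).order.toNat
  · rw [if_pos (Operator.mem_principal.2 ⟨hx, hp⟩)]
    by_cases hN : x.1 ≤ N + m
    · rw [if_pos ⟨hN, by omega⟩, Operator.leadCoeff, show N + x.1 - (N + m) = x.1 - m by omega,
        show N + m - x.1 = N - (x.1 - m) by omega]
      congr 1
      rw [div_eq_iff (Nat.cast_ne_zero.2 (Nat.factorial_ne_zero _)), mul_comm]
      exact_mod_cast (Nat.factorial_mul_descFactorial (show x.1 - m ≤ N by omega)).symm
    · rw [if_neg fun h => hN h.1, Nat.descFactorial_eq_zero_iff_lt.2 (by omega)]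
      simp
  · rw [if_neg fun h => hp (Operator.mem_principal.1 h).2]
    split_ifs with h
    · rw [PowerSeries.coeff_of_lt_order_toNat _ (by omega), smul_zero]
    · rfl

/-- The part of the coefficient of `t^N` in `P(∂_t,∂_z) ∂_t^{-m} u` coming from the lower
coefficients of `u`. -/
def Operator.lowerPart (P : Operator) (m N : ℕ) (u : ℕ → SeriesZ) : SeriesZ :=
  ∑ n ∈ Finset.range N, ∑ x ∈ P.support,
    P.kernel m x N n * (PowerSeries.derivative ℂ)^[x.2] (u n)

/-- The triangular structure on which everything rests: the diagonal block at `t^N` is `P̃_m(N,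
∂_z)`. -/
theorem Operator.coeff_actInt (hm : P.HasTimeOrder m) (u : SeriesTZ) (N : ℕ) :
    PowerSeries.coeff N (P.actInt m u) =
      P.lowerPart m N (fun n => PowerSeries.coeff n u) +
        odeAct (P.reduced m N) (PowerSeries.coeff N u) := by
  have h1 : P.actInt m u =
      ∑ x ∈ P.support, P x * (dt ^ x.1) ((dz ^ x.2) ((dtInv ^ m) u)) := by
    simp [Operator.actInt, Operator.act]
  rw [h1, map_sum, Finset.sum_congr rfl fun x hx =>
    coeff_mul_dt_pow (fun i hi => Operator.coeff_eq_zero_of_hasTimeOrder hm hx hi) x.2 u N,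
    Finset.sum_comm, Finset.sum_range_succ]
  congr 1
  rw [Operator.reduced, odeAct_sum_single]
  have h2 : ∀ x ∈ P.support, P.kernel m x N N *
      (PowerSeries.derivative ℂ)^[x.2] (PowerSeries.coeff N u) =
      if x ∈ P.principal m then ((N.descFactorial (x.1 - m) : ℂ) • P.leadCoeff m x) *
        (PowerSeries.derivative ℂ)^[x.2] (PowerSeries.coeff N u) else 0 := by
    intro x hx
    rw [Operator.kernel_self hm hx]
    split_ifs <;> simp
  refine (Finset.sum_congr rfl h2).trans ?_
  rw [← Finset.sum_filter]
  congr 1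
  ext x
  simp only [Finset.mem_filter, Operator.mem_principal]
  tauto

theorem Operator.lowerPart_congr {u v : ℕ → SeriesZ} {N : ℕ} (h : ∀ n < N, u n = v n) :
    P.lowerPart m N u = P.lowerPart m N v :=
  Finset.sum_congr rfl fun n hn => by rw [h n (Finset.mem_range.1 hn)]

/-- Gives injectivity, and also shows that the preimage of `f(z) t^n` starts at `t^n`. -/
theorem Operator.actInt_eq_zero_below (hm : P.HasTimeOrder m)
    (hinj : ∀ N u, odeAct (P.reduced m N) u = 0 → u = 0) {u : SeriesTZ} {N : ℕ}
    (hu : ∀ n < N, PowerSeries.coeff n (P.actInt m u) = 0) :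
    ∀ n < N, PowerSeries.coeff n u = 0 := by
  intro n
  induction n using Nat.strong_induction_on with
  | _ n ih =>
    intro hn
    have h := hu n hn
    rw [Operator.coeff_actInt hm, Operator.lowerPart, Finset.sum_eq_zero, zero_add] at h
    · exact hinj _ _ h
    · intro i hi
      have hi' := Finset.mem_range.1 hi
      refine Finset.sum_eq_zero fun x _ => ?_
      rw [ih i hi' (hi'.trans hn), iterate_derivative_zero, mul_zero]

/-- The subspaces are arbitrary so that the same recursion serves `ℂ[[z]]` (all `V n = ⊤`) and the
spaces `G_s(r(n))`. -/
theorem Operator.exists_actInt_eq (hm : P.HasTimeOrder m) (V : ℕ → Submodule ℂ SeriesZ)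
    (hlower : ∀ N (u : ℕ → SeriesZ), (∀ n < N, u n ∈ V n) → P.lowerPart m N u ∈ V N)
    (hsurj : ∀ N, ∀ f ∈ V N, ∃ u ∈ V N, odeAct (P.reduced m N) u = f)
    (f : SeriesTZ) (hf : ∀ n, PowerSeries.coeff n f ∈ V n) :
    ∃ u : SeriesTZ, (∀ n, PowerSeries.coeff n u ∈ V n) ∧ P.actInt m u = f := by
  choose! inv hinv hinv' using hsurj
  obtain ⟨u, hu⟩ := exists_seq_of_step (A := SeriesZ) fun N v =>
    inv N (PowerSeries.coeff N f - P.lowerPart m N v)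
  have hu' : ∀ N, u N = inv N (PowerSeries.coeff N f - P.lowerPart m N u) := fun N => by
    refine (hu N).trans ?_
    rw [Operator.lowerPart_congr (v := u) fun n hn => if_pos hn]
  have hmem : ∀ N, u N ∈ V N := by
    intro N
    induction N using Nat.strong_induction_on with
    | _ N ih =>
      rw [hu' N]
      exact hinv N _ (Submodule.sub_mem _ (hf N) (hlower N u ih))
  refine ⟨PowerSeries.mk u, fun n => by simpa using hmem n, ?_⟩
  ext N : 1
  rw [Operator.coeff_actInt hm]
  simp only [PowerSeries.coeff_mk]
  conv_lhs => rw [hu' N]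
  rw [hinv' N _ (Submodule.sub_mem _ (hf N) (hlower N u fun n _ => hmem n))]
  abel

theorem Operator.isAutomorphism_actInt (hm : P.HasTimeOrder m)
    (hinj : ∀ N u, odeAct (P.reduced m N) u = 0 → u = 0)
    (hsurj : ∀ N f, ∃ u, odeAct (P.reduced m N) u = f) : IsAutomorphism (P.actInt m) := by
  refine ⟨LinearEquiv.ofBijective (P.actInt m) ⟨?_, ?_⟩, fun u => rfl⟩
  · rw [← LinearMap.ker_eq_bot, LinearMap.ker_eq_bot']
    intro u hu
    ext n : 1
    exact Operator.actInt_eq_zero_below hm hinj (N := n + 1) (fun n _ => by simp [hu]) n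
      (Nat.lt_succ_self n)
  · intro f
    obtain ⟨u, -, hu⟩ := Operator.exists_actInt_eq hm (fun _ => ⊤) (fun _ _ _ => trivial)
      (fun N f _ => (hsurj N f).imp fun u hu => ⟨trivial, hu⟩) f fun _ => trivial
    exact ⟨u, hu⟩

theorem Operator.kernel_mem {s : ℝ≥0} {ρ : ℝ}
    (hcoeff : ∀ x ∈ P.support, ∀ n : ℕ, PowerSeries.coeff n (P x) ∈ gevreyDisc s ρ)
    {x : ℕ × ℕ} (hx : x ∈ P.support) (N n : ℕ) : P.kernel m x N n ∈ gevreyDisc s ρ := by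
  rw [Operator.kernel]
  split_ifs
  · exact Submodule.smul_mem _ _ (hcoeff x hx _)
  · exact Submodule.zero_mem _

/-- Since the radii decrease, `u_n` with `n < N` lies in `G_s(r(N))`, and so does the lower part of
the `N`-th equation. -/
theorem Operator.isAutomorphismOn_actInt {s : ℝ≥0} {ρ : ℝ} {r : ℕ → ℝ} (hr : ∀ n, 0 < r n)
    (hrρ : ∀ n, r n ≤ ρ) (hanti : Antitone r)
    (hcoeff : ∀ x ∈ P.support, ∀ n : ℕ, PowerSeries.coeff n (P x) ∈ gevreyDisc s ρ)
    (hm : P.HasTimeOrder m) (hinj : ∀ N u, odeAct (P.reduced m N) u = 0 → u = 0)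
    (hsurj : ∀ N f, f ∈ gevreyDisc s (r N) →
      ∃ u ∈ gevreyDisc s (r N), odeAct (P.reduced m N) u = f) :
    IsAutomorphismOn (P.actInt m) (gevreyDiscSeries s r) := by
  have hmono : ∀ N, gevreyDisc s ρ ≤ gevreyDisc s (r N) := fun N => gevreyDisc_anti (hr N) (hrρ N)
  have hlower : ∀ N (u : ℕ → SeriesZ), (∀ n < N, u n ∈ gevreyDisc s (r n)) →
      P.lowerPart m N u ∈ gevreyDisc s (r N) := by
    intro N u hu
    refine Submodule.sum_mem _ fun n hn => Submodule.sum_mem _ fun x hx => ?_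
    have hn' := Finset.mem_range.1 hn
    exact mul_mem_gevreyDisc (hr N) (hmono N (Operator.kernel_mem hcoeff hx N n))
      (iterate_derivative_mem_gevreyDisc (hr N) (gevreyDisc_anti (hr N) (hanti hn'.le) (hu n hn')) _)
  have hred : ∀ N i, P.reduced m N i ∈ gevreyDisc s (r N) := by
    intro N i
    rw [Operator.reduced, Finsupp.finsetSum_apply]
    refine Submodule.sum_mem _ fun x hx => ?_
    rw [Finsupp.single_apply]
    split_ifs
    · exact Submodule.smul_mem _ _ (hmono N (hcoeff x (Operator.mem_principal.1 hx).1 _))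
    · exact Submodule.zero_mem _
  have hmaps : ∀ u ∈ gevreyDiscSeries s r, P.actInt m u ∈ gevreyDiscSeries s r := by
    intro u hu N
    rw [Operator.coeff_actInt hm]
    exact Submodule.add_mem _ (hlower N _ fun n _ => hu n) (odeAct_mem (hr N) (hred N) (hu N))
  refine ⟨LinearEquiv.ofBijective ((P.actInt m).restrict hmaps) ⟨?_, ?_⟩, fun u => rfl⟩
  · rw [← LinearMap.ker_eq_bot, LinearMap.ker_eq_bot']
    rintro ⟨u, hu⟩ h
    have h0 : P.actInt m u = 0 := congrArg Subtype.val h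
    ext n : 2
    exact Operator.actInt_eq_zero_below hm hinj (N := n + 1) (fun n _ => by simp [h0]) n
      (Nat.lt_succ_self n)
  · rintro ⟨f, hf⟩
    obtain ⟨u, hu, huf⟩ := Operator.exists_actInt_eq hm (fun n => gevreyDisc s (r n)) hlower
      (fun N f hf => hsurj N f hf) f hf
    exact ⟨⟨u, hu⟩, Subtype.ext huf⟩

/-- An automorphism provides solutions of the diagonal equations with monomial right-hand side. -/
theorem Operator.exists_mem_of_isAutomorphismOn {s : ℝ≥0} {r : ℕ → ℝ} (hr : ∀ n, 0 < r n)
    (hm : P.HasTimeOrder m) (hinj : ∀ N u, odeAct (P.reduced m N) u = 0 → u = 0)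
    (h : IsAutomorphismOn (P.actInt m) (gevreyDiscSeries s r)) (n K : ℕ) :
    ∃ u ∈ gevreyDisc s (r n), odeAct (P.reduced m n) u = PowerSeries.X ^ K := by
  obtain ⟨e, he⟩ := h
  let f : SeriesTZ := PowerSeries.monomial n (PowerSeries.X ^ K)
  have hcoeff : ∀ N, PowerSeries.coeff N f = if N = n then PowerSeries.X ^ K else 0 := fun N =>
    PowerSeries.coeff_monomial _ _ _
  have hf : f ∈ gevreyDiscSeries s r := fun N => by
    rw [hcoeff]
    split_ifs
    · exact X_pow_mem_gevreyDisc s (hr N) K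
    · exact Submodule.zero_mem _
  obtain ⟨⟨u, hu⟩, hue⟩ := e.surjective ⟨f, hf⟩
  have huf : P.actInt m u = f := by
    rw [← he ⟨u, hu⟩, hue]
  have hlow := Operator.actInt_eq_zero_below hm hinj (u := u) (N := n) fun k hk => by
    rw [huf, hcoeff, if_neg hk.ne]
  refine ⟨PowerSeries.coeff n u, hu n, ?_⟩
  have h1 := Operator.coeff_actInt hm u n
  rw [huf, hcoeff, if_pos rfl, Operator.lowerPart, Finset.sum_eq_zero, zero_add] at h1
  · exact h1.symm
  · intro i hi
    refine Finset.sum_eq_zero fun x _ => ?_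
    rw [hlow i (Finset.mem_range.1 hi), iterate_derivative_zero, mul_zero]

/-! ### The diagonal operators for large `n` -/

/-- The hypotheses on the operator `P(∂_t,∂_z)`. -/
structure Operator.Admissible (P : Operator) (m : ℕ) (s : ℝ≥0) (ρ : ℝ) : Prop where
  radius_pos : 0 < ρ
  coeff_mem : ∀ x ∈ P.support, ∀ n : ℕ, PowerSeries.coeff n (P x) ∈ gevreyDisc s ρ
  timeOrder : P.HasTimeOrder m
  lowerOrdinate : ∀ n : ℕ, IsLowerOrdinate (newtonPolygon (P.reduced m n)) 0
  slope : ∀ n : ℕ, (s : ℝ≥0∞)⁻¹ ≤ firstPositiveSlope (newtonPolygon (P.reduced m n))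
  resonance : ∃ C₀ : ℝ, 0 < C₀ ∧ ∀ n k : ℕ, C₀ ≤ ‖P.resonance m n k‖

namespace Operator

variable {s : ℝ≥0} {ρ : ℝ}

theorem coeff_reduced (n r l : ℕ) : PowerSeries.coeff l (P.reduced m n r) =
    ∑ x ∈ P.principal m with x.2 = r,
      PowerSeries.coeff l (P.leadCoeff m x) * (n.descFactorial (x.1 - m) : ℂ) := by
  rw [reduced, Finsupp.finsetSum_apply, map_sum, Finset.sum_filter]
  refine Finset.sum_congr rfl fun x _ => ?_
  rw [Finsupp.single_apply]
  split_ifs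
  · rw [PowerSeries.coeff_smul, smul_eq_mul, mul_comm]
  · simp

theorem exists_of_coeff_reduced_ne_zero {n r l : ℕ}
    (h : PowerSeries.coeff l (P.reduced m n r) ≠ 0) :
    ∃ x ∈ P.principal m, x.2 = r ∧ PowerSeries.coeff l (P.leadCoeff m x) ≠ 0 := by
  rw [coeff_reduced] at h
  obtain ⟨x, hx, hne⟩ := Finset.exists_ne_zero_of_sum_ne_zero h
  exact ⟨x, (Finset.mem_filter.1 hx).1, (Finset.mem_filter.1 hx).2, left_ne_zero_of_mul hne⟩

theorem norm_coeff_reduced_le (n r l : ℕ) {B : ℝ} (hB : 0 ≤ B)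
    (h : ∀ x ∈ P.principal m, x.2 = r →
      ‖PowerSeries.coeff l (P.leadCoeff m x)‖ * (1 + (n : ℝ)) ^ (x.1 - m) ≤ B) :
    ‖PowerSeries.coeff l (P.reduced m n r)‖ ≤ (P.principal m).card * B := by
  rw [coeff_reduced]
  refine (norm_sum_le _ _).trans ((Finset.sum_le_card_nsmul _ _ B fun x hx => ?_).trans ?_)
  · have hx' := Finset.mem_filter.1 hx
    exact (norm_coeff_mul_descFactorial_le _ _ _).trans (h x hx'.1 hx'.2)
  · rw [nsmul_eq_mul]
    gcongr
    exact Finset.filter_subset _ _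

theorem principal_ext {x y : ℕ × ℕ} (hx : x ∈ P.principal m) (hy : y ∈ P.principal m)
    (h1 : x.1 - m = y.1 - m) (h2 : x.2 = y.2) : x = y := by
  have := (mem_principal.1 hx).2
  have := (mem_principal.1 hy).2
  exact Prod.ext (by omega) h2

/-- Elements of `Δ_m` with the same `r` have different `q`, so a single pair supplies the leading
term in `n` and no cancellation occurs. -/
theorem tendsto_coeff_reduced {x : ℕ × ℕ} (hx : x ∈ P.principal m) (l : ℕ)
    (hmax : ∀ y ∈ P.principal m, y.2 = x.2 → PowerSeries.coeff l (P.leadCoeff m y) ≠ 0 →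
      y.1 - m ≤ x.1 - m) :
    Filter.Tendsto (fun n : ℕ => PowerSeries.coeff l (P.reduced m n x.2) /
      ((1 + (n : ℝ) : ℝ) : ℂ) ^ (x.1 - m)) Filter.atTop
      (nhds (PowerSeries.coeff l (P.leadCoeff m x))) := by
  have h := tendsto_sum_descFactorial_div ((P.principal m).filter fun y => y.2 = x.2)
    (fun y => PowerSeries.coeff l (P.leadCoeff m y)) (fun y => y.1 - m) (x.1 - m) (fun y hy hne =>
      hmax y (Finset.mem_filter.1 hy).1 (Finset.mem_filter.1 hy).2 hne)
  have e : ((P.principal m).filter fun y => y.2 = x.2).filter (fun y => y.1 - m = x.1 - m) =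
      {x} := by
    ext y
    simp only [Finset.mem_filter, Finset.mem_singleton]
    constructor
    · rintro ⟨⟨h1, h2⟩, h3⟩
      exact principal_ext h1 hx h3 h2
    · rintro rfl
      exact ⟨⟨hx, rfl⟩, rfl⟩
  rw [e, Finset.sum_singleton] at h
  simpa only [coeff_reduced] using h

/-- Transfers conditions (a) and (b), which concern the summed operators, to individual pairs in
`Δ_m`: for large `n` no coefficient is lost. -/
theorem eventually_coeff_reduced_ne_zero {x : ℕ × ℕ} (hx : x ∈ P.principal m) {l : ℕ}
    (hne : PowerSeries.coeff l (P.leadCoeff m x) ≠ 0) :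
    ∀ᶠ n : ℕ in Filter.atTop, PowerSeries.coeff l (P.reduced m n x.2) ≠ 0 := by
  obtain ⟨y, hy, hmax⟩ := Finset.exists_max_image ((P.principal m).filter fun y =>
    y.2 = x.2 ∧ PowerSeries.coeff l (P.leadCoeff m y) ≠ 0) (fun y => y.1 - m)
    ⟨x, by simp [hx, hne]⟩
  obtain ⟨hy1, hy2, hy3⟩ := Finset.mem_filter.1 hy
  have h := tendsto_coeff_reduced hy1 l (fun z hz hz2 hz3 =>
    hmax z (Finset.mem_filter.2 ⟨hz, hz2.trans hy2, hz3⟩))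
  filter_upwards [eventually_norm_bounds hy3 h] with n hn h0
  rw [hy2, h0, norm_zero, mul_zero] at hn
  have h1 := norm_pos_iff.2 hy3
  have : 0 < ‖PowerSeries.coeff l (P.leadCoeff m y)‖ * (1 + (n : ℝ)) ^ (y.1 - m) := by positivity
  linarith [hn.1]

theorem mem_principalAt {x : ℕ × ℕ} {j : ℕ} :
    x ∈ P.principalAt m j ↔ x ∈ P.principal m ∧ P.ordZ m x = x.2 + j := by
  rw [principalAt, Finset.mem_filter]
  refine and_congr_right fun _ => ?_
  omega

theorem coeff_ordZ_ne_zero {x : ℕ × ℕ} (hx : x ∈ P.principal m) :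
    PowerSeries.coeff (P.ordZ m x) (P.leadCoeff m x) ≠ 0 :=
  PowerSeries.coeff_order (leadCoeff_ne_zero hx)

theorem Admissible.le_ordZ (h : P.Admissible m s ρ) {x : ℕ × ℕ} (hx : x ∈ P.principal m) :
    x.2 ≤ P.ordZ m x := by
  obtain ⟨n, hn⟩ := (eventually_coeff_reduced_ne_zero hx (coeff_ordZ_ne_zero hx)).exists
  by_contra hlt
  exact hn (coeff_eq_zero_of_isLowerOrdinate (h.lowerOrdinate n) _ _ (not_le.1 hlt))

theorem Admissible.mem_principalAt_zero (h : P.Admissible m s ρ) {x : ℕ × ℕ}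
    (hx : x ∈ P.principal m) :
    x ∈ P.principalAt m 0 ↔ PowerSeries.coeff x.2 (P.leadCoeff m x) ≠ 0 := by
  rw [mem_principalAt, add_zero]
  constructor
  · rintro ⟨-, h1⟩
    rw [← h1]
    exact coeff_ordZ_ne_zero hx
  · exact fun h1 => ⟨hx, le_antisymm (toNat_order_le h1) (h.le_ordZ hx)⟩

/-- A pair in `Δ_m` outside `Δ_{m,0}` has `α_{qr} > r`, hence no coefficient at `z^r`. -/
theorem Admissible.odeSymbol_zero (h : P.Admissible m s ρ) (n k : ℕ) :
    odeSymbol (P.reduced m n) 0 k = P.resonance m n k := by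
  have h1 := Finsupp.sum_finsetSum_index (s := P.principal m)
    (g := fun x => Finsupp.single x.2 ((n.descFactorial (x.1 - m) : ℂ) • P.leadCoeff m x))
    (h := fun r a => PowerSeries.coeff (0 + r) a * (k.descFactorial r : ℂ))
    (by simp) (by simp [add_mul])
  have h2 : odeSymbol (P.reduced m n) 0 k = ∑ x ∈ P.principal m,
      PowerSeries.coeff x.2 (P.leadCoeff m x) * (n.descFactorial (x.1 - m) : ℂ) *
        (k.descFactorial x.2 : ℂ) := by
    refine Eq.trans ?_ h1.symm |>.trans ?_
    · rfl
    · refine Finset.sum_congr rfl fun x _ => ?_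
      rw [Finsupp.sum_single_index (by simp), zero_add, PowerSeries.coeff_smul, smul_eq_mul]
      ring
  have h3 : P.principalAt m 0 ⊆ P.principal m := Finset.filter_subset _ _
  rw [h2, Operator.resonance, ← Finset.sum_subset h3]
  · refine Finset.sum_congr rfl fun x hx => ?_
    rw [(mem_principalAt.1 hx).2, add_zero]
  · intro x hx hx0
    rw [h.mem_principalAt_zero hx, not_not] at hx0
    rw [hx0, zero_mul, zero_mul]

theorem Admissible.odeSymbol_ne_zero (h : P.Admissible m s ρ) (n k : ℕ) :
    odeSymbol (P.reduced m n) 0 k ≠ 0 := by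
  obtain ⟨C₀, hC₀, hW⟩ := h.resonance
  rw [h.odeSymbol_zero]
  exact norm_pos_iff.1 (hC₀.trans_le (hW n k))

theorem Admissible.coeff_reduced_eq_zero (h : P.Admissible m s ρ) (n r l : ℕ) (hl : l < r) :
    PowerSeries.coeff l (P.reduced m n r) = 0 :=
  coeff_eq_zero_of_isLowerOrdinate (h.lowerOrdinate n) r l hl

/-- The vertex `(q,p)` of highest degree in `n`. -/
theorem Admissible.exists_vertex (h : P.Admissible m s ρ) : ∃ x ∈ P.principalAt m 0,
    x.2 = P.topOrder m ∧ x.1 - m = P.degW m (P.topOrder m) 0 := by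
  have hne : (P.principalAt m 0).Nonempty := by
    rw [Finset.nonempty_iff_ne_empty]
    intro h0
    have h1 := h.odeSymbol_ne_zero 0 0
    rw [h.odeSymbol_zero, Operator.resonance, h0] at h1
    simp at h1
  obtain ⟨y, hy, hy2⟩ := Finset.exists_mem_eq_sup _ hne Prod.snd
  obtain ⟨x, hx, hx2⟩ := Finset.exists_mem_eq_sup
    ((P.principalAt m 0).filter fun x => x.2 = P.topOrder m)
    ⟨y, Finset.mem_filter.2 ⟨hy, hy2.symm⟩⟩ (fun x => x.1 - m)
  exact ⟨x, (Finset.mem_filter.1 hx).1, (Finset.mem_filter.1 hx).2, hx2.symm⟩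

theorem sub_le_degW {x : ℕ × ℕ} {j : ℕ} (hx : x ∈ P.principalAt m j) :
    x.1 - m ≤ P.degW m x.2 j :=
  Finset.le_sup (f := fun x : ℕ × ℕ => x.1 - m) (Finset.mem_filter.2 ⟨hx, rfl⟩)

theorem Admissible.le_topOrder (h : P.Admissible m s ρ) {x : ℕ × ℕ} (hx : x ∈ P.principal m)
    (hne : PowerSeries.coeff x.2 (P.leadCoeff m x) ≠ 0) : x.2 ≤ P.topOrder m :=
  Finset.le_sup (f := Prod.snd) ((h.mem_principalAt_zero hx).2 hne)

theorem Admissible.le_topOrder_of_reduced (h : P.Admissible m s ρ) {n r : ℕ}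
    (hne : PowerSeries.coeff r (P.reduced m n r) ≠ 0) : r ≤ P.topOrder m := by
  obtain ⟨x, hx, rfl, hx2⟩ := exists_of_coeff_reduced_ne_zero hne
  exact h.le_topOrder hx hx2

theorem Admissible.tendsto_top (h : P.Admissible m s ρ) : ∃ L : ℂ, L ≠ 0 ∧
    Filter.Tendsto (fun n : ℕ => PowerSeries.coeff (P.topOrder m) (P.reduced m n (P.topOrder m)) /
      ((1 + (n : ℝ) : ℝ) : ℂ) ^ (P.degW m (P.topOrder m) 0)) Filter.atTop (nhds L) := by
  obtain ⟨x, hx, hx2, hx3⟩ := h.exists_vertex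
  have hxp := (mem_principalAt.1 hx).1
  have h1 := tendsto_coeff_reduced hxp x.2 (fun y hy hyx hne => by
    rw [← hyx] at hne
    have h4 := sub_le_degW ((h.mem_principalAt_zero hy).2 hne)
    rwa [hyx, hx2, ← hx3] at h4)
  rw [hx3, hx2] at h1
  refine ⟨_, ?_, h1⟩
  rw [← hx2]
  exact (h.mem_principalAt_zero hxp).1 hx

theorem Admissible.eventually_top_ne_zero (h : P.Admissible m s ρ) : ∀ᶠ n : ℕ in Filter.atTop,
    PowerSeries.coeff (P.topOrder m) (P.reduced m n (P.topOrder m)) ≠ 0 := by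
  obtain ⟨x, hx, hx2, -⟩ := h.exists_vertex
  have hxp := (mem_principalAt.1 hx).1
  have := eventually_coeff_reduced_ne_zero hxp ((h.mem_principalAt_zero hxp).1 hx)
  rwa [hx2] at this

theorem Admissible.snd_le (h : P.Admissible m s ρ) {x : ℕ × ℕ} (hx : x ∈ P.principal m) {j : ℕ}
    (hne : PowerSeries.coeff (j + x.2) (P.leadCoeff m x) ≠ 0) :
    (x.2 : ℝ) ≤ P.topOrder m + j * s := by
  obtain ⟨n, h1, h2⟩ :=
    (h.eventually_top_ne_zero.and (eventually_coeff_reduced_ne_zero hx hne)).exists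
  exact le_add_of_firstPositiveSlope (h.lowerOrdinate n) (h.slope n) h1
    (fun r hr => h.le_topOrder_of_reduced hr) _ _ h2

theorem Admissible.exists_coeff_bound (h : P.Admissible m s ρ) : ∃ A ≥ (0 : ℝ), ∃ C ≥ (0 : ℝ),
    ∀ x ∈ P.principal m, ∀ j : ℕ,
      ‖PowerSeries.coeff (j + x.2) (P.leadCoeff m x)‖ ≤ A * C ^ j * Real.Gamma (1 + s * j) := by
  have hex : ∀ x ∈ P.principal m, ∃ A C : ℝ, 0 ≤ A ∧ 0 ≤ C ∧ ∀ j : ℕ,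
      ‖PowerSeries.coeff (j + x.2) (P.leadCoeff m x)‖ ≤ A * C ^ j * Real.Gamma (1 + s * j) := by
    intro x hx
    -- Differentiating `r` times shifts the index `j + r` to `j` and multiplies by an integer at
    -- least `1`, so a bound for the derivative gives the shifted bound.
    obtain ⟨⟨A, hA, C, hC, hb⟩, -⟩ := iterate_derivative_mem_gevreyDisc h.radius_pos
      (h.coeff_mem x (mem_principal.1 hx).1 (x.1 - m)) x.2
    refine ⟨A, C, hA.le, hC.le, fun j => le_trans ?_ (hb j)⟩
    rw [PowerSeries.coeff_iterate_derivative, norm_mul, Complex.norm_natCast]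
    refine le_mul_of_one_le_left (norm_nonneg _) ?_
    exact_mod_cast Nat.succ_le_of_lt (Nat.ascFactorial_pos _ _)
  choose! A C hA hC hb using hex
  refine ⟨∑ x ∈ P.principal m, A x, Finset.sum_nonneg hA, ∑ x ∈ P.principal m, C x,
    Finset.sum_nonneg hC, fun x hx j => (hb x hx j).trans ?_⟩
  have h1 := Finset.single_le_sum hA hx
  have h2 := Finset.single_le_sum hC hx
  have h3 := hA x hx
  have h4 := hC x hx
  have h5 := gamma_pos s j
  have h6 := Finset.sum_nonneg hA
  gcongr

/-- Only the factor `A` depends on `n`. The uniformity of `C` is what makes the radii from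
`exists_radius` comparable for different `n`. -/
theorem Admissible.odeBounds (h : P.Admissible m s ρ) {A C : ℝ} (hA : 0 ≤ A) (hC : 0 ≤ C)
    (hAC : ∀ x ∈ P.principal m, ∀ j : ℕ,
      ‖PowerSeries.coeff (j + x.2) (P.leadCoeff m x)‖ ≤ A * C ^ j * Real.Gamma (1 + s * j))
    {n p : ℕ} (hp : PowerSeries.coeff p (P.reduced m n p) ≠ 0)
    (hmax : ∀ r, PowerSeries.coeff r (P.reduced m n r) ≠ 0 → r ≤ p) :
    OdeBounds s (P.reduced m n) p ((P.principal m).sup Prod.snd)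
      ((P.principal m).card * (A * (1 + (n : ℝ)) ^ ((P.principal m).sup fun x => x.1 - m))) C where
  slope := le_add_of_firstPositiveSlope (h.lowerOrdinate n) (h.slope n) hp hmax
  bound := by
    intro r j
    have gj := gamma_pos s j
    refine (norm_coeff_reduced_le n r (j + r) (B := A * (1 + (n : ℝ)) ^
      ((P.principal m).sup fun x => x.1 - m) * C ^ j * Real.Gamma (1 + s * j)) (by positivity)
      ?_).trans (le_of_eq (by ring))
    rintro x hx rfl
    have h1 : (1 + (n : ℝ)) ^ (x.1 - m) ≤
        (1 + (n : ℝ)) ^ ((P.principal m).sup fun x => x.1 - m) :=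
      pow_le_pow_right₀ (by linarith [show (0 : ℝ) ≤ n by positivity])
        (Finset.le_sup (f := fun x : ℕ × ℕ => x.1 - m) hx)
    calc _ ≤ (A * C ^ j * Real.Gamma (1 + s * j)) *
          (1 + (n : ℝ)) ^ ((P.principal m).sup fun x => x.1 - m) := by gcongr; exact hAC x hx j
      _ = _ := by ring
  top := hp
  order_le := by
    intro r hr
    rw [Finsupp.mem_support_iff] at hr
    obtain ⟨l, hl⟩ : ∃ l, PowerSeries.coeff l (P.reduced m n r) ≠ 0 := by
      by_contra! h0
      exact hr (by ext l; simpa using h0 l)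
    obtain ⟨x, hx, rfl, -⟩ := exists_of_coeff_reduced_ne_zero hl
    exact Finset.le_sup (f := Prod.snd) hx

/-! ### The exponent `α` -/

theorem degW_le (i j : ℕ) : P.degW m i j ≤ (P.principal m).sup fun x => x.1 - m :=
  Finset.sup_mono fun _ hx => (mem_principalAt.1 (Finset.mem_filter.1 hx).1).1

theorem bddAbove_exponent_set : BddAbove (insert 0 {x : ℝ | ∃ i j : ℕ, 1 ≤ j ∧ (i : ℝ) = j * s ∧
    x = ((P.degW m (P.topOrder m + i) j : ℝ) - (P.degW m (P.topOrder m) 0 : ℝ)) / j}) := by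
  refine ⟨((P.principal m).sup fun x => x.1 - m : ℕ), ?_⟩
  rintro _ (rfl | ⟨i, j, hj, -, rfl⟩)
  · positivity
  · have hj' : (1 : ℝ) ≤ j := by exact_mod_cast hj
    have h1 : (P.degW m (P.topOrder m + i) j : ℝ) ≤ ((P.principal m).sup fun x => x.1 - m : ℕ) := by
      exact_mod_cast degW_le _ _
    rw [div_le_iff₀ (by linarith)]
    have h2 : (0 : ℝ) ≤ P.degW m (P.topOrder m) 0 := by positivity
    have h3 : (0 : ℝ) ≤ ((P.principal m).sup fun x => x.1 - m : ℕ) := by positivity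
    nlinarith

theorem exponent_nonneg : 0 ≤ P.exponent m s :=
  le_csSup bddAbove_exponent_set (Set.mem_insert _ _)

theorem degW_le_exponent {i j : ℕ} (hj : 1 ≤ j) (hi : (i : ℝ) = j * s) :
    (P.degW m (P.topOrder m + i) j : ℝ) ≤ P.degW m (P.topOrder m) 0 + j * P.exponent m s := by
  have h := le_csSup (bddAbove_exponent_set (P := P) (m := m) (s := s))
    (Set.mem_insert_of_mem 0 ⟨i, j, hj, hi, rfl⟩)
  have hj' : (0 : ℝ) < j := by exact_mod_cast hj
  rw [div_le_iff₀ hj'] at h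
  have : P.exponent m s * j = j * P.exponent m s := mul_comm _ _
  rw [exponent] at *
  linarith

theorem exists_of_degW_pos {i j : ℕ} (h : 0 < P.degW m i j) :
    ∃ x ∈ P.principalAt m j, x.2 = i ∧ x.1 - m = P.degW m i j := by
  have hne : ((P.principalAt m j).filter fun x => x.2 = i).Nonempty := by
    rw [Finset.nonempty_iff_ne_empty]
    intro h0
    rw [degW, h0] at h
    simp at h
  obtain ⟨x, hx, hx2⟩ := Finset.exists_mem_eq_sup _ hne (fun x => x.1 - m)
  exact ⟨x, (Finset.mem_filter.1 hx).1, (Finset.mem_filter.1 hx).2, hx2.symm⟩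

/-- A positive quotient requires a positive degree, hence a pair in `Δ_m`; there are finitely many,
so a positive supremum is a maximum. -/
theorem exists_exponent_attained (hα : 0 < P.exponent m s) :
    ∃ i j : ℕ, 1 ≤ j ∧ (i : ℝ) = j * s ∧
      (P.degW m (P.topOrder m + i) j : ℝ) = P.degW m (P.topOrder m) 0 + j * P.exponent m s := by
  set S : Set ℝ := insert 0 {x : ℝ | ∃ i j : ℕ, 1 ≤ j ∧ (i : ℝ) = j * s ∧
    x = ((P.degW m (P.topOrder m + i) j : ℝ) - (P.degW m (P.topOrder m) 0 : ℝ)) / j} with hS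
  have hpos : ∀ x ∈ S, 0 < x → x ∈ (P.principal m).image fun y : ℕ × ℕ =>
      ((P.degW m y.2 (P.ordZ m y - y.2) : ℝ) - (P.degW m (P.topOrder m) 0 : ℝ)) /
        (P.ordZ m y - y.2 : ℕ) := by
    rintro x (rfl | ⟨i, j, hj, hi, rfl⟩) hx
    · exact absurd hx (lt_irrefl _)
    have hj' : (0 : ℝ) < j := by exact_mod_cast hj
    have h1 := (div_pos_iff_of_pos_right hj').1 hx
    have h2 : 0 < P.degW m (P.topOrder m + i) j := by
      have : (0 : ℝ) ≤ P.degW m (P.topOrder m) 0 := by positivity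
      have : (0 : ℝ) < P.degW m (P.topOrder m + i) j := by linarith
      exact_mod_cast this
    obtain ⟨y, hy, hy2, -⟩ := exists_of_degW_pos h2
    obtain ⟨hy3, hy4⟩ := mem_principalAt.1 hy
    refine Finset.mem_image.2 ⟨y, hy3, ?_⟩
    rw [show P.ordZ m y - y.2 = j by omega, hy2]
  have hmem : P.exponent m s ∈ S := by
    have hlt : ∃ x ∈ S, 0 < x := exists_lt_of_lt_csSup ⟨0, Set.mem_insert _ _⟩ hα
    have hfin : (S ∩ Set.Ioi 0).Finite :=
      (Finset.finite_toSet _).subset fun x hx => hpos x hx.1 hx.2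
    obtain ⟨x, hx, hx0⟩ := hlt
    have hne : (S ∩ Set.Ioi 0).Nonempty := ⟨x, hx, hx0⟩
    have h1 := hne.csSup_mem hfin
    have h2 : sSup (S ∩ Set.Ioi 0) = P.exponent m s := by
      refine le_antisymm (csSup_le_csSup bddAbove_exponent_set hne Set.inter_subset_left) ?_
      refine csSup_le ⟨0, Set.mem_insert _ _⟩ fun y hy => ?_
      rcases le_or_gt y 0 with hy0 | hy0
      · exact hy0.trans (le_of_lt h1.2)
      · exact le_csSup hfin.bddAbove ⟨hy, hy0⟩
    rw [← h2]
    exact h1.1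
  rcases hmem with h0 | ⟨i, j, hj, hi, h⟩
  · exact absurd h0 hα.ne'
  · have hj' : (0 : ℝ) < j := by exact_mod_cast hj
    refine ⟨i, j, hj, hi, ?_⟩
    rw [h]
    field_simp
    ring

/-- The largest `j` at which the exponent is attained. -/
theorem exists_last_attained (hα : 0 < P.exponent m s) :
    ∃ l J : ℕ, 1 ≤ J ∧ (l : ℝ) = J * s ∧
      (P.degW m (P.topOrder m + l) J : ℝ) = P.degW m (P.topOrder m) 0 + J * P.exponent m s ∧
      ∀ i j : ℕ, J < j → (i : ℝ) = j * s →
        (P.degW m (P.topOrder m + i) j : ℝ) < P.degW m (P.topOrder m) 0 + j * P.exponent m s := by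
  let p : ℕ → Prop := fun j => 1 ≤ j ∧ ∃ i : ℕ, (i : ℝ) = j * s ∧
    (P.degW m (P.topOrder m + i) j : ℝ) = P.degW m (P.topOrder m) 0 + j * P.exponent m s
  have hne : {j | p j}.Nonempty := by
    obtain ⟨i, j, hj, hi, h⟩ := exists_exponent_attained hα
    exact ⟨j, hj, i, hi, h⟩
  have hbdd : BddAbove {j | p j} := by
    obtain ⟨B, hB⟩ := exists_nat_ge
      ((((P.principal m).sup fun x => x.1 - m : ℕ) : ℝ) / P.exponent m s)
    refine ⟨B, ?_⟩
    rintro j ⟨hj, i, hi, h⟩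
    have h1 : (P.degW m (P.topOrder m + i) j : ℝ) ≤ ((P.principal m).sup fun x => x.1 - m : ℕ) := by
      exact_mod_cast degW_le _ _
    have h2 : (0 : ℝ) ≤ P.degW m (P.topOrder m) 0 := by positivity
    have h3 : (j : ℝ) ≤ B := by
      refine le_trans ?_ hB
      rw [le_div_iff₀ hα]
      linarith
    exact_mod_cast h3
  obtain ⟨hJ, l, hl, hJl⟩ := Nat.sSup_mem hne hbdd
  refine ⟨l, sSup {j | p j}, hJ, hl, hJl, fun i j hj hi => ?_⟩
  refine lt_of_le_of_ne (degW_le_exponent (by omega) hi) fun heq => ?_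
  exact absurd (le_csSup hbdd (show j ∈ {j | p j} from ⟨by omega, i, hi, heq⟩)) (not_le.2 hj)

/-- The degrees in `n` of the coefficients on the edge `r = p + js`. -/
theorem Admissible.edge_cases (h : P.Admissible m s ρ) {x : ℕ × ℕ} (hx : x ∈ P.principal m) {j : ℕ}
    (hr : (x.2 : ℝ) = P.topOrder m + j * s)
    (hne : PowerSeries.coeff (j + x.2) (P.leadCoeff m x) ≠ 0) :
    (j : ℝ) * s = 0 ∧ x.1 - m ≤ P.degW m (P.topOrder m) 0 ∨
      ∃ i j₀ : ℕ, 1 ≤ j₀ ∧ j₀ ≤ j ∧ (i : ℝ) = j₀ * s ∧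
        x.1 - m ≤ P.degW m (P.topOrder m + i) j₀ := by
  have hs0 : (0 : ℝ) ≤ s := s.2
  have h1 := toNat_order_le hne
  have h2 := h.le_ordZ hx
  obtain ⟨j₀, hj₀⟩ := Nat.exists_eq_add_of_le h2
  have hj : j₀ ≤ j := by
    have : P.ordZ m x ≤ j + x.2 := h1
    omega
  have h3 := h.snd_le hx (j := j₀) (by
    rw [add_comm, ← hj₀]
    exact coeff_ordZ_ne_zero hx)
  have hmem : x ∈ P.principalAt m j₀ := mem_principalAt.2 ⟨hx, hj₀⟩
  have h4 := sub_le_degW hmem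
  have hjle : (j₀ : ℝ) * s ≤ j * s := by gcongr
  -- The lowest coefficient, at `j₀ ≤ j`, obeys the slope bound as well. For `s > 0` this forces `j
  -- = j₀`; for `s = 0` the higher coefficients lie on the edge too.
  have hjs : (j : ℝ) * s = j₀ * s := by linarith
  rcases Nat.eq_zero_or_pos j₀ with rfl | hpos
  · left
    simp only [Nat.cast_zero, zero_mul] at hjs
    refine ⟨hjs, ?_⟩
    have : x.2 = P.topOrder m := by
      rw [hjs, add_zero] at hr
      exact_mod_cast hr
    rwa [this] at h4
  · right
    have h5 : P.topOrder m ≤ x.2 := by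
      have : (P.topOrder m : ℝ) ≤ x.2 := by
        rw [hr]
        linarith [show (0 : ℝ) ≤ j * s by positivity]
      exact_mod_cast this
    obtain ⟨i, hi⟩ := Nat.exists_eq_add_of_le h5
    refine ⟨i, j₀, hpos, hj, ?_, hi ▸ h4⟩
    rw [hi] at hr
    push_cast at hr
    linarith

theorem Admissible.degree_le (h : P.Admissible m s ρ) {x : ℕ × ℕ} (hx : x ∈ P.principal m) {j : ℕ}
    (hr : (x.2 : ℝ) = P.topOrder m + j * s)
    (hne : PowerSeries.coeff (j + x.2) (P.leadCoeff m x) ≠ 0) :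
    ((x.1 - m : ℕ) : ℝ) ≤ P.degW m (P.topOrder m) 0 + j * P.exponent m s := by
  have hα := exponent_nonneg (P := P) (m := m) (s := s)
  rcases h.edge_cases hx hr hne with ⟨-, h1⟩ | ⟨i, j₀, hj₀, hj, hi, h1⟩
  · have h2 : ((x.1 - m : ℕ) : ℝ) ≤ P.degW m (P.topOrder m) 0 := by exact_mod_cast h1
    linarith [show 0 ≤ j * P.exponent m s by positivity]
  · have h2 : ((x.1 - m : ℕ) : ℝ) ≤ P.degW m (P.topOrder m + i) j₀ := by exact_mod_cast h1
    have h3 : (j₀ : ℝ) * P.exponent m s ≤ j * P.exponent m s := by gcongr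
    linarith [degW_le_exponent (P := P) (m := m) hj₀ hi]

theorem Admissible.degree_lt (h : P.Admissible m s ρ) (hα : 0 < P.exponent m s) {J : ℕ}
    (hJ : ∀ i j : ℕ, J < j → (i : ℝ) = j * s →
        (P.degW m (P.topOrder m + i) j : ℝ) < P.degW m (P.topOrder m) 0 + j * P.exponent m s)
    {x : ℕ × ℕ} (hx : x ∈ P.principal m) {j : ℕ} (hj : J < j)
    (hr : (x.2 : ℝ) = P.topOrder m + j * s)
    (hne : PowerSeries.coeff (j + x.2) (P.leadCoeff m x) ≠ 0) :
    ((x.1 - m : ℕ) : ℝ) < P.degW m (P.topOrder m) 0 + j * P.exponent m s := by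
  have hj' : (0 : ℝ) < j := by exact_mod_cast (Nat.zero_le J).trans_lt hj
  rcases h.edge_cases hx hr hne with ⟨-, h1⟩ | ⟨i, j₀, hj₀, hjj, hi, h1⟩
  · have h2 : ((x.1 - m : ℕ) : ℝ) ≤ P.degW m (P.topOrder m) 0 := by exact_mod_cast h1
    linarith [show 0 < j * P.exponent m s by positivity]
  · have h2 : ((x.1 - m : ℕ) : ℝ) ≤ P.degW m (P.topOrder m + i) j₀ := by exact_mod_cast h1
    rcases hjj.eq_or_lt with rfl | hlt
    · exact h2.trans_lt (hJ i j₀ hj hi)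
    · have h3 : (j₀ : ℝ) * P.exponent m s < j * P.exponent m s := by gcongr
      linarith [degW_le_exponent (P := P) (m := m) hj₀ hi]

/-- Strictness gives a gap for each of the finitely many small `j`; for large `j` all degrees are at
most `D ≤ jα/2`, which leaves a gap of `jα/2`. -/
theorem Admissible.exists_degree_gap (h : P.Admissible m s ρ) (hα : 0 < P.exponent m s) {J : ℕ}
    (hJ : ∀ i j : ℕ, J < j → (i : ℝ) = j * s →
        (P.degW m (P.topOrder m + i) j : ℝ) < P.degW m (P.topOrder m) 0 + j * P.exponent m s) :
    ∃ η > (0 : ℝ), ∀ x ∈ P.principal m, ∀ j : ℕ, J < j → (x.2 : ℝ) = P.topOrder m + j * s →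
      PowerSeries.coeff (j + x.2) (P.leadCoeff m x) ≠ 0 →
      ((x.1 - m : ℕ) : ℝ) + η * j ≤ P.degW m (P.topOrder m) 0 + j * P.exponent m s := by
  set D := (P.principal m).sup fun x => x.1 - m with hD
  set α := P.exponent m s with hαd
  set d := P.degW m (P.topOrder m) 0 with hd
  obtain ⟨B, hB⟩ := exists_nat_ge ((D : ℝ) / (α / 2))
  rw [div_le_iff₀ (by positivity)] at hB
  obtain ⟨δ, hδ, hgap⟩ := exists_pos_le_of_finset
    ((P.principal m ×ˢ Finset.range B).filter fun y => ((y.1.1 - m : ℕ) : ℝ) < d + y.2 * α)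
    (fun y => d + y.2 * α - ((y.1.1 - m : ℕ) : ℝ)) (fun y hy => by
      have := (Finset.mem_filter.1 hy).2
      linarith)
  have hB1 : (0 : ℝ) < B + 1 := by positivity
  refine ⟨min (α / 2) (δ / (B + 1)), by positivity, fun x hx j hj hr hne => ?_⟩
  have hlt := h.degree_lt hα hJ hx hj hr hne
  have hj0 : (0 : ℝ) ≤ j := by positivity
  by_cases hjB : j < B
  · have h1 := hgap (x, j) (Finset.mem_filter.2
      ⟨Finset.mem_product.2 ⟨hx, Finset.mem_range.2 hjB⟩, hlt⟩)
    have h2 : (j : ℝ) ≤ B + 1 := by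
      have : (j : ℝ) < B := by exact_mod_cast hjB
      linarith
    have h3 : min (α / 2) (δ / (B + 1)) * j ≤ δ := by
      calc min (α / 2) (δ / (B + 1)) * j ≤ δ / (B + 1) * (B + 1) := by
            gcongr
            exact min_le_right _ _
        _ = δ := by field_simp
    simp only at h1
    linarith
  · have h1 : (B : ℝ) ≤ j := by exact_mod_cast not_lt.1 hjB
    have h2 : ((x.1 - m : ℕ) : ℝ) ≤ D := by
      exact_mod_cast Finset.le_sup (f := fun x : ℕ × ℕ => x.1 - m) hx
    have h3 : min (α / 2) (δ / (B + 1)) * j ≤ α / 2 * j := by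
      gcongr
      exact min_le_left _ _
    have h4 : (B : ℝ) * (α / 2) ≤ j * (α / 2) := by gcongr
    have h5 : (0 : ℝ) ≤ d := by positivity
    linarith

/-! ### Automorphisms of `G_s(a(n+1)^{-α})` -/

theorem norm_edge_le {A C : ℝ} (hA : 0 ≤ A) (hC : 0 ≤ C)
    (hAC : ∀ x ∈ P.principal m, ∀ j : ℕ,
      ‖PowerSeries.coeff (j + x.2) (P.leadCoeff m x)‖ ≤ A * C ^ j * Real.Gamma (1 + s * j))
    (n r j : ℕ) {E : ℝ} (hE : ∀ x ∈ P.principal m, x.2 = r →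
      PowerSeries.coeff (j + x.2) (P.leadCoeff m x) ≠ 0 → ((x.1 - m : ℕ) : ℝ) ≤ E) :
    ‖PowerSeries.coeff (j + r) (P.reduced m n r)‖ ≤
      (P.principal m).card * (A * C ^ j * Real.Gamma (1 + s * j) * (1 + (n : ℝ)) ^ E) := by
  have gj := gamma_pos s j
  refine norm_coeff_reduced_le n r (j + r) (by positivity) ?_
  rintro x hx rfl
  by_cases h0 : PowerSeries.coeff (j + x.2) (P.leadCoeff m x) = 0
  · rw [h0, norm_zero, zero_mul]
    positivity
  · have h1 : (1 + (n : ℝ)) ^ (x.1 - m) ≤ (1 + (n : ℝ)) ^ E := by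
      rw [← Real.rpow_natCast]
      exact Real.rpow_le_rpow_of_exponent_le (by linarith [show (0 : ℝ) ≤ n by positivity])
        (hE x hx rfl h0)
    gcongr
    exact hAC x hx j

theorem rpow_add_mul_natCast {y : ℝ} (hy : 0 < y) (d j : ℕ) (β : ℝ) :
    y ^ ((d : ℝ) + j * β) = y ^ d * (y ^ β) ^ j := by
  rw [Real.rpow_add hy, Real.rpow_natCast, mul_comm (j : ℝ), Real.rpow_mul hy.le,
    Real.rpow_natCast]

theorem Admissible.odeAct_injective (h : P.Admissible m s ρ) (N : ℕ) (u : SeriesZ)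
    (hu : odeAct (P.reduced m N) u = 0) : u = 0 := by
  ext k
  exact GevreyDisc.odeAct_injective (h.coeff_reduced_eq_zero N) (h.odeSymbol_ne_zero N)
    (K := k + 1) (fun i _ => by simp [hu]) k (Nat.lt_succ_self k)

theorem Admissible.odeAct_surjective (h : P.Admissible m s ρ) (N : ℕ) (f : SeriesZ) :
    ∃ u, odeAct (P.reduced m N) u = f :=
  GevreyDisc.odeAct_surjective (h.coeff_reduced_eq_zero N) (h.odeSymbol_ne_zero N) f

theorem Admissible.exists_le_odeSymbol (h : P.Admissible m s ρ) (n : ℕ) :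
    ∃ C₀ > (0 : ℝ), ∀ k, C₀ ≤ ‖odeSymbol (P.reduced m n) 0 k‖ := by
  obtain ⟨C₀, hC₀, hW⟩ := h.resonance
  exact ⟨C₀, hC₀, fun k => by rw [h.odeSymbol_zero]; exact hW n k⟩

/-- For a single `n` no uniformity is needed: `X = 1`, and `Q` is chosen so that the edge bound is
the general coefficient bound. This handles the small `n`. -/
theorem Admissible.exists_radius (h : P.Admissible m s ρ) (n : ℕ) :
    ∃ ε > (0 : ℝ), ∀ r : ℝ, 0 < r → r ≤ ε → ∀ u,
      odeAct (P.reduced m n) u ∈ gevreyDisc s r → u ∈ gevreyDisc s r := by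
  obtain ⟨A, hA, C, hC, hAC⟩ := h.exists_coeff_bound
  obtain ⟨p, hp, hmax⟩ := exists_top_coeff (h.odeSymbol_ne_zero n 0)
  have hb := h.odeBounds hA hC hAC hp hmax
  have hT := norm_pos_iff.2 hp
  set A' : ℝ := (P.principal m).card *
    (A * (1 + (n : ℝ)) ^ ((P.principal m).sup fun x => x.1 - m)) with hA'
  have hA'0 : 0 ≤ A' := by positivity
  obtain ⟨ε, hε, hr⟩ := GevreyDisc.exists_radius s ((P.principal m).sup Prod.snd)
    (Q := A' / ‖PowerSeries.coeff p (P.reduced m n p)‖) (C := C) (by positivity) hC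
  refine ⟨ε, hε, fun r hr0 hrε => hr _ p A' 1 hA'0 le_rfl hb (h.coeff_reduced_eq_zero n)
    (h.exists_le_odeSymbol n) (fun r j _ _ => (hb.bound r j).trans (le_of_eq ?_)) r hr0 (by simpa)⟩
  rw [mul_one]
  field_simp

/-- Here `X = (1+n)^α`. The constant `Q` is independent of `n` because the coefficient at the vertex
is at least `|L|(1+n)^d / 2`, `d` being its degree in `n`. -/
theorem Admissible.exists_uniform_radius (h : P.Admissible m s ρ) :
    ∃ ε > (0 : ℝ), ∃ N : ℕ, ∀ n ≥ N, ∀ r : ℝ, 0 < r → r ≤ ε / (1 + (n : ℝ)) ^ P.exponent m s →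
      ∀ u, odeAct (P.reduced m n) u ∈ gevreyDisc s r → u ∈ gevreyDisc s r := by
  obtain ⟨A, hA, C, hC, hAC⟩ := h.exists_coeff_bound
  obtain ⟨L, hL, hlim⟩ := h.tendsto_top
  have hL' := norm_pos_iff.2 hL
  obtain ⟨ε, hε, hr⟩ := GevreyDisc.exists_radius s ((P.principal m).sup Prod.snd)
    (Q := 2 * (P.principal m).card * A / ‖L‖) (C := C) (by positivity) hC
  obtain ⟨N, hN⟩ := Filter.eventually_atTop.1
    (h.eventually_top_ne_zero.and (eventually_norm_bounds hL hlim))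
  refine ⟨ε, hε, N, fun n hn r hr0 hrε => ?_⟩
  obtain ⟨htop, hlow, -⟩ := hN n hn
  have hn1 : (1 : ℝ) ≤ 1 + n := by linarith [show (0 : ℝ) ≤ n by positivity]
  have hb := h.odeBounds hA hC hAC htop fun r hr => h.le_topOrder_of_reduced hr
  refine hr _ _ _ ((1 + (n : ℝ)) ^ P.exponent m s) (by positivity)
    (Real.one_le_rpow hn1 exponent_nonneg) hb (h.coeff_reduced_eq_zero n)
    (h.exists_le_odeSymbol n) (fun r j hj hrj => ?_) r hr0 hrε
  refine (norm_edge_le hA hC hAC n r j (E := P.degW m (P.topOrder m) 0 + j * P.exponent m s)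
    fun x hx hxr hne => h.degree_le hx (by rw [hxr]; exact hrj) hne).trans ?_
  rw [rpow_add_mul_natCast (by linarith)]
  have gj := gamma_pos s j
  set X := (1 + (n : ℝ)) ^ P.exponent m s
  have hX : 0 ≤ X := by positivity
  calc (P.principal m).card * (A * C ^ j * Real.Gamma (1 + s * j) *
        ((1 + (n : ℝ)) ^ P.degW m (P.topOrder m) 0 * X ^ j))
      = (P.principal m).card * A / ‖L‖ * (C * X) ^ j * Real.Gamma (1 + s * j) *
        (‖L‖ * (1 + (n : ℝ)) ^ P.degW m (P.topOrder m) 0) := by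
        rw [mul_pow]; field_simp
    _ ≤ (P.principal m).card * A / ‖L‖ * (C * X) ^ j * Real.Gamma (1 + s * j) *
        (2 * ‖PowerSeries.coeff (P.topOrder m) (P.reduced m n (P.topOrder m))‖) :=
        mul_le_mul_of_nonneg_left hlow (by positivity)
    _ = _ := by ring

theorem Admissible.exists_isAutomorphismOn (h : P.Admissible m s ρ) : ∃ a : ℝ, 0 < a ∧
    IsAutomorphismOn (P.actInt m)
      (gevreyDiscSeries s fun n => a * ((n : ℝ) + 1) ^ (-P.exponent m s)) := by
  obtain ⟨ε, hε, N, hN⟩ := h.exists_uniform_radius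
  choose ε' hε' hr using h.exists_radius
  obtain ⟨δ, hδ, hδε⟩ := exists_pos_le_of_finset (Finset.range N) ε' fun n _ => hε' n
  have hα := exponent_nonneg (P := P) (m := m) (s := s)
  have hρ := h.radius_pos
  have ha : 0 < min ρ (min ε δ) := by positivity
  -- `ρ` is for the coefficients of `P`, `ε` for `n ≥ N`, and `δ` for the finitely many smaller `n`.
  set a := min ρ (min ε δ) with had
  have hle : ∀ n : ℕ, a * ((n : ℝ) + 1) ^ (-P.exponent m s) ≤ a := fun n => by
    refine mul_le_of_le_one_right ha.le (Real.rpow_le_one_of_one_le_of_nonpos ?_ (by linarith))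
    linarith [show (0 : ℝ) ≤ n by positivity]
  have hpos : ∀ n : ℕ, 0 < a * ((n : ℝ) + 1) ^ (-P.exponent m s) := fun n => by positivity
  refine ⟨a, ha, isAutomorphismOn_actInt hpos (fun n => (hle n).trans (min_le_left _ _)) ?_
    h.coeff_mem h.timeOrder h.odeAct_injective fun n f hf => ?_⟩
  · intro i j hij
    have hij' : (i : ℝ) ≤ j := by exact_mod_cast hij
    exact mul_le_mul_of_nonneg_left (Real.rpow_le_rpow_of_nonpos (by positivity)
      (by linarith) (by linarith)) ha.le
  · obtain ⟨u, hu⟩ := h.odeAct_surjective n f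
    refine ⟨u, ?_, hu⟩
    rw [← hu] at hf
    by_cases hn : n < N
    · exact hr n _ (hpos n) ((hle n).trans (((min_le_right _ _).trans (min_le_right _ _)).trans
        (hδε n (Finset.mem_range.2 hn)))) u hf
    · refine hN n (not_lt.1 hn) _ (hpos n) ?_ u hf
      rw [Real.rpow_neg (by positivity), add_comm (n : ℝ), div_eq_mul_inv]
      gcongr
      exact (min_le_right _ _).trans (min_le_left _ _)

/-! ### Sharpness of the exponent. -/

theorem tendsto_rpow_atTop_of_pos {β : ℝ} (hβ : 0 < β) :
    Filter.Tendsto (fun n : ℕ => (1 + (n : ℝ)) ^ β) Filter.atTop Filter.atTop :=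
  (tendsto_rpow_atTop hβ).comp
    (Filter.tendsto_atTop_add_const_left _ _ tendsto_natCast_atTop_atTop)

theorem Admissible.not_isAutomorphismOn (h : P.Admissible m s ρ) (hα : 0 < P.exponent m s)
    {α' : ℝ} (hα' : α' < P.exponent m s) {a : ℝ} (ha : 0 < a) :
    ¬ IsAutomorphismOn (P.actInt m)
      (gevreyDiscSeries s fun n => a * ((n : ℝ) + 1) ^ (-α')) := by
  intro haut
  obtain ⟨A, hA, C, hC, hAC⟩ := h.exists_coeff_bound
  obtain ⟨L, hL, hlim⟩ := h.tendsto_top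
  have hL0 := norm_pos_iff.2 hL
  obtain ⟨l, J, hJ1, hl, hJα, hJmax⟩ := exists_last_attained hα
  obtain ⟨η, hη, hgap⟩ := h.exists_degree_gap hα hJmax
  set α := P.exponent m s with hαd
  set p := P.topOrder m with hp
  set d := P.degW m p 0 with hd
  have hJpos : (0 : ℝ) < J := by exact_mod_cast hJ1
  obtain ⟨y, hy, hy2, hyd⟩ : ∃ y ∈ P.principalAt m J, y.2 = p + l ∧
      y.1 - m = P.degW m (p + l) J := by
    refine exists_of_degW_pos ?_
    have : (0 : ℝ) < P.degW m (p + l) J := by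
      rw [hJα]
      have : (0 : ℝ) ≤ d := by positivity
      linarith [show 0 < J * α by positivity]
    exact_mod_cast this
  obtain ⟨hyp, hyJ⟩ := mem_principalAt.1 hy
  have hyne : PowerSeries.coeff (J + (p + l)) (P.leadCoeff m y) ≠ 0 := by
    rw [← hy2, add_comm, ← hyJ]
    exact coeff_ordZ_ne_zero hyp
  -- As `α` is attained at `J`, the pair `y` has the largest degree in `n` among all that contribute
  -- to this coefficient.
  have hylim := tendsto_coeff_reduced hyp (J + (p + l)) fun z hz hz2 hne => by
    rw [hy2] at hz2
    have h1 := h.degree_le hz (j := J) (by rw [hz2, ← hl]; push_cast; rfl) (by rwa [hz2])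
    rw [← hJα, ← hyd] at h1
    exact_mod_cast h1
  rw [hy2, hyd] at hylim
  set L' := PowerSeries.coeff (J + (p + l)) (P.leadCoeff m y) with hL'
  have hL'0 := norm_pos_iff.2 hyne
  -- In `q`, the `4` collects a factor `2` from the lower bound for the edge coefficient and a
  -- factor `2` from the upper bound for the vertex coefficient.
  obtain ⟨x, hx, y₀, hy₀, hscale⟩ := exists_scale s ((P.principal m).sup Prod.snd) p J l hJ1 hl
    (Q := 2 * (P.principal m).card * A / ‖L‖) (C := C) (q := ‖L'‖ / (4 * ‖L‖))
    (by positivity) hC (by positivity)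
  -- With `X = (1+n)^α` and `Y = (1+n)^{-η}`, the three conditions say `Y ≤ y₀`, `X⁻¹ ≤ y₀`, and
  -- that `x/X` is below the radius `a(n+1)^{-α'}`.
  have ev1 := (tendsto_rpow_atTop_of_pos hη).eventually_ge_atTop y₀⁻¹
  have ev2 := (tendsto_rpow_atTop_of_pos hα).eventually_ge_atTop y₀⁻¹
  have ev3 := (tendsto_rpow_atTop_of_pos (sub_pos.2 hα')).eventually_gt_atTop (x / a)
  obtain ⟨n, htop, ⟨hlow, hup⟩, ⟨hlow', -⟩, hn1, hn2, hn3⟩ := (h.eventually_top_ne_zero.and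
    ((eventually_norm_bounds hL hlim).and ((eventually_norm_bounds hyne hylim).and
      (ev1.and (ev2.and ev3))))).exists
  have hb := h.odeBounds hA hC hAC htop fun r hr => h.le_topOrder_of_reduced hr
  have hn0 : (0 : ℝ) < 1 + n := by positivity
  set X := (1 + (n : ℝ)) ^ α with hX
  set T := ‖PowerSeries.coeff p (P.reduced m n p)‖ with hT
  have hX0 : 0 < X := by positivity
  have hYinv : (1 + (n : ℝ)) ^ (-η) = ((1 + (n : ℝ)) ^ η)⁻¹ := Real.rpow_neg hn0.le η
  have hnorm : ∀ j : ℕ, ∀ Z : ℝ, 0 ≤ Z → (P.principal m).card * (A * C ^ j * Real.Gamma (1 + s * j) *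
      ((1 + (n : ℝ)) ^ d * Z ^ j)) ≤ 2 * (P.principal m).card * A / ‖L‖ * (C * Z) ^ j *
        Real.Gamma (1 + s * j) * T := by
    intro j Z hZ
    have gj := gamma_pos s j
    calc (P.principal m).card * (A * C ^ j * Real.Gamma (1 + s * j) * ((1 + (n : ℝ)) ^ d * Z ^ j))
        = (P.principal m).card * A / ‖L‖ * (C * Z) ^ j * Real.Gamma (1 + s * j) *
          (‖L‖ * (1 + (n : ℝ)) ^ d) := by rw [mul_pow]; field_simp
      _ ≤ (P.principal m).card * A / ‖L‖ * (C * Z) ^ j * Real.Gamma (1 + s * j) * (2 * T) :=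
          mul_le_mul_of_nonneg_left hlow (by positivity)
      _ = _ := by ring
  obtain ⟨K, hK⟩ := hscale (P.reduced m n) _ X ((1 + (n : ℝ)) ^ (-η)) (by positivity) hX0
    (by positivity) (by rw [hYinv]; exact inv_le_of_inv_le₀ hy₀ hn1)
    (inv_le_of_inv_le₀ hy₀ hn2) hb (h.coeff_reduced_eq_zero n) (h.odeSymbol_ne_zero n)
    (fun r j hj _ hrj => by
      refine (norm_edge_le hA hC hAC n r j (E := d + j * α)
        fun x hx hxr hne => h.degree_le hx (by rw [hxr]; exact hrj) hne).trans ?_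
      rw [rpow_add_mul_natCast hn0]
      exact hnorm j X hX0.le)
    (fun r j hj hrj => by
      refine (norm_edge_le hA hC hAC n r j (E := d + j * (α + -η)) fun x hx hxr hne => by
        have := hgap x hx j hj (by rw [hxr]; exact hrj) hne
        linarith).trans ?_
      rw [rpow_add_mul_natCast hn0, Real.rpow_add hn0, mul_assoc C X]
      exact hnorm j _ (by positivity))
    (by
      have h1 : (1 + (n : ℝ)) ^ P.degW m (p + l) J = (1 + (n : ℝ)) ^ d * X ^ J := by
        rw [← rpow_add_mul_natCast hn0, ← Real.rpow_natCast, hJα]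
      rw [h1] at hlow'
      calc ‖L'‖ / (4 * ‖L‖) * X ^ J * T
          ≤ ‖L'‖ / (4 * ‖L‖) * X ^ J * (2 * ‖L‖ * (1 + (n : ℝ)) ^ d) := by gcongr
        _ = (‖L'‖ * ((1 + (n : ℝ)) ^ d * X ^ J)) / 2 := by field_simp; ring
        _ ≤ _ := by linarith)
  obtain ⟨u, hu, huK⟩ := exists_mem_of_isAutomorphismOn (fun n => by positivity) h.timeOrder
    h.odeAct_injective haut n K
  refine hK u huK _ ?_ hu
  rw [add_comm (n : ℝ), div_lt_iff₀ hX0, mul_assoc, ← Real.rpow_add hn0, neg_add_eq_sub]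
  rwa [div_lt_iff₀ ha, mul_comm] at hn3

end Operator

end GevreyDisc

end

theorem theorem2
    (s : ℝ≥0) (P : GevreyDisc.Operator) (m : ℕ) (ρ : ℝ) (hρ : 0 < ρ)
    (hcoeff : ∀ x ∈ P.support, ∀ n : ℕ, PowerSeries.coeff n (P x) ∈ GevreyDisc.gevreyDisc s ρ)
    (hm : P.HasTimeOrder m)
    (ha : ∀ n : ℕ, GevreyDisc.IsLowerOrdinate (GevreyDisc.newtonPolygon (P.reduced m n)) 0)
    (hb : ∀ n : ℕ, (s : ℝ≥0∞)⁻¹ ≤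
      GevreyDisc.firstPositiveSlope (GevreyDisc.newtonPolygon (P.reduced m n)))
    (hc : ∃ C₀ : ℝ, 0 < C₀ ∧ ∀ n k : ℕ, C₀ ≤ ‖P.resonance m n k‖) :
    GevreyDisc.IsAutomorphism (P.actInt m) ∧
    (∃ a : ℝ, 0 < a ∧ GevreyDisc.IsAutomorphismOn (P.actInt m)
      (GevreyDisc.gevreyDiscSeries s fun n => a * ((n : ℝ) + 1) ^ (-P.exponent m s))) ∧
    (0 < P.exponent m s → ∀ α' : ℝ, α' < P.exponent m s → ∀ a : ℝ, 0 < a →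
      ¬ GevreyDisc.IsAutomorphismOn (P.actInt m)
        (GevreyDisc.gevreyDiscSeries s fun n => a * ((n : ℝ) + 1) ^ (-α'))) := by
  have h : P.Admissible m s ρ := ⟨hρ, hcoeff, hm, ha, hb, hc⟩
  exact ⟨GevreyDisc.Operator.isAutomorphism_actInt hm h.odeAct_injective h.odeAct_surjective,
    h.exists_isAutomorphismOn, fun hα _ hα' _ ha' => h.not_isAutomorphismOn hα hα' ha'⟩
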